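/- Let $M$ be a connected smooth ($C^\infty$, Hausdorff, second countable) manifold of dimension $2n+1$ with a contact form $\alpha$, i.e. a smooth 1-form with $\alpha\wedge(d\alpha)^n\neq 0$ everywhere. Let $\mathcal H=\ker\alpha$, and let $Z$ be the Reeb vector field ($\alpha(Z)=1$, $i_Zd\alpha=0$). For a covector $\eta$ put $\hat\eta=\eta-\eta(Z)\alpha$, and let $\Lambda^\sharp(\eta)$ be the unique vector in $\mathcal H$ with $-i_{\Lambda^\sharp(\eta)}d\alpha=\hat\eta$. For a smooth function $f$ on an open set let $X_f=fZ+\Lambda^\sharp(df)$, and let $[f,g]=\alpha([X_f,X_g])$ be the Jacobi bracket. For a field $\mathcal D$ of tangent subspaces with annihilator $\mathcal D^0$ put $\mathcal D^\perp=\mathbb RZ\oplus\Lambda^\sharp(\mathcal D^0)$. A (local) first integral of $\mathcal D$ is a smooth function $f$ on an open set with $df|_{\mathcal D}=0$ (constants allowed); $\mathcal D$ is $\alpha$-complete if the Jacobi bracket of any two first integrals of $\mathcal D$ on an open set is again a first integral of $\mathcal D$ there. A foliation is identified with its tangent distribution, and a distribution is completely integrable if it is the tangent distribution of a foliation. A foliation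 $\mathcal F$ is pre-isotropic if $\mathcal F$ is transversal to $\mathcal H$ and $\mathcal F\cap\mathcal H$ is an isotropic subbundle of $\mathcal H$ with respect to $d\alpha$. Let $\mathcal F$ be a foliation of codimension $p$ on $M$ containing the Reeb field $Z$, let $\mathcal G=\mathcal F\cap\mathcal H$, $\mathcal E=\mathcal F^\perp$, and $r=2n-p$. (i) If $\mathcal F$ is pre-isotropic, then $\mathcal G$, $\mathcal F$, $\mathcal E$ are smooth distributions of ranks $r$, $r+1$, $p+1$, and $$\mathcal G=\mathcal F\cap\mathcal H\ \subset\ \mathcal F\ \subset\ \mathcal E=\mathcal G^\perp=\mathcal F^\perp .\qquad(*)$$ Conversely, if $(*)$ holds, then $\mathcal F$ is pre-isotropic. Now let $\mathcal F$ be pre-isotropic. Then $\mathcal G$ is a foliation (of codimension $p+1$), and: (ii) $\mathcal F$ is $\alpha$-complete if and only if $\mathcal E$ is completely integrable, and likewise $\mathcal G$ is $\alpha$-complete if and only if $\mathcal E$ is completely integrable. If $\mathcal E$ is completely integrable and $f_1,\dots,f_p$ and $y_1,\dots,y_r$ are any first integrals of $\mathcal F$ and of $\mathcal E$, respectively, on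 an open set $U$, then on $U$, for all indices, $$[f_i,y_j]=0,\quad [y_j,y_k]=0,\quad [f_i,1]=0,\quad [y_j,1]=0 .$$ (iii) If $\mathcal F$ is $\alpha$-complete, then each leaf of $\mathcal F$ and each leaf of $\mathcal G$ has an affine structure, i.e. an atlas of charts, compatible with the smooth structure of the leaf, whose transition maps are locally affine. -/

import Mathlib

open scoped Manifold ContDiff Topology
open Bundle Set

universe u

noncomputable section

namespace ContactFoliation

section Basic

variable {n : ℕ} {M : Type u} [TopologicalSpace M]
  [ChartedSpace (EuclideanSpace ℝ (Fin (2 * n + 1))) M]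

/-- Pointwise 1-forms on a `(2n+1)`-dimensional manifold (no regularity imposed). -/
abbrev OneForm (n : ℕ) (M : Type u) [TopologicalSpace M]
    [ChartedSpace (EuclideanSpace ℝ (Fin (2 * n + 1))) M] : Type u :=
  ∀ x : M, TangentSpace (𝓡 (2 * n + 1)) x →L[ℝ] ℝ

/-- Fields of tangent subspaces (no regularity and no constancy of the rank imposed). -/
abbrev PlaneField (n : ℕ) (M : Type u) [TopologicalSpace M]
    [ChartedSpace (EuclideanSpace ℝ (Fin (2 * n + 1))) M] : Type u :=
  ∀ x : M, Submodule ℝ (TangentSpace (𝓡 (2 * n + 1)) x)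

/-- The expression of a 1-form in the preferred chart at `x`, as a function on the model space. -/
def inChart (α : OneForm n M) (x : M) (e : EuclideanSpace ℝ (Fin (2 * n + 1))) :
    EuclideanSpace ℝ (Fin (2 * n + 1)) →L[ℝ] ℝ :=
  (α ((extChartAt (𝓡 (2 * n + 1)) x).symm e)).comp
    (mfderiv 𝓘(ℝ, EuclideanSpace ℝ (Fin (2 * n + 1))) (𝓡 (2 * n + 1))
      (extChartAt (𝓡 (2 * n + 1)) x).symm e)

/-- The exterior derivative `dα` of a 1-form at `x`, computed in the preferred chart at `x` by
`dβ(v, w) = (D_v β)(w) - (D_w β)(v)`; thus `dα(X, Y) = X(α(Y)) - Y(α(X)) - α([X, Y])`. -/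
def extDer (α : OneForm n M) (x : M) (v w : TangentSpace (𝓡 (2 * n + 1)) x) : ℝ :=
  let B : EuclideanSpace ℝ (Fin (2 * n + 1)) →L[ℝ]
      EuclideanSpace ℝ (Fin (2 * n + 1)) →L[ℝ] ℝ :=
    fderiv ℝ (inChart α x) (extChartAt (𝓡 (2 * n + 1)) x x)
  let c : TangentSpace (𝓡 (2 * n + 1)) x →L[ℝ] EuclideanSpace ℝ (Fin (2 * n + 1)) :=
    mfderiv (𝓡 (2 * n + 1)) 𝓘(ℝ, EuclideanSpace ℝ (Fin (2 * n + 1)))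
      (extChartAt (𝓡 (2 * n + 1)) x) x
  B (c v) (c w) - B (c w) (c v)

/-- The value on `v 0, …, v (2n)` of `α ∧ (dα)ⁿ` at `x`, up to the positive factor relating the
antisymmetrized sum to the normalized wedge product. -/
def contactVolume (α : OneForm n M) (x : M)
    (v : Fin (2 * n + 1) → TangentSpace (𝓡 (2 * n + 1)) x) : ℝ :=
  ∑ σ : Equiv.Perm (Fin (2 * n + 1)),
    ((Equiv.Perm.sign σ : ℤ) : ℝ) *
      (α x (v (σ ⟨0, by omega⟩)) *
        ∏ i : Fin n, extDer α x (v (σ ⟨2 * i + 1, by omega⟩)) (v (σ ⟨2 * i + 2, by omega⟩)))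

/-- `α` is a contact form: a smooth 1-form with `α ∧ (dα)ⁿ` nowhere zero. -/
structure IsContactForm [IsManifold (𝓡 (2 * n + 1)) ∞ M] (α : OneForm n M) : Prop where
  smooth : ContMDiff (𝓡 (2 * n + 1))
    ((𝓡 (2 * n + 1)).prod 𝓘(ℝ, EuclideanSpace ℝ (Fin (2 * n + 1)) →L[ℝ] ℝ)) ∞
    (fun x ↦ TotalSpace.mk' (EuclideanSpace ℝ (Fin (2 * n + 1)) →L[ℝ] ℝ)
      (E := fun y : M ↦ TangentSpace (𝓡 (2 * n + 1)) y →L[ℝ] ℝ) x (α x))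
  nonvanishing : ∀ x, ∃ v, contactVolume α x v ≠ 0

/-- The contact (horizontal) distribution `ℋ = ker α`. -/
def horizontal (α : OneForm n M) : PlaneField n M := fun x ↦ LinearMap.ker (α x).toLinearMap

/-- The Reeb vector field `Z`: the unique field with `α(Z) = 1` and `i_Z dα = 0`. -/
def reeb (α : OneForm n M) (x : M) : TangentSpace (𝓡 (2 * n + 1)) x :=
  Classical.epsilon fun z ↦ α x z = 1 ∧ ∀ w, extDer α x z w = 0

/-- `α^♯ η` for a semi-basic covector `η` (that is, `η(Z) = 0`): the unique horizontal vector `v`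
with `-i_v dα = η`. -/
def alphaSharp (α : OneForm n M) (x : M) (η : TangentSpace (𝓡 (2 * n + 1)) x →L[ℝ] ℝ) :
    TangentSpace (𝓡 (2 * n + 1)) x :=
  Classical.epsilon fun v ↦ α x v = 0 ∧ ∀ w, -(extDer α x v w) = η w

/-- The semi-basic part `η̂ = η - η(Z) α` of a covector. -/
def semiBasic (α : OneForm n M) (x : M) (η : TangentSpace (𝓡 (2 * n + 1)) x →L[ℝ] ℝ) :
    TangentSpace (𝓡 (2 * n + 1)) x →L[ℝ] ℝ :=
  η - (η (reeb α x)) • α x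

/-- The morphism `Λ^♯ : T*M → TM` of the Jacobi bivector `Λ(η, ξ) = dα(α^♯ η̂, α^♯ ξ̂)`. One has
`ξ(α^♯ η̂) = ξ̂(α^♯ η̂) = dα(α^♯ η̂, α^♯ ξ̂)` for all `ξ`, whence `Λ^♯ η = α^♯ η̂`. -/
def lambdaSharp (α : OneForm n M) (x : M) (η : TangentSpace (𝓡 (2 * n + 1)) x →L[ℝ] ℝ) :
    TangentSpace (𝓡 (2 * n + 1)) x :=
  alphaSharp α x (semiBasic α x η)

/-- The differential of a real function at `x`, as a covector. -/
def differential (f : M → ℝ) (x : M) : TangentSpace (𝓡 (2 * n + 1)) x →L[ℝ] ℝ :=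
  mfderiv (𝓡 (2 * n + 1)) 𝓘(ℝ, ℝ) f x

/-- The contact Hamiltonian vector field `X_f = f Z + Λ^♯(df)`. -/
def contactField (α : OneForm n M) (f : M → ℝ) (x : M) : TangentSpace (𝓡 (2 * n + 1)) x :=
  f x • reeb α x + lambdaSharp α x (differential f x)

/-- The Jacobi bracket `[f, g] = α([X_f, X_g])`. -/
def jacobiBracket (α : OneForm n M) (f g : M → ℝ) (x : M) : ℝ :=
  α x (VectorField.mlieBracket (𝓡 (2 * n + 1)) (contactField α f) (contactField α g) x)

/-- The pseudo-orthogonal `𝒟^⊥ = ℝZ ⊕ Λ^♯(𝒟⁰)`, where `𝒟⁰` is the annihilator of `𝒟`. -/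
def pseudoOrth (α : OneForm n M) (D : PlaneField n M) : PlaneField n M := fun x ↦
  Submodule.span ℝ {reeb α x} ⊔
    Submodule.span ℝ (lambdaSharp α x '' {η | ∀ v ∈ D x, η v = 0})

/-- The intersection `𝒟 ∩ ℋ`. -/
def horizontalPart (α : OneForm n M) (D : PlaneField n M) : PlaneField n M := fun x ↦
  D x ⊓ horizontal α x

/-- `D` is a smooth distribution (a vector subbundle of the tangent bundle) of rank `k`: locally,
it has a frame of `k` smooth vector fields. -/
def IsDistribution [IsManifold (𝓡 (2 * n + 1)) ∞ M] (D : PlaneField n M) (k : ℕ) : Prop :=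
  ∀ x : M, ∃ U : Set M, IsOpen U ∧ x ∈ U ∧
    ∃ X : Fin k → ∀ y : M, TangentSpace (𝓡 (2 * n + 1)) y,
      (∀ i, ContMDiffOn (𝓡 (2 * n + 1)) (𝓡 (2 * n + 1)).tangent ∞
        (fun y ↦ (⟨y, X i y⟩ : TangentBundle (𝓡 (2 * n + 1)) M)) U) ∧
      ∀ y ∈ U, LinearIndependent ℝ (fun i ↦ X i y) ∧
        D y = Submodule.span ℝ (range fun i ↦ X i y)

/-- `D` is (the tangent distribution of) a smooth foliation of codimension `q`: locally, it is the
kernel of the differential of a smooth submersion to `ℝ^q`. -/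
def IsFoliation (D : PlaneField n M) (q : ℕ) : Prop :=
  ∀ x : M, ∃ U : Set M, IsOpen U ∧ x ∈ U ∧ ∃ f : M → EuclideanSpace ℝ (Fin q),
    ContMDiffOn (𝓡 (2 * n + 1)) (𝓡 q) ∞ f U ∧
    ∀ y ∈ U, Function.Surjective (mfderiv (𝓡 (2 * n + 1)) (𝓡 q) f y) ∧
      D y = LinearMap.ker (mfderiv (𝓡 (2 * n + 1)) (𝓡 q) f y).toLinearMap

/-- `D` is completely integrable: it is the tangent distribution of a smooth foliation. -/
def IsCompletelyIntegrable (D : PlaneField n M) : Prop := ∃ q : ℕ, IsFoliation D q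

/-- `f` is a smooth first integral of `D` on the open set `U` (constants are allowed). -/
def IsFirstIntegralOn (D : PlaneField n M) (U : Set M) (f : M → ℝ) : Prop :=
  ContMDiffOn (𝓡 (2 * n + 1)) 𝓘(ℝ, ℝ) ∞ f U ∧ ∀ x ∈ U, ∀ v ∈ D x, differential f x v = 0

/-- `D` is `α`-complete: the Jacobi bracket of two (local) first integrals is a first integral. -/
def IsAlphaComplete (α : OneForm n M) (D : PlaneField n M) : Prop :=
  ∀ U : Set M, IsOpen U → ∀ f g : M → ℝ, IsFirstIntegralOn D U f → IsFirstIntegralOn D U g →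
    IsFirstIntegralOn D U (jacobiBracket α f g)

/-- The conditions for a foliation `F` to be pre-isotropic: `F` is transversal to `ℋ`, and `F ∩ ℋ`
is isotropic, that is, contained in its `dα`-orthogonal complement in `ℋ`. By transversality, the
intersection `F ∩ ℋ` has constant rank and is a smooth subbundle of `ℋ`. -/
structure IsPreIsotropic (α : OneForm n M) (F : PlaneField n M) : Prop where
  transversal : ∀ x, F x ⊔ horizontal α x = ⊤
  isotropic : ∀ x, ∀ u ∈ horizontalPart α F x, ∀ v ∈ horizontalPart α F x, extDer α x u v = 0

/-- The flag `𝒢 = F ∩ ℋ ⊆ F ⊆ 𝒢^⊥ = F^⊥`. -/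
structure SatisfiesFlag (α : OneForm n M) (F : PlaneField n M) : Prop where
  horizontalPart_le : ∀ x, horizontalPart α F x ≤ F x
  le_pseudoOrth : ∀ x, F x ≤ pseudoOrth α (horizontalPart α F) x
  pseudoOrth_eq : pseudoOrth α (horizontalPart α F) = pseudoOrth α F

/-- `ι : L → M` is an integral manifold of `D`: an injective immersion of the `k`-dimensional
manifold `L` whose tangent spaces are exactly the planes of `D`. -/
structure IsIntegralManifold (D : PlaneField n M) {k : ℕ} {L : Type u} [TopologicalSpace L]
    [ChartedSpace (EuclideanSpace ℝ (Fin k)) L] (ι : L → M) : Prop where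
  smooth : ContMDiff (𝓡 k) (𝓡 (2 * n + 1)) ∞ ι
  injective : Function.Injective ι
  immersion : ∀ l, Function.Injective (mfderiv (𝓡 k) (𝓡 (2 * n + 1)) ι l)
  tangent : ∀ l, LinearMap.range (mfderiv (𝓡 k) (𝓡 (2 * n + 1)) ι l).toLinearMap = D (ι l)

/-- `ι : L → M` is a leaf of `D`: a maximal connected integral manifold. -/
structure IsLeaf (D : PlaneField n M) {k : ℕ} {L : Type u} [TopologicalSpace L]
    [ChartedSpace (EuclideanSpace ℝ (Fin k)) L] (ι : L → M) : Prop
    extends IsIntegralManifold D (k := k) ι where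
  connected : ConnectedSpace L
  maximal : ∀ (L' : Type u) [TopologicalSpace L'] [ChartedSpace (EuclideanSpace ℝ (Fin k)) L']
    [IsManifold (𝓡 k) ∞ L'] [ConnectedSpace L'] (ι' : L' → M), IsIntegralManifold D (k := k) ι' →
      (range ι' ∩ range ι).Nonempty → range ι' ⊆ range ι

end Basic

/-- The smooth `k`-manifold `L` has an affine structure: an atlas of charts, compatible with the
smooth structure, whose transition maps are locally affine. -/
def HasAffineStructure (k : ℕ) (L : Type u) [TopologicalSpace L]
    [ChartedSpace (EuclideanSpace ℝ (Fin k)) L] : Prop :=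
  ∃ A : Set (OpenPartialHomeomorph L (EuclideanSpace ℝ (Fin k))),
    A ⊆ IsManifold.maximalAtlas (𝓡 k) ∞ L ∧
    (∀ l : L, ∃ e ∈ A, l ∈ e.source) ∧
    ∀ e ∈ A, ∀ e' ∈ A, ∀ z ∈ (e.symm.trans e').source,
      ∃ a : EuclideanSpace ℝ (Fin k) →ᵃ[ℝ] EuclideanSpace ℝ (Fin k),
        ∀ᶠ w in 𝓝 z, e' (e.symm w) = a w

end ContactFoliation

end

/-! Everything rests on one dictionary. A tangent vector v is determined by α(v) and i_v dα, and X_f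
is the field with α(X_f) = f and i_{X_f} dα = -df + (Zf)α. Hence L_{X_f} α = (Zf)α, and
differentiating this gives [f,g] = X_f g - (Zf)g and [X_f, X_g] = X_{[f,g]} (`jacobiBracket_eq`,
`chartFrame_lieBracket`). On the side of distributions, if D contains Z then D^⊥ consists of the v
with i_v dα = 0 on D, so D^⊥⊥ = D. If D is cut out locally by independent functions f_i, then D^⊥ is
framed by Z = X_1 and the X_{f_i} (`IsContactAt.span_contactField`).

The flag is now linear algebra: since i_Z dα = 0, isotropy of F ∩ ℋ says that dα vanishes on F,
which is F ⊆ F^⊥. It also makes α closed along the leaves of F, so α has a local leafwise primitive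
s; a submersion defining F, together with s, defines G.

Completeness and integrability are linked by a cycle. If F is α-complete, the frame X_1, X_{f_i} of
E is involutive and Frobenius' theorem applies. If E is integrable, the contact fields of first
integrals of G are tangent to E, hence so is X_{[f,g]}, which forces d[f,g] to vanish on G. If G is
α-complete, the bracket of two first integrals of F is killed by G, and by Z because Z commutes with
X_f; so F is α-complete. The brackets in (ii) vanish because X_f lies in E when f is a first
integral of F, while y is constant along E.

For the affine structures, take local first integrals y_j of E that define it. As F = E^⊥ ⊆ E, the
fields X_1, X_{y_j} frame F and commute, so there are functions dual to them, which restrict to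
charts of the leaves. The frames of two such families also commute with each other, so the matrix
relating them is constant along the leaves and the transitions are affine
(`IsAdaptedOn.transition_spec`). On leaves of G the coordinate dual to Z is dropped.

Frobenius' theorem and the leafwise Poincaré lemma both come from total differential equations
(`exists_solution_total`), solved along rays; smooth dependence on parameters comes from the inverse
function theorem in a space of continuous paths. -/

noncomputable section

namespace ContactFoliation

/-! ### Inverse function theorem with a smooth inverse on the whole target. -/

section InverseFunction

variable {E F : Type*} [NormedAddCommGroup E] [NormedSpace ℝ E] [CompleteSpace E]
  [NormedAddCommGroup F] [NormedSpace ℝ F]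

theorem isOpen_setOf_isInvertible : IsOpen {f : E →L[ℝ] F | f.IsInvertible} :=
  ContinuousLinearEquiv.isOpen

/-- The inverse function theorem, with smoothness on a whole neighbourhood. -/
theorem exists_openPartialHomeomorph {f : E → F} {s : Set E} (hs : IsOpen s)
    (hf : ContDiffOn ℝ ∞ f s) {x : E} (hx : x ∈ s) (hinv : (fderiv ℝ f x).IsInvertible) :
    ∃ e : OpenPartialHomeomorph E F, (e : E → F) = f ∧ x ∈ e.source ∧ e.source ⊆ s ∧
      (∀ y ∈ e.source, (fderiv ℝ f y).IsInvertible) ∧ ContDiffOn ℝ ∞ e.symm e.target := by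
  obtain ⟨A, hA⟩ := hinv
  have hfx : ContDiffAt ℝ ∞ f x := hf.contDiffAt (hs.mem_nhds hx)
  have hd : HasFDerivAt f (A : E →L[ℝ] F) x := by
    rw [hA]
    exact (hfx.differentiableAt (by simp)).hasFDerivAt
  have hcont : ContinuousOn (fderiv ℝ f) s := hf.continuousOn_fderiv_of_isOpen hs (by simp)
  have hopen : IsOpen (s ∩ (fderiv ℝ f) ⁻¹' {g | g.IsInvertible}) :=
    hcont.isOpen_inter_preimage hs isOpen_setOf_isInvertible
  -- Shrinking to the open set where the derivative is invertible makes the inverse smooth at every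
  -- point of the target, not just at the image of `x`.
  refine ⟨(hfx.toOpenPartialHomeomorph f hd (by simp)).restrOpen _ hopen, rfl, ?_, ?_, ?_, ?_⟩
  · exact ⟨hfx.mem_toOpenPartialHomeomorph_source hd (by simp), hx, A, hA⟩
  · exact fun y hy ↦ hy.2.1
  · exact fun y hy ↦ hy.2.2
  · intro z hz
    set e := (hfx.toOpenPartialHomeomorph f hd (by simp)).restrOpen _ hopen with he
    have hy : e.symm z ∈ e.source := e.map_target hz
    obtain ⟨B, hB⟩ := hy.2.2
    have hfy : ContDiffAt ℝ ∞ f (e.symm z) := hf.contDiffAt (hs.mem_nhds hy.2.1)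
    refine (e.contDiffAt_symm hz (f₀' := B) ?_ hfy).contDiffWithinAt
    rw [hB]
    exact (hfy.differentiableAt (by simp)).hasFDerivAt

end InverseFunction

/-- A function that is smooth near a point agrees near this point with a smooth function. -/
theorem exists_contDiff_eventuallyEq {E F : Type*} [NormedAddCommGroup E] [NormedSpace ℝ E]
    [FiniteDimensional ℝ E] [NormedAddCommGroup F] [NormedSpace ℝ F] {f : E → F} {s : Set E}
    (hs : IsOpen s) (hf : ContDiffOn ℝ ∞ f s) {x : E} (hx : x ∈ s) :
    ∃ g : E → F, ContDiff ℝ ∞ g ∧ g =ᶠ[𝓝 x] f := by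
  obtain ⟨r, hr, hrs⟩ := Metric.isOpen_iff.1 hs x hx
  -- The cut-off is 1 on the ball of radius `r / 3` and vanishes outside that of radius `r / 2`,
  -- well inside the ball where `f` is smooth.
  let χ : ContDiffBump x := ⟨r / 3, r / 2, by positivity, by linarith⟩
  refine ⟨fun y ↦ χ y • f y, ?_, ?_⟩
  · rw [contDiff_iff_contDiffAt]
    intro y
    by_cases hy : y ∈ Metric.ball x r
    · exact χ.contDiffAt.smul (hf.contDiffAt (hs.mem_nhds (hrs hy)))
    · have hy' : y ∈ (Metric.closedBall x (r / 2))ᶜ := by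
        simp only [Metric.mem_ball, not_lt, mem_compl_iff, Metric.mem_closedBall, not_le] at hy ⊢
        linarith
      refine (contDiffAt_const (c := (0 : F))).congr_of_eventuallyEq ?_
      filter_upwards [Metric.isClosed_closedBall.isOpen_compl.mem_nhds hy'] with z hz
      have : χ z = 0 := χ.zero_of_le_dist (by
        simp only [mem_compl_iff, Metric.mem_closedBall, not_le] at hz; exact hz.le)
      simp [this]
  · filter_upwards [χ.eventuallyEq_one] with y hy
    simp [hy]

/-! ### Smoothness of w ↦ h ∘ w on spaces of continuous maps. -/

section Postcomposition

variable {K : Type*} [TopologicalSpace K] [CompactSpace K]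

/-- The pointwise application of a continuous bilinear map to continuous functions. -/
def pointwiseBilin (K : Type*) [TopologicalSpace K] [CompactSpace K] {B V W : Type*}
    [NormedAddCommGroup B] [NormedSpace ℝ B]
    [NormedAddCommGroup V] [NormedSpace ℝ V] [NormedAddCommGroup W] [NormedSpace ℝ W]
    (L : B →L[ℝ] V →L[ℝ] W) : C(K, B) →L[ℝ] C(K, V) →L[ℝ] C(K, W) :=
  LinearMap.mkContinuous₂
    (LinearMap.mk₂ ℝ (fun (A : C(K, B)) (v : C(K, V)) ↦
        (⟨fun s ↦ L (A s) (v s), by fun_prop⟩ : C(K, W)))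
      (fun _ _ _ ↦ by ext; simp) (fun _ _ _ ↦ by ext; simp) (fun _ _ _ ↦ by ext; simp)
      (fun _ _ _ ↦ by ext; simp)) ‖L‖ (fun A v ↦ by
        rw [ContinuousMap.norm_le _ (by positivity)]
        intro s
        exact (L.le_opNorm₂ _ _).trans (mul_le_mul (mul_le_mul_of_nonneg_left
          (A.norm_coe_le_norm s) L.opNorm_nonneg) (v.norm_coe_le_norm s)
          (norm_nonneg _) (mul_nonneg L.opNorm_nonneg (norm_nonneg _))))

@[simp] theorem pointwiseBilin_apply {B V W : Type*} [NormedAddCommGroup B] [NormedSpace ℝ B]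
    [NormedAddCommGroup V] [NormedSpace ℝ V] [NormedAddCommGroup W] [NormedSpace ℝ W]
    (L : B →L[ℝ] V →L[ℝ] W) (A : C(K, B)) (v : C(K, V)) (s : K) :
    pointwiseBilin K L A v s = L (A s) (v s) := rfl

/-- The derivative of `h` is uniformly continuous near the compact range of `w`, so the mean value
inequality bounds the remainder at all points `s` at once. Writing the derivative as `L (h' v)` lets
the linear term be formed by `pointwiseBilin`. -/
theorem hasFDerivAt_postcomp {B V W : Type*} [NormedAddCommGroup B] [NormedSpace ℝ B]
    [NormedAddCommGroup V] [NormedSpace ℝ V]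
    [NormedAddCommGroup W] [NormedSpace ℝ W] (L : B →L[ℝ] V →L[ℝ] W) (h : C(V, W)) (h' : C(V, B))
    (hh : ∀ v, HasFDerivAt h (L (h' v)) v) (w : C(K, V)) :
    HasFDerivAt (fun w : C(K, V) ↦ h.comp w) (pointwiseBilin K L (h'.comp w)) w := by
  rw [hasFDerivAt_iff_isLittleO_nhds_zero, Asymptotics.isLittleO_iff]
  intro ε hε
  have huc : ∃ δ > 0, ∀ x ∈ range w, ∀ y, dist x y < δ → dist (L (h' x)) (L (h' y)) < ε := by
    have hc : IsCompact (range w) := isCompact_range w.continuous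
    have hcont : Continuous fun x ↦ L (h' x) := by fun_prop
    have := hc.uniformContinuousAt_of_continuousAt _ (fun a _ ↦ hcont.continuousAt)
      (Metric.dist_mem_uniformity hε)
    obtain ⟨δ, hδ, H⟩ := Metric.mem_uniformity_dist.1 this
    exact ⟨δ, hδ, fun x hx y hy ↦ H hy hx⟩
  obtain ⟨δ, hδ, H⟩ := huc
  filter_upwards [Metric.ball_mem_nhds (0 : C(K, V)) hδ] with v hv
  rw [mem_ball_zero_iff] at hv
  rw [ContinuousMap.norm_le _ (by positivity)]
  intro s
  have hvs : ‖v s‖ < δ := (v.norm_coe_le_norm s).trans_lt hv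
  have key : ‖h (w s + v s) - h (w s) - L (h' (w s)) (w s + v s - w s)‖
      ≤ ε * ‖w s + v s - w s‖ := by
    refine (convex_ball (w s) δ).norm_image_sub_le_of_norm_hasFDerivWithin_le'
      (f' := fun v ↦ L (h' v)) (fun x _ ↦ (hh x).hasFDerivWithinAt) (fun x hx ↦ ?_)
      (Metric.mem_ball_self hδ) ?_
    · have := H (w s) (mem_range_self s) x (by rw [dist_comm]; exact hx)
      rw [dist_comm, dist_eq_norm] at this
      exact this.le
    · simpa using hvs
  simp only [add_sub_cancel_left] at key
  refine le_trans ?_ (mul_le_mul_of_nonneg_left (v.norm_coe_le_norm s) hε.le)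
  simpa using key

/-- Postcomposition with a smooth map is smooth on spaces of continuous maps. -/
theorem contDiff_postcomp {V : Type u} {W : Type u} [NormedAddCommGroup V] [NormedSpace ℝ V]
    [NormedAddCommGroup W] [NormedSpace ℝ W] (h : C(V, W)) (hh : ContDiff ℝ ∞ h) :
    ContDiff ℝ ∞ (fun w : C(K, V) ↦ h.comp w) := by
  rw [contDiff_infty]
  intro n
  -- The codomain must vary: the derivative of the postcomposition is again a postcomposition, by
  -- the derivative of `h`, with values in an operator space. A common universe for `V` and `W`
  -- keeps that space in range of the induction.
  induction n generalizing W with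
  | zero =>
    exact contDiff_zero.2 (ContinuousMap.continuous_postcomp h)
  | succ n ih =>
    have hd := contDiff_infty_iff_fderiv.1 hh
    obtain ⟨B, _, _, L, h', hh', hL⟩ : ∃ (B : Type u) (_ : NormedAddCommGroup B)
        (_ : NormedSpace ℝ B) (L : B →L[ℝ] V →L[ℝ] W) (h' : C(V, B)), ContDiff ℝ ∞ h' ∧
        ∀ v, HasFDerivAt h (L (h' v)) v :=
      ⟨V →L[ℝ] W, inferInstance, inferInstance, .id ℝ _, ⟨fderiv ℝ h, hd.2.continuous⟩, hd.2,
        fun v ↦ (hd.1 v).hasFDerivAt⟩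
    push_cast
    exact contDiff_succ_iff_hasFDerivAt.2 ⟨fun w ↦ pointwiseBilin K L (h'.comp w),
      (pointwiseBilin K L).contDiff.comp (ih h' hh'), fun w ↦ hasFDerivAt_postcomp L h h' hL w⟩

end Postcomposition

end ContactFoliation

end

noncomputable section

namespace ContactFoliation

/-! ### The integration operator on continuous paths. -/

section Volterra

variable {Q : Type*} [NormedAddCommGroup Q] [NormedSpace ℝ Q] [CompleteSpace Q]

omit [NormedSpace ℝ Q] [CompleteSpace Q] in
theorem continuous_extend (v : C(unitInterval, Q)) :
    Continuous fun s : ℝ ↦ v (projIcc 0 1 zero_le_one s) :=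
  v.continuous.comp continuous_projIcc

theorem hasDerivAt_primitive (v : C(unitInterval, Q)) (t : ℝ) :
    HasDerivAt (fun t : ℝ ↦ ∫ s in (0 : ℝ)..t, v (projIcc 0 1 zero_le_one s))
      (v (projIcc 0 1 zero_le_one t)) t :=
  (continuous_extend v).integral_hasStrictDerivAt 0 t |>.hasDerivAt

/-- The Volterra operator `v ↦ ∫₀ᵗ v` on continuous functions on the unit interval. -/
def volterra (Q : Type*) [NormedAddCommGroup Q] [NormedSpace ℝ Q] [CompleteSpace Q] :
    C(unitInterval, Q) →L[ℝ] C(unitInterval, Q) :=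
  LinearMap.mkContinuous
    { toFun := fun v ↦ ⟨fun t ↦ ∫ s in (0 : ℝ)..t, v (projIcc 0 1 zero_le_one s), by
        have : Continuous fun t : ℝ ↦ ∫ s in (0 : ℝ)..t, v (projIcc 0 1 zero_le_one s) :=
          continuous_iff_continuousAt.2 fun t ↦ (hasDerivAt_primitive v t).continuousAt
        exact this.comp continuous_subtype_val⟩
      map_add' := fun v w ↦ by
        ext t
        simp only [ContinuousMap.add_apply, ContinuousMap.coe_mk]
        exact intervalIntegral.integral_add ((continuous_extend v).intervalIntegrable _ _)
          ((continuous_extend w).intervalIntegrable _ _)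
      map_smul' := fun c v ↦ by
        ext t
        simp only [ContinuousMap.smul_apply, ContinuousMap.coe_mk, RingHom.id_apply]
        exact intervalIntegral.integral_smul _ _ }
    1 (fun v ↦ by
      rw [ContinuousMap.norm_le _ (by positivity)]
      intro t
      simp only [LinearMap.coe_mk, AddHom.coe_mk, ContinuousMap.coe_mk, one_mul]
      refine (intervalIntegral.norm_integral_le_of_norm_le_const
        (C := ‖v‖) (fun s _ ↦ v.norm_coe_le_norm _)).trans ?_
      have h0 := t.2.1
      have h1 := t.2.2
      rw [sub_zero, abs_of_nonneg h0]
      exact mul_le_of_le_one_right (norm_nonneg _) h1)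

theorem volterra_apply (v : C(unitInterval, Q)) (t : unitInterval) :
    volterra Q v t = ∫ s in (0 : ℝ)..t, v (projIcc 0 1 zero_le_one s) := rfl

end Volterra

/-! ### Total differential equations: existence and smooth dependence. -/

section TotalDifferential

variable {P Q : Type u} [NormedAddCommGroup P] [NormedSpace ℝ P] [FiniteDimensional ℝ P]
  [NormedAddCommGroup Q] [NormedSpace ℝ Q] [FiniteDimensional ℝ Q]

/-- The path `s ↦ ((s x, a + w(s)), x)` as a linear function of `((x, a), w)`. -/
def pathMap (P Q : Type u) [NormedAddCommGroup P] [NormedSpace ℝ P]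
    [NormedAddCommGroup Q] [NormedSpace ℝ Q] :
    (P × Q) × C(unitInterval, Q) →L[ℝ] C(unitInterval, (P × Q) × P) :=
  LinearMap.mkContinuous
    { toFun := fun z ↦ ⟨fun s ↦ (((s : ℝ) • z.1.1, z.1.2 + z.2 s), z.1.1), by fun_prop⟩
      map_add' := fun z z' ↦ by
        ext s <;> simp
        abel
      map_smul' := fun c z ↦ by
        ext s
        · exact smul_comm _ _ _
        · simp
        · simp }
    2 (fun z ↦ by
      rw [ContinuousMap.norm_le _ (by positivity)]
      intro s
      have h1 : ‖z.1.1‖ ≤ ‖z‖ := (norm_fst_le z.1).trans (norm_fst_le z)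
      have h2 : ‖z.1.2‖ ≤ ‖z‖ := (norm_snd_le z.1).trans (norm_fst_le z)
      have h3 : ‖z.2 s‖ ≤ ‖z‖ := (z.2.norm_coe_le_norm s).trans (norm_snd_le z)
      have h4 : ‖(s : ℝ) • z.1.1‖ ≤ ‖z.1.1‖ := by
        rw [norm_smul, Real.norm_of_nonneg s.2.1]
        exact mul_le_of_le_one_left (norm_nonneg _) s.2.2
      have h5 := norm_add_le z.1.2 (z.2 s)
      have h6 := norm_nonneg z
      simp only [LinearMap.coe_mk, AddHom.coe_mk, ContinuousMap.coe_mk, Prod.norm_def,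
        sup_le_iff]
      simp only [Prod.norm_def] at h1 h2 h3 h6
      refine ⟨⟨?_, ?_⟩, ?_⟩ <;> linarith)

omit [FiniteDimensional ℝ P] [FiniteDimensional ℝ Q] in
@[simp] theorem pathMap_apply (z : (P × Q) × C(unitInterval, Q)) (s : unitInterval) :
    pathMap P Q z s = (((s : ℝ) • z.1.1, z.1.2 + z.2 s), z.1.1) := rfl

/-- The solution, smooth in the parameters, of `w(t) = ∫₀ᵗ g(s x, a + w(s)) x ds`. -/
theorem exists_smooth_integral_solution (g : P × Q → P →L[ℝ] Q) (hg : ContDiff ℝ ∞ g) :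
    ∃ (h : C((P × Q) × P, Q)) (W : P × Q → C(unitInterval, Q)) (O : Set (P × Q)),
      (∀ z, h z = g z.1 z.2) ∧ IsOpen O ∧ 0 ∈ O ∧ ContDiffOn ℝ ∞ W O ∧ W 0 = 0 ∧
      ∀ z ∈ O, W z = volterra Q (h.comp (pathMap P Q (z, W z))) := by
  have hh : ContDiff ℝ ∞ fun z : (P × Q) × P ↦ g z.1 z.2 :=
    (hg.comp contDiff_fst).clm_apply contDiff_snd
  let h : C((P × Q) × P, Q) := ⟨fun z ↦ g z.1 z.2, hh.continuous⟩
  let N : (P × Q) × C(unitInterval, Q) → C(unitInterval, Q) := fun z ↦ h.comp (pathMap P Q z)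
  have hN : ContDiff ℝ ∞ N := (contDiff_postcomp h hh).comp (pathMap P Q).contDiff
  -- The integral equation reads Ξ(z, w) = (z, 0), so inverting Ξ near 0 solves it smoothly in the
  -- parameters z.
  let Ξ : (P × Q) × C(unitInterval, Q) → (P × Q) × C(unitInterval, Q) :=
    fun z ↦ (z.1, z.2 - volterra Q (N z))
  have hΞ : ContDiff ℝ ∞ Ξ :=
    contDiff_fst.prodMk (contDiff_snd.sub ((volterra Q).contDiff.comp hN))
  have hN0 : HasFDerivAt N ((pointwiseBilin unitInterval (.id ℝ (((P × Q) × P) →L[ℝ] Q))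
      ((⟨fderiv ℝ h, (contDiff_infty_iff_fderiv.1 hh).2.continuous⟩ : C(_, _)).comp
        (pathMap P Q 0))).comp (pathMap P Q)) 0 :=
    (hasFDerivAt_postcomp (.id ℝ (((P × Q) × P) →L[ℝ] Q)) h
      ⟨fderiv ℝ h, (contDiff_infty_iff_fderiv.1 hh).2.continuous⟩
      (fun v ↦ (hh.differentiable (by simp) v).hasFDerivAt) (pathMap P Q 0)).comp _
      (pathMap P Q).hasFDerivAt
  set N' := (pointwiseBilin unitInterval (.id ℝ (((P × Q) × P) →L[ℝ] Q))
      ((⟨fderiv ℝ h, (contDiff_infty_iff_fderiv.1 hh).2.continuous⟩ : C(_, _)).comp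
        (pathMap P Q 0))).comp (pathMap P Q) with hN'
  -- The integrand is linear in `x`, so it vanishes identically for `x = 0`; hence its derivative at
  -- the origin in the direction of the path is zero.
  have hN'0 : ∀ w, N' (0, w) = 0 := by
    intro w
    ext s
    have h0 : ∀ q, h ((0, q), 0) = 0 := fun q ↦ by simp [h]
    have hd : HasFDerivAt h (fderiv ℝ h 0) 0 := (hh.differentiable (by simp) 0).hasFDerivAt
    have hl : HasFDerivAt (fun q : Q ↦ (((0 : P), q), (0 : P)))
        (((ContinuousLinearMap.inl ℝ (P × Q) P).comp (ContinuousLinearMap.inr ℝ P Q))) 0 :=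
      (((ContinuousLinearMap.inl ℝ (P × Q) P).comp
        (ContinuousLinearMap.inr ℝ P Q))).hasFDerivAt
    have hc := hd.comp (0 : Q) hl
    have hc' : HasFDerivAt (h ∘ fun q : Q ↦ (((0 : P), q), (0 : P))) (0 : Q →L[ℝ] Q) 0 := by
      have : (h ∘ fun q : Q ↦ (((0 : P), q), (0 : P))) = fun _ ↦ 0 := funext h0
      rw [this]
      exact hasFDerivAt_const _ _
    have := congrArg (fun L : Q →L[ℝ] Q ↦ L (w s)) (hc.unique hc')
    simpa [hN'] using this
  have hΞ0 : HasFDerivAt Ξ ((ContinuousLinearMap.fst ℝ _ _).prod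
      (ContinuousLinearMap.snd ℝ _ _ - (volterra Q).comp N')) 0 :=
    hasFDerivAt_fst.prodMk (hasFDerivAt_snd.sub ((volterra Q).hasFDerivAt.comp _ hN0))
  have hinv : (fderiv ℝ Ξ 0).IsInvertible := by
    rw [hΞ0.fderiv]
    have hdec : ∀ z w, N' (z, w) = N' (z, 0) := fun z w ↦ by
      have : ((z, w) : (P × Q) × C(unitInterval, Q)) = (z, 0) + (0, w) := by simp
      rw [this, map_add, hN'0, add_zero]
    -- The derivative is (z, w) ↦ (z, w - VN'(z, 0)) with V the Volterra operator; the inverse only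
    -- changes the sign of the off-diagonal block.
    refine ContinuousLinearMap.IsInvertible.of_inverse
      (g := (ContinuousLinearMap.fst ℝ _ _).prod
        (ContinuousLinearMap.snd ℝ _ _ + ((volterra Q).comp N').comp
          ((ContinuousLinearMap.inl ℝ _ _).comp (ContinuousLinearMap.fst ℝ _ _)))) ?_ ?_
    · refine ContinuousLinearMap.ext fun ⟨z, w⟩ ↦ ?_
      simp [hdec z]
    · refine ContinuousLinearMap.ext fun ⟨z, w⟩ ↦ ?_
      simp
      rw [hdec z w]
      abel
  obtain ⟨e, he, h0e, -, -, hsymm⟩ := exists_openPartialHomeomorph isOpen_univ hΞ.contDiffOn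
    (mem_univ 0) hinv
  have hO : IsOpen {z : P × Q | ((z, 0) : (P × Q) × C(unitInterval, Q)) ∈ e.target} :=
    e.open_target.preimage (by fun_prop)
  have hΞ00 : Ξ 0 = 0 := by
    have : N 0 = 0 := by ext s; simp [N, h]
    simp [Ξ, this]
  have h0 : ((0, 0) : (P × Q) × C(unitInterval, Q)) ∈ e.target := by
    have := e.map_source h0e
    rwa [he, hΞ00] at this
  refine ⟨h, fun z ↦ (e.symm (z, 0)).2, _, fun z ↦ rfl, hO, h0, ?_, ?_, ?_⟩
  · have : ContDiffOn ℝ ∞ (fun z : P × Q ↦ ((z, 0) : (P × Q) × C(unitInterval, Q)))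
        {z : P × Q | ((z, 0) : (P × Q) × C(unitInterval, Q)) ∈ e.target} :=
      (contDiff_id.prodMk contDiff_const).contDiffOn
    exact contDiff_snd.comp_contDiffOn (hsymm.comp this fun z hz ↦ hz)
  · have : e.symm (0, 0) = 0 := by
      have := e.left_inv h0e
      rwa [he, hΞ00] at this
    have h2 : e.symm ((0 : P × Q), (0 : C(unitInterval, Q))) = 0 := this
    show (e.symm ((0 : P × Q), (0 : C(unitInterval, Q)))).2 = 0
    rw [h2]; rfl
  · intro z hz
    have h1 := e.right_inv hz
    rw [he] at h1
    have hfst : (e.symm (z, 0)).1 = z := congrArg Prod.fst h1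
    have hsnd : (e.symm (z, 0)).2 - volterra Q (N (e.symm (z, 0))) = 0 := congrArg Prod.snd h1
    have hpair : e.symm (z, 0) = (z, (e.symm (z, 0)).2) := Prod.ext hfst rfl
    rw [← hpair]
    exact sub_eq_zero.1 hsnd

/-- Frobenius' theorem for total differential equations `∂u/∂x = g(x, u)`. -/
theorem exists_solution_total (g : P × Q → P →L[ℝ] Q) {U : Set (P × Q)} (hU : IsOpen U)
    (h0 : (0 : P × Q) ∈ U) (hg : ContDiffOn ℝ ∞ g U)
    (hint : ∀ z ∈ U, ∀ ξ η, fderiv ℝ g z (ξ, g z ξ) η = fderiv ℝ g z (η, g z η) ξ) :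
    ∃ (u : P × Q → Q) (O : Set (P × Q)), IsOpen O ∧ 0 ∈ O ∧ ContDiffOn ℝ ∞ u O ∧
      (∀ z ∈ O, (z.1, u z) ∈ U ∧ ∀ ξ, fderiv ℝ u z (ξ, 0) = g (z.1, u z) ξ) ∧
      ∀ z ∈ O, z.1 = 0 → u z = z.2 := by
  -- Postcomposition needs a globally smooth map; integrability is then only available on `U'`,
  -- where `G` agrees with `g`.
  obtain ⟨G, hG, hGg⟩ := exists_contDiff_eventuallyEq hU hg h0
  obtain ⟨U', hU'U, hU', h0'⟩ := mem_nhds_iff.1 (Filter.inter_mem hGg (hU.mem_nhds h0))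
  obtain ⟨h, W, O, hh, hO, h0O, hW, hW0, hWeq⟩ := exists_smooth_integral_solution G hG
  have hGg' : ∀ z ∈ U', G =ᶠ[𝓝 z] g := fun z hz ↦
    Filter.eventually_of_mem (hU'.mem_nhds hz) fun y hy ↦ (hU'U hy).1
  have hGint : ∀ z ∈ U', ∀ ξ η, fderiv ℝ G z (ξ, G z ξ) η = fderiv ℝ G z (η, G z η) ξ := by
    intro z hz ξ η
    rw [(hGg' z hz).fderiv_eq, (hGg' z hz).eq_of_nhds]
    exact hint z (hU'U hz).2 ξ η
  have hcont : ContinuousOn (fun z ↦ pathMap P Q (z, W z)) O :=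
    (pathMap P Q).continuous.comp_continuousOn (continuousOn_id.prodMk hW.continuousOn)
  -- Paths that stay over `U'` at all times; by compactness of the interval this is an open
  -- condition.
  let T : Set C(unitInterval, (P × Q) × P) := {c | MapsTo c univ (U' ×ˢ univ)}
  have hT : IsOpen T :=
    ContinuousMap.isOpen_setOfPred_mapsTo isCompact_univ (hU'.prod isOpen_univ)
  have hO' : IsOpen (O ∩ (fun z ↦ pathMap P Q (z, W z)) ⁻¹' T) :=
    hcont.isOpen_inter_preimage hO hT
  have hmemU' : ∀ z ∈ O ∩ (fun z ↦ pathMap P Q (z, W z)) ⁻¹' T, ∀ s : unitInterval,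
      (((s : ℝ) • z.1, z.2 + W z s) : P × Q) ∈ U' := fun z hz s ↦ (hz.2 (mem_univ s)).1
  have hWd : ∀ z ∈ O, DifferentiableAt ℝ W z := fun z hz ↦
    (hW.contDiffAt (hO.mem_nhds hz)).differentiableAt (by simp)
  let ev : C(unitInterval, Q) →L[ℝ] Q := ContinuousMap.evalCLM ℝ (1 : unitInterval)
  have h1I : ((1 : unitInterval) : ℝ) = 1 := rfl
  -- `u (x, a)` is the value at time 1 of the solution along the ray t ↦ t x that starts at `a`.
  refine ⟨fun z ↦ z.2 + ev (W z), _, hO', ⟨h0O, fun s _ ↦ ?_⟩, ?_, fun z hz ↦ ⟨?_, fun ξ ↦ ?_⟩, ?_⟩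
  · simp only [pathMap_apply, hW0]
    exact ⟨by simpa [← Prod.zero_eq_mk] using h0', mem_univ _⟩
  · exact contDiff_snd.contDiffOn.add (ev.contDiff.comp_contDiffOn (hW.mono inter_subset_left))
  · have := hmemU' z hz 1
    simp only [h1I, one_smul] at this
    exact (hU'U this).2
  · -- the derivative in the direction of the first factor
    obtain ⟨x, a⟩ := z
    set w := W (x, a) with hw
    set D : C(unitInterval, Q) := fderiv ℝ W (x, a) (ξ, 0) with hD
    have hhd : ∀ v, HasFDerivAt h (fderiv ℝ h v) v := fun v ↦ by
      have : (h : (P × Q) × P → Q) = fun z ↦ G z.1 z.2 := funext hh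
      rw [this]
      exact ((((hG.comp contDiff_fst).clm_apply contDiff_snd).differentiable
        (by simp)) v).hasFDerivAt
    have hhc : Continuous (fderiv ℝ h) := by
      have : (h : (P × Q) × P → Q) = fun z ↦ G z.1 z.2 := funext hh
      rw [this]
      exact ((hG.comp contDiff_fst).clm_apply contDiff_snd).continuous_fderiv (by simp)
    have hh' : ∀ p q x' p' q' ξ', fderiv ℝ h ((p, q), x') ((p', q'), ξ')
        = fderiv ℝ G (p, q) (p', q') x' + G (p, q) ξ' := by
      intro p q x' p' q' ξ'
      have : (h : (P × Q) × P → Q) = fun z ↦ G z.1 z.2 := funext hh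
      have h1 : HasFDerivAt (fun z : (P × Q) × P ↦ G z.1) _ ((p, q), x') :=
        (hG.differentiable (by simp) (p, q)).hasFDerivAt.comp ((p, q), x') hasFDerivAt_fst
      have h2 := h1.clm_apply (hasFDerivAt_snd (𝕜 := ℝ) (p := ((p, q), x')))
      rw [this, h2.fderiv]
      simp [add_comm]
    have hpath : HasFDerivAt (fun z ↦ pathMap P Q (z, W z)) _ (x, a) :=
      (pathMap P Q).hasFDerivAt.comp (x, a)
        ((hasFDerivAt_id (x, a)).prodMk (hWd _ hz.1).hasFDerivAt)
    have hcomp := (hasFDerivAt_postcomp (.id ℝ (((P × Q) × P) →L[ℝ] Q)) h ⟨fderiv ℝ h, hhc⟩ hhd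
      (pathMap P Q ((x, a), W (x, a)))).comp (x, a) hpath
    have hJ := (volterra Q).hasFDerivAt.comp (x, a) hcomp
    have hWJ : HasFDerivAt W _ (x, a) := hJ.congr_of_eventuallyEq
      (Filter.eventually_of_mem (hO.mem_nhds hz.1) fun z hz ↦ hWeq z hz)
    let R : C(unitInterval, Q) := pointwiseBilin unitInterval (.id ℝ (((P × Q) × P) →L[ℝ] Q))
      ((⟨fderiv ℝ h, hhc⟩ : C(_, _)).comp (pathMap P Q ((x, a), w)))
      (pathMap P Q ((ξ, 0), D))
    have hDR : D = volterra Q R := by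
      rw [hD, hWJ.fderiv]
      simp only [ContinuousLinearMap.comp_apply, ContinuousLinearMap.prod_apply,
        ContinuousLinearMap.id_apply]
      congr 3
    have hR : ∀ s : unitInterval, R s = fderiv ℝ G ((s : ℝ) • x, a + w s) ((s : ℝ) • ξ, D s) x
        + G ((s : ℝ) • x, a + w s) ξ := by
      intro s
      show fderiv ℝ h (((s : ℝ) • x, a + w s), x) (((s : ℝ) • ξ, 0 + D s), ξ) = _
      rw [hh', zero_add]
    let pr : ℝ → unitInterval := projIcc 0 1 zero_le_one
    have hpr : ∀ t ∈ Icc (0 : ℝ) 1, ((pr t : unitInterval) : ℝ) = t := fun t ht ↦ by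
      simp [pr, projIcc_of_mem zero_le_one ht]
    let c := h.comp (pathMap P Q ((x, a), w))
    -- `y` is the solution along the ray, and `d` is its derivative in the direction `ξ`, governed
    -- by the variational equation.
    let y : ℝ → Q := fun t ↦ a + ∫ s in (0 : ℝ)..t, c (pr s)
    let d : ℝ → Q := fun t ↦ ∫ s in (0 : ℝ)..t, R (pr s)
    have hyw : ∀ t ∈ Icc (0 : ℝ) 1, y t = a + w (pr t) := fun t ht ↦ by
      have := hWeq (x, a) hz.1
      rw [hw, this, volterra_apply, hpr t ht]
    have hdD : ∀ t ∈ Icc (0 : ℝ) 1, d t = D (pr t) := fun t ht ↦ by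
      rw [hDR, volterra_apply, hpr t ht]
    have hyd : ∀ t ∈ Icc (0 : ℝ) 1, HasDerivAt y (G (t • x, y t) x) t := fun t ht ↦ by
      have := (hasDerivAt_primitive c t).const_add a
      convert! this using 1
      rw [hyw t ht]
      show _ = h (((pr t : ℝ) • x, a + w (pr t)), x)
      rw [hh, hpr t ht]
    have hdd : ∀ t ∈ Icc (0 : ℝ) 1, HasDerivAt d
        (fderiv ℝ G (t • x, y t) (t • ξ, d t) x + G (t • x, y t) ξ) t := fun t ht ↦ by
      have := hasDerivAt_primitive R t
      convert! this using 1
      rw [hyw t ht, hdD t ht]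
      show _ = R (pr t)
      rw [hR, hpr t ht]
    -- The defect from the wanted equation on the ray. Integrability swaps `x` and `ξ` in its
    -- derivative, leaving a homogeneous linear equation.
    let v : ℝ → Q := fun t ↦ d t - t • G (t • x, y t) ξ
    have hyU : ∀ t ∈ Icc (0 : ℝ) 1, (t • x, y t) ∈ U' := fun t ht ↦ by
      have := hmemU' (x, a) hz (pr t)
      rw [hpr t ht] at this
      rw [hyw t ht]
      exact this
    have hvd : ∀ t ∈ Icc (0 : ℝ) 1, HasDerivAt v (fderiv ℝ G (t • x, y t) (0, v t) x) t := by
      intro t ht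
      have h1 : HasDerivAt (fun t : ℝ ↦ (t • x, y t)) (x, G (t • x, y t) x) t := by
        have := ((hasDerivAt_id t).smul_const x).prodMk (hyd t ht)
        simpa using this
      have h2 : HasDerivAt (fun t : ℝ ↦ G (t • x, y t) ξ)
          (fderiv ℝ G (t • x, y t) (x, G (t • x, y t) x) ξ) t := by
        have h3 := ((hG.differentiable (by simp) (t • x, y t)).hasFDerivAt.comp_hasDerivAt t h1)
        have h4 := h3.clm_apply (hasDerivAt_const t ξ)
        simpa using h4
      have h5 := (hdd t ht).sub ((hasDerivAt_id t).smul h2)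
      convert! h5 using 1
      rw [hGint _ (hyU t ht) x ξ]
      have h6 : ((0, v t) : P × Q) = (t • ξ, d t) - t • (ξ, G (t • x, y t) ξ) := by
        ext <;> simp [v]
      rw [h6, map_sub, map_smul]
      simp only [id, one_smul, sub_apply, smul_apply]
      abel
    have hyc : ContinuousOn y (Icc 0 1) := fun t ht ↦ (hyd t ht).continuousAt.continuousWithinAt
    let L : ℝ → Q →L[ℝ] Q := fun t ↦ ((ContinuousLinearMap.apply ℝ Q x).comp
      (fderiv ℝ G (t • x, y t))).comp (ContinuousLinearMap.inr ℝ P Q)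
    have hLc : ContinuousOn L (Icc 0 1) := by
      have hc : ContinuousOn (fun t : ℝ ↦ fderiv ℝ G (t • x, y t)) (Icc 0 1) :=
        (hG.continuous_fderiv (by simp)).comp_continuousOn
          (ContinuousOn.prodMk (by fun_prop) hyc)
      exact (continuousOn_const.clm_comp hc).clm_comp continuousOn_const
    obtain ⟨K, hK⟩ := isCompact_Icc.exists_bound_of_continuousOn hLc
    have hv0 : v 0 = 0 := by simp [v, d]
    -- Grönwall: the defect starts at 0, so it is still 0 at time 1.
    have hv := eq_zero_of_abs_deriv_le_mul_abs_self_of_eq_zero_right (K := K)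
      (fun t ht ↦ (hvd t ht).continuousAt.continuousWithinAt)
      (fun t ht ↦ (hvd t ⟨ht.1, ht.2.le⟩).hasDerivWithinAt) hv0
      (fun t ht ↦ (L t).le_of_opNorm_le (hK t ⟨ht.1, ht.2.le⟩) (v t)) 1 ⟨zero_le_one, le_rfl⟩
    have h1 : (1 : ℝ) ∈ Icc (0 : ℝ) 1 := ⟨zero_le_one, le_rfl⟩
    have hp1 : pr 1 = 1 := Subtype.ext (hpr 1 h1)
    have hD1 : D 1 = G (x, a + w 1) ξ := by
      have := sub_eq_zero.1 hv
      rw [hdD 1 h1, hyw 1 h1, hp1] at this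
      simpa using this
    have hu : HasFDerivAt (fun z : P × Q ↦ z.2 + ev (W z)) _ (x, a) :=
      (hasFDerivAt_snd (p := (x, a))).add (ev.hasFDerivAt.comp (x, a) (hWd _ hz.1).hasFDerivAt)
    rw [hu.fderiv]
    have hmem := hmemU' (x, a) hz 1
    simp only [h1I, one_smul] at hmem
    show _ = g (x, a + W (x, a) 1) ξ
    rw [← (hGg' _ hmem).eq_of_nhds, ← hD1]
    simp [ev, hD]
  · rintro ⟨x, a⟩ hz hx
    obtain rfl : x = 0 := hx
    have : h.comp (pathMap P Q ((0, a), W (0, a))) = 0 := by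
      ext s
      simp [hh]
    have h2 := hWeq (0, a) hz.1
    rw [this, map_zero] at h2
    simp [h2]

end TotalDifferential

end ContactFoliation

end

noncomputable section

namespace ContactFoliation

/-! ### Splittings of finite-dimensional spaces. -/

section LinearSplitting

variable {V Q : Type*} [NormedAddCommGroup V] [NormedSpace ℝ V] [FiniteDimensional ℝ V]
  [NormedAddCommGroup Q] [NormedSpace ℝ Q] [FiniteDimensional ℝ Q]

theorem isInvertible_of_injective {W : Type*} [NormedAddCommGroup W] [NormedSpace ℝ W]
    [FiniteDimensional ℝ W] (f : V →L[ℝ] W) (hf : Function.Injective f)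
    (hdim : Module.finrank ℝ V = Module.finrank ℝ W) : f.IsInvertible :=
  ⟨(LinearEquiv.ofInjectiveOfFinrankEq f.toLinearMap hf hdim).toContinuousLinearEquiv, by
    ext; rfl⟩

/-- A surjective linear map can be completed to an isomorphism. -/
theorem exists_prod_isInvertible {k : ℕ} (f : V →L[ℝ] Q) (hf : Function.Surjective f)
    (hdim : Module.finrank ℝ V = k + Module.finrank ℝ Q) :
    ∃ L : V →L[ℝ] EuclideanSpace ℝ (Fin k), (L.prod f).IsInvertible := by
  have hk : Module.finrank ℝ (LinearMap.ker f.toLinearMap)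
      = Module.finrank ℝ (EuclideanSpace ℝ (Fin k)) := by
    have h1 := f.toLinearMap.finrank_range_add_finrank_ker
    have h2 : LinearMap.range f.toLinearMap = ⊤ := LinearMap.range_eq_top.2 hf
    rw [h2, finrank_top] at h1
    simp
    omega
  let σ := LinearEquiv.ofFinrankEq _ _ hk
  obtain ⟨ρ, hρ⟩ := (LinearMap.ker f.toLinearMap).exists_isCompl.elim fun C hC ↦
    (⟨Submodule.projectionOnto _ C hC, fun x ↦
      Submodule.projectionOnto_apply_left hC x⟩ :
      ∃ ρ : V →ₗ[ℝ] LinearMap.ker f.toLinearMap, ∀ x : LinearMap.ker f.toLinearMap, ρ x = x)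
  refine ⟨(σ.toLinearMap.comp ρ).toContinuousLinearMap, isInvertible_of_injective _ ?_ ?_⟩
  · refine (injective_iff_map_eq_zero _).2 fun v hv ↦ ?_
    have h1 : σ (ρ v) = 0 := congrArg Prod.fst hv
    have h2 : f v = 0 := congrArg Prod.snd hv
    have h3 : ρ v = 0 := by simpa using h1
    have h4 := hρ ⟨v, h2⟩
    rw [h3] at h4
    exact (congrArg Subtype.val h4).symm
  · simpa using hdim

/-- An injective linear map is, in suitable coordinates, the inclusion of a factor. -/
theorem exists_equiv_prod_of_injective {P : Type*} [NormedAddCommGroup P] [NormedSpace ℝ P]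
    [FiniteDimensional ℝ P] (σ : P →L[ℝ] V) (hσ : Function.Injective σ)
    (hdim : Module.finrank ℝ V = Module.finrank ℝ P + Module.finrank ℝ Q) :
    ∃ T : V ≃L[ℝ] P × Q, ∀ ξ, T (σ ξ) = (ξ, 0) := by
  obtain ⟨C, hC⟩ := (LinearMap.range σ.toLinearMap).exists_isCompl
  have hr : Module.finrank ℝ (LinearMap.range σ.toLinearMap) = Module.finrank ℝ P :=
    LinearMap.finrank_range_of_inj hσ
  have hCQ : Module.finrank ℝ C = Module.finrank ℝ Q := by
    have := Submodule.finrank_add_eq_of_isCompl hC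
    omega
  let T := (((LinearEquiv.ofInjective σ.toLinearMap hσ).prodCongr
    (LinearEquiv.ofFinrankEq C Q hCQ).symm).trans
    (Submodule.prodEquivOfIsCompl _ C hC)).symm
  refine ⟨T.toContinuousLinearEquiv, fun ξ ↦ ?_⟩
  show T (σ ξ) = (ξ, 0)
  rw [LinearEquiv.symm_apply_eq]
  simp

end LinearSplitting

/-! ### Smooth frames and inverses of smooth families of operators. -/

section Frames

variable {V Q : Type*} [NormedAddCommGroup V] [NormedSpace ℝ V] [FiniteDimensional ℝ V]
  [NormedAddCommGroup Q] [NormedSpace ℝ Q] [FiniteDimensional ℝ Q]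

/-- The linear map `c ↦ ∑ cᵢ Xᵢ`. -/
def frameMap {k : ℕ} (X : Fin k → V) : EuclideanSpace ℝ (Fin k) →L[ℝ] V :=
  ∑ i, (EuclideanSpace.proj i : EuclideanSpace ℝ (Fin k) →L[ℝ] ℝ).smulRight (X i)

omit [FiniteDimensional ℝ V] in
theorem frameMap_apply {k : ℕ} (X : Fin k → V) (c : EuclideanSpace ℝ (Fin k)) :
    frameMap X c = ∑ i, c i • X i := by
  simp [frameMap]

omit [FiniteDimensional ℝ V] in
theorem frameMap_single {k : ℕ} (X : Fin k → V) (i : Fin k) :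
    frameMap X (EuclideanSpace.single i 1) = X i := by
  rw [frameMap_apply, Finset.sum_eq_single i]
  · simp
  · intro j _ hj
    simp [hj]
  · simp

omit [FiniteDimensional ℝ V] in
theorem mem_span_range_iff {k : ℕ} (X : Fin k → V) (v : V) :
    v ∈ Submodule.span ℝ (range X) ↔ ∃ c, frameMap X c = v := by
  rw [Submodule.mem_span_range_iff_exists_fun]
  constructor
  · rintro ⟨c, rfl⟩
    exact ⟨WithLp.toLp 2 c, by simp [frameMap_apply]⟩
  · rintro ⟨c, rfl⟩
    exact ⟨c, by simp [frameMap_apply]⟩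

omit [FiniteDimensional ℝ V] in
theorem frameMap_injective {k : ℕ} {X : Fin k → V} (hX : LinearIndependent ℝ X) :
    Function.Injective (frameMap X) := by
  refine (injective_iff_map_eq_zero _).2 fun c hc ↦ ?_
  rw [frameMap_apply] at hc
  have := Fintype.linearIndependent_iff.1 hX _ hc
  ext i
  exact this i

omit [FiniteDimensional ℝ V] in
theorem contDiffOn_frameMap {W : Type*} [NormedAddCommGroup W] [NormedSpace ℝ W] {k : ℕ}
    {X : Fin k → W → V} {s : Set W}
    (hX : ∀ i, ContDiffOn ℝ ∞ (X i) s) : ContDiffOn ℝ ∞ (fun e ↦ frameMap fun i ↦ X i e) s := by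
  unfold frameMap
  refine ContDiffOn.sum fun i _ ↦ ?_
  exact (ContinuousLinearMap.smulRightL ℝ _ V (EuclideanSpace.proj i)).contDiff.comp_contDiffOn
    (hX i)

omit [FiniteDimensional ℝ Q] in
theorem contDiffOn_inverse {W : Type*} [NormedAddCommGroup W] [NormedSpace ℝ W]
    {f : W → V →L[ℝ] Q} {s : Set W}
    (hf : ContDiffOn ℝ ∞ f s) (hinv : ∀ e ∈ s, (f e).IsInvertible) :
    ContDiffOn ℝ ∞ (fun e ↦ (f e).inverse) s := fun e he ↦
  (hinv e he).contDiffAt_map_inverse.comp_contDiffWithinAt e (hf e he)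

/-- The kernels of a smooth family of surjective maps have a smooth local frame. -/
theorem exists_frame_ker {k : ℕ} (hdim : Module.finrank ℝ V = k + Module.finrank ℝ Q)
    {Ω : V → V →L[ℝ] Q} {U : Set V} (hU : IsOpen U) (hΩ : ContDiffOn ℝ ∞ Ω U) {e₀ : V}
    (he₀ : e₀ ∈ U) (hsurj : Function.Surjective (Ω e₀)) :
    ∃ (X : Fin k → V → V) (O : Set V), IsOpen O ∧ e₀ ∈ O ∧ O ⊆ U ∧
      (∀ i, ContDiffOn ℝ ∞ (X i) O) ∧ ∀ e ∈ O, LinearIndependent ℝ (fun i ↦ X i e) ∧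
        LinearMap.ker (Ω e).toLinearMap = Submodule.span ℝ (range fun i ↦ X i e) := by
  obtain ⟨L, hL⟩ := exists_prod_isInvertible (Ω e₀) hsurj hdim
  have hT : ContDiffOn ℝ ∞ (fun e ↦ L.prod (Ω e)) U := by
    have h : (fun e ↦ L.prod (Ω e)) = fun e ↦ (ContinuousLinearMap.inl ℝ _ _).comp L +
        (ContinuousLinearMap.inr ℝ (EuclideanSpace ℝ (Fin k)) Q).comp (Ω e) := by
      funext e
      refine ContinuousLinearMap.ext fun v ↦ ?_
      simp
    rw [h]
    exact contDiffOn_const.add (contDiffOn_const.clm_comp hΩ)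
  have hO : IsOpen (U ∩ (fun e ↦ L.prod (Ω e)) ⁻¹' {g | g.IsInvertible}) :=
    hT.continuousOn.isOpen_inter_preimage hU isOpen_setOf_isInvertible
  -- The complement `L`, chosen at `e₀`, stays complementary nearby; inverting the pair on `P × 0`
  -- parametrizes the kernels smoothly.
  refine ⟨fun i e ↦ (L.prod (Ω e)).inverse (EuclideanSpace.single i 1, 0), _, hO, ⟨he₀, hL⟩,
    inter_subset_left, fun i ↦ ?_, fun e he ↦ ?_⟩
  · exact (contDiffOn_inverse (hT.mono inter_subset_left) fun e he ↦ he.2).clm_apply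
      contDiffOn_const
  · have hinv : (L.prod (Ω e)).IsInvertible := he.2
    have hap : ∀ z, (L.prod (Ω e)) ((L.prod (Ω e)).inverse z) = z :=
      fun z ↦ hinv.self_apply_inverse z
    have hfr : ∀ c, frameMap (fun i ↦ (L.prod (Ω e)).inverse (EuclideanSpace.single i 1, 0)) c
        = (L.prod (Ω e)).inverse (c, 0) := by
      intro c
      have h : (frameMap fun i ↦ (L.prod (Ω e)).inverse (EuclideanSpace.single i 1, 0)) =
          (L.prod (Ω e)).inverse.comp (ContinuousLinearMap.inl ℝ _ _) := by
        refine ContinuousLinearMap.coe_injective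
          ((EuclideanSpace.basisFun (Fin k) ℝ).toBasis.ext fun i ↦ ?_)
        simp [frameMap_single]
      rw [h]; simp
    constructor
    · rw [Fintype.linearIndependent_iff]
      intro c hc i
      have h1 := hfr (WithLp.toLp 2 c)
      rw [frameMap_apply] at h1
      have h2 := congrArg (L.prod (Ω e)) (h1.symm.trans hc)
      rw [hap, map_zero] at h2
      exact congrArg (fun z ↦ z.1 i) h2
    · ext v
      rw [mem_span_range_iff, LinearMap.mem_ker]
      constructor
      · intro hv
        refine ⟨L v, ?_⟩
        rw [hfr]
        have h : (L v, (0 : Q)) = (L.prod (Ω e)) v := by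
          simp only [ContinuousLinearMap.prod_apply]; exact congrArg _ hv.symm
        rw [h]
        exact hinv.inverse_apply_self v
      · rintro ⟨c, rfl⟩
        rw [hfr]
        exact congrArg Prod.snd (hap (c, 0))

end Frames

/-! ### The exterior derivative and pullback. -/

section ExteriorDerivative

variable {V W : Type*} [NormedAddCommGroup V] [NormedSpace ℝ V]
  [NormedAddCommGroup W] [NormedSpace ℝ W]

/-- The exterior derivative of a 1-form on a normed space. -/
def dform (a : V → V →L[ℝ] ℝ) (e v w : V) : ℝ := fderiv ℝ a e v w - fderiv ℝ a e w v

/-- The exterior derivative is natural under pullback. -/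
theorem dform_pullback {τ : W → V} {b : V → V →L[ℝ] ℝ} {a : W → W →L[ℝ] ℝ} {e : W}
    (hτ : ContDiffAt ℝ ∞ τ e) (hb : DifferentiableAt ℝ b (τ e))
    (ha : a =ᶠ[𝓝 e] fun e ↦ (b (τ e)).comp (fderiv ℝ τ e)) (v w : W) :
    dform a e v w = dform b (τ e) (fderiv ℝ τ e v) (fderiv ℝ τ e w) := by
  have hτd : DifferentiableAt ℝ τ e := hτ.differentiableAt (by simp)
  have hτ' : ContDiffAt ℝ 1 (fderiv ℝ τ) e := hτ.fderiv_right (m := 1) (by norm_cast)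
  have hτ2 : HasFDerivAt (fderiv ℝ τ) (fderiv ℝ (fderiv ℝ τ) e) e :=
    (hτ'.differentiableAt (by simp)).hasFDerivAt
  have h := (hb.hasFDerivAt.comp e hτd.hasFDerivAt).clm_comp hτ2
  -- The second derivative of `τ` enters both terms of `dform` and cancels by symmetry.
  have hsymm : IsSymmSndFDerivAt ℝ τ e :=
    hτ.isSymmSndFDerivAt (by
      rw [minSmoothness_of_isRCLikeNormedField]; norm_cast)
  have h2 := hsymm v w
  have h3 : fderiv ℝ a e = _ := ha.fderiv_eq.trans h.fderiv
  simp only [dform, h3]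
  simp [h2]

end ExteriorDerivative

end ContactFoliation

end

noncomputable section

namespace ContactFoliation

open VectorField

/-! ### Frobenius' theorem for involutive frames. -/

section Frobenius

variable {V : Type} [NormedAddCommGroup V] [NormedSpace ℝ V] [FiniteDimensional ℝ V]

omit [FiniteDimensional ℝ V] in
/-- In a splitting of `V`, involutivity of a frame is symmetry of the derivative of the graph. -/
theorem fderiv_graph_symm {P Q : Type*} [NormedAddCommGroup P] [NormedSpace ℝ P]
    [NormedAddCommGroup Q] [NormedSpace ℝ Q] {k : ℕ} {X : Fin k → V → V} {U : Set V}
    (hU : IsOpen U) (hX : ∀ i, ContDiffOn ℝ ∞ (X i) U)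
    (A : V →L[ℝ] P) (B : V →L[ℝ] Q) (g : V → P →L[ℝ] Q) (hg : ContDiffOn ℝ ∞ g U)
    (hgX : ∀ e ∈ U, ∀ i, B (X i e) = g e (A (X i e)))
    (hinv : ∀ e ∈ U, ∀ i j, lieBracket ℝ (X i) (X j) e ∈ Submodule.span ℝ (range fun i ↦ X i e))
    {e : V} (he : e ∈ U) {v w : V} (hv : v ∈ Submodule.span ℝ (range fun i ↦ X i e))
    (hw : w ∈ Submodule.span ℝ (range fun i ↦ X i e)) :
    fderiv ℝ g e v (A w) = fderiv ℝ g e w (A v) := by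
  have hgd : HasFDerivAt g (fderiv ℝ g e) e :=
    ((hg.contDiffAt (hU.mem_nhds he)).differentiableAt (by simp)).hasFDerivAt
  have hspan : ∀ v ∈ Submodule.span ℝ (range fun i ↦ X i e), B v = g e (A v) := by
    intro v hv
    induction hv using Submodule.span_induction with
    | mem x hx => obtain ⟨i, rfl⟩ := hx; exact hgX e he i
    | zero => simp
    | add x y _ _ hx hy => simp [hx, hy]
    | smul c x _ hx => simp [hx]
  have hder : ∀ i v, B (fderiv ℝ (X i) e v) =
      fderiv ℝ g e v (A (X i e)) + g e (A (fderiv ℝ (X i) e v)) := by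
    intro i v
    have hXd : HasFDerivAt (X i) (fderiv ℝ (X i) e) e :=
      (((hX i).contDiffAt (hU.mem_nhds he)).differentiableAt (by simp)).hasFDerivAt
    have h1 : HasFDerivAt (fun e ↦ B (X i e)) _ e := B.hasFDerivAt.comp e hXd
    have h2 := hgd.clm_apply (A.hasFDerivAt.comp e hXd)
    have h3 := h1.unique (h2.congr_of_eventuallyEq
      (Filter.eventually_of_mem (hU.mem_nhds he) fun e he ↦ hgX e he i))
    have := congrArg (fun L ↦ L v) h3
    simp only [ContinuousLinearMap.comp_apply] at this
    rw [this]
    simp [add_comm]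
  have hij : ∀ i j, fderiv ℝ g e (X i e) (A (X j e)) = fderiv ℝ g e (X j e) (A (X i e)) := by
    intro i j
    have h := hspan _ (hinv e he i j)
    rw [lieBracket_eq] at h
    simp only [map_sub, hder] at h
    -- The bracket lies in the span, that is, on the graph of `g e`; after inserting `hder`, the
    -- terms with derivatives of the fields cancel and only the derivative of `g` remains.
    have h' : fderiv ℝ g e (X i e) (A (X j e)) - fderiv ℝ g e (X j e) (A (X i e)) = 0 := by
      rw [← sub_eq_zero] at h
      rw [← h]
      abel
    exact sub_eq_zero.1 h'
  induction hv, hw using Submodule.span_induction₂ with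
  | mem_mem x y hx hy =>
    obtain ⟨i, rfl⟩ := hx
    obtain ⟨j, rfl⟩ := hy
    exact hij i j
  | zero_left => simp
  | zero_right => simp
  | add_left x y z _ _ _ hx hy => simp [hx, hy]
  | add_right x y z _ _ _ hx hy => simp [hx, hy]
  | smul_left c x y _ _ h => simp [h]
  | smul_right c x y _ _ h => simp [h]

/-- Frobenius' theorem: an involutive frame is tangent to the fibres of a local submersion. -/
theorem exists_submersion_of_involutive {k q : ℕ} (hdim : Module.finrank ℝ V = k + q)
    {X : Fin k → V → V} {U : Set V} (hU : IsOpen U) (hX : ∀ i, ContDiffOn ℝ ∞ (X i) U)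
    (hli : ∀ e ∈ U, LinearIndependent ℝ fun i ↦ X i e)
    (hinv : ∀ e ∈ U, ∀ i j, lieBracket ℝ (X i) (X j) e ∈ Submodule.span ℝ (range fun i ↦ X i e))
    {e₀ : V} (he₀ : e₀ ∈ U) :
    ∃ (A : V → EuclideanSpace ℝ (Fin q)) (O : Set V), IsOpen O ∧ e₀ ∈ O ∧ O ⊆ U ∧
      ContDiffOn ℝ ∞ A O ∧ ∀ e ∈ O, Function.Surjective (fderiv ℝ A e) ∧
        LinearMap.ker (fderiv ℝ A e).toLinearMap = Submodule.span ℝ (range fun i ↦ X i e) := by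
  let P := EuclideanSpace ℝ (Fin k)
  let Q := EuclideanSpace ℝ (Fin q)
  -- In these coordinates the span at `e₀` is the first factor, so at nearby points it still
  -- projects isomorphically there and is a graph.
  obtain ⟨T, hT⟩ := exists_equiv_prod_of_injective (Q := Q) (frameMap fun i ↦ X i e₀)
    (frameMap_injective (hli e₀ he₀)) (by rw [hdim]; simp [Q])
  let A : V →L[ℝ] P := (ContinuousLinearMap.fst ℝ P Q).comp (T : V →L[ℝ] P × Q)
  let B : V →L[ℝ] Q := (ContinuousLinearMap.snd ℝ P Q).comp (T : V →L[ℝ] P × Q)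
  let m : V → P →L[ℝ] P := fun e ↦ A.comp (frameMap fun i ↦ X i e)
  have hm : ContDiffOn ℝ ∞ m U := contDiffOn_const.clm_comp (contDiffOn_frameMap hX)
  let U₁ := U ∩ m ⁻¹' {g | g.IsInvertible}
  have hU₁ : IsOpen U₁ := hm.continuousOn.isOpen_inter_preimage hU isOpen_setOf_isInvertible
  have hm₀ : m e₀ = ContinuousLinearMap.id ℝ P := by
    refine ContinuousLinearMap.ext fun ξ ↦ ?_
    show (T (frameMap _ ξ)).1 = ξ
    rw [hT]
  have he₁ : e₀ ∈ U₁ := ⟨he₀, ⟨.refl ℝ P, hm₀.symm⟩⟩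
  -- The span at `e` is the graph of `g e`; its leaves are the graphs of solutions of ∂u/∂x = g, and
  -- involutivity is the integrability condition.
  let g : V → P →L[ℝ] Q := fun e ↦ (B.comp (frameMap fun i ↦ X i e)).comp (m e).inverse
  have hg : ContDiffOn ℝ ∞ g U₁ :=
    (contDiffOn_const.clm_comp ((contDiffOn_frameMap hX).mono inter_subset_left)).clm_comp
      (contDiffOn_inverse (hm.mono inter_subset_left) fun e he ↦ he.2)
  have hspan : ∀ e ∈ U₁, ∀ v, v ∈ Submodule.span ℝ (range fun i ↦ X i e) ↔ B v = g e (A v) := by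
    intro e he v
    rw [mem_span_range_iff]
    have hi : (m e).IsInvertible := he.2
    constructor
    · rintro ⟨c, rfl⟩
      show _ = B (frameMap _ ((m e).inverse (m e c)))
      rw [hi.inverse_apply_self]
    · intro h
      refine ⟨(m e).inverse (A v), T.injective (Prod.ext ?_ ?_)⟩
      · exact hi.self_apply_inverse (A v)
      · exact h.symm
  have hsymm : ∀ e ∈ U₁, ∀ v w, B v = g e (A v) → B w = g e (A w) →
      fderiv ℝ g e v (A w) = fderiv ℝ g e w (A v) := by
    intro e he v w hv hw
    exact fderiv_graph_symm hU₁ (fun i ↦ (hX i).mono inter_subset_left) A B g hg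
      (fun e he i ↦ (hspan e he _).1 (Submodule.subset_span ⟨i, rfl⟩))
      (fun e he i j ↦ hinv e he.1 i j) he ((hspan e he _).2 hv) ((hspan e he _).2 hw)
  -- the affine coordinates centred at `e₀`
  let c : P × Q → V := fun z ↦ e₀ + T.symm z
  have hc : ContDiff ℝ ∞ c := contDiff_const.add T.symm.contDiff
  have hcd : ∀ z, HasFDerivAt c (T.symm : P × Q →L[ℝ] V) z := fun z ↦
    (T.symm : P × Q →L[ℝ] V).hasFDerivAt.const_add e₀
  have hU' : IsOpen (c ⁻¹' U₁) := hU₁.preimage hc.continuous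
  have hgc : ∀ z ∈ c ⁻¹' U₁, ∀ v, fderiv ℝ (fun z ↦ g (c z)) z v = fderiv ℝ g (c z) (T.symm v) := by
    intro z hz v
    have h1 : HasFDerivAt g (fderiv ℝ g (c z)) (c z) :=
      ((hg.contDiffAt (hU₁.mem_nhds hz)).differentiableAt (by simp)).hasFDerivAt
    have h2 : HasFDerivAt (fun z ↦ g (c z)) _ z := h1.comp z (hcd z)
    rw [h2.fderiv]
    rfl
  have hAT : ∀ z, A (T.symm z) = z.1 := fun z ↦ by simp [A]
  have hBT : ∀ z, B (T.symm z) = z.2 := fun z ↦ by simp [B]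
  have h0' : (0 : P × Q) ∈ c ⁻¹' U₁ := by simpa [c] using he₁
  obtain ⟨u, O, hO, h0O, hu, huU, hu0⟩ := exists_solution_total (fun z ↦ g (c z)) hU' h0'
    (hg.comp hc.contDiffOn fun z hz ↦ hz) (fun z hz ξ η ↦ by
      rw [hgc z hz, hgc z hz]
      have := hsymm (c z) hz (T.symm (ξ, g (c z) ξ)) (T.symm (η, g (c z) η))
        (by rw [hAT, hBT]) (by rw [hAT, hBT])
      rwa [hAT, hAT] at this)
  have hud : ∀ z ∈ O, HasFDerivAt u (fderiv ℝ u z) z := fun z hz ↦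
    ((hu.contDiffAt (hO.mem_nhds hz)).differentiableAt (by simp)).hasFDerivAt
  -- Each slice with constant second coordinate is sent to an integral leaf; inverting Θ straightens
  -- them all.
  let Θ : P × Q → P × Q := fun z ↦ (z.1, u z)
  have hΘ : ContDiffOn ℝ ∞ Θ O := contDiff_fst.contDiffOn.prodMk hu
  have hΘd : ∀ z ∈ O, HasFDerivAt Θ ((ContinuousLinearMap.fst ℝ P Q).prod (fderiv ℝ u z)) z :=
    fun z hz ↦ hasFDerivAt_fst.prodMk (hud z hz)
  have hu2 : ∀ b, fderiv ℝ u 0 (0, b) = b := by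
    intro b
    have h1 := (show HasFDerivAt u (fderiv ℝ u 0) (ContinuousLinearMap.inr ℝ P Q 0) by
      rw [map_zero]; exact hud 0 h0O).comp (0 : Q) (ContinuousLinearMap.inr ℝ P Q).hasFDerivAt
    have h2 : (u ∘ ContinuousLinearMap.inr ℝ P Q) =ᶠ[𝓝 0] id := by
      have : (ContinuousLinearMap.inr ℝ P Q) ⁻¹' O ∈ 𝓝 (0 : Q) :=
        (ContinuousLinearMap.inr ℝ P Q).continuous.continuousAt.preimage_mem_nhds
          (by rw [map_zero]; exact hO.mem_nhds h0O)
      filter_upwards [this] with b hb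
      exact hu0 _ hb rfl
    have h3 := h1.unique ((hasFDerivAt_id (0 : Q)).congr_of_eventuallyEq h2)
    have := congrArg (fun L ↦ L b) h3
    simpa using this
  have hΘinv : (fderiv ℝ Θ 0).IsInvertible := by
    rw [(hΘd 0 h0O).fderiv]
    refine isInvertible_of_injective _ ((injective_iff_map_eq_zero _).2 fun z hz ↦ ?_) rfl
    obtain ⟨a, b⟩ := z
    have h1 : a = 0 := congrArg Prod.fst hz
    have h2 : fderiv ℝ u 0 (a, b) = 0 := congrArg Prod.snd hz
    subst h1
    rw [hu2] at h2
    rw [h2]; rfl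
  obtain ⟨φ, hφ, h0φ, hφO, hφinv, hφsymm⟩ := exists_openPartialHomeomorph hO hΘ h0O hΘinv
  have hcO : IsOpen ((fun e ↦ T (e - e₀)) ⁻¹' φ.target) := φ.open_target.preimage (by fun_prop)
  have hΘ0 : Θ 0 = 0 := by
    have := hu0 0 h0O rfl
    simp [Θ, this]
  have hcT : ∀ e, c (T (e - e₀)) = e := fun e ↦ by simp [c]
  have hmemU : ∀ e, T (e - e₀) ∈ φ.target → e ∈ U₁ ∧
      φ.symm (T (e - e₀)) ∈ O ∧ Θ (φ.symm (T (e - e₀))) = T (e - e₀) := by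
    intro e he
    have h1 := hφO (φ.map_target he)
    have h2 := φ.right_inv he
    rw [hφ] at h2
    have h3 := (huU _ h1).1
    have h4 : c (Θ (φ.symm (T (e - e₀)))) ∈ U₁ := h3
    rw [h2, hcT] at h4
    exact ⟨h4, h1, h2⟩
  -- The submersion reads off the initial value of the leaf through `e`.
  refine ⟨fun e ↦ (φ.symm (T (e - e₀))).2, _, hcO, ?_, fun e he ↦ (hmemU e he).1.1, ?_,
    fun e he ↦ ?_⟩
  · have := φ.map_source h0φ
    rw [hφ, hΘ0] at this
    simpa using this
  · exact contDiff_snd.comp_contDiffOn (hφsymm.comp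
      (T.contDiff.comp (contDiff_id.sub contDiff_const)).contDiffOn fun e he ↦ he)
  · obtain ⟨heU, hzO, hz⟩ := hmemU e he
    set z := φ.symm (T (e - e₀)) with hzdef
    obtain ⟨D, hD⟩ := hφinv z (φ.map_target he)
    have hφd : HasFDerivAt φ (D : P × Q →L[ℝ] P × Q) z := by
      rw [hD, hφ]; exact (hΘd z hzO).differentiableAt.hasFDerivAt
    have hsd : HasFDerivAt φ.symm (D.symm : P × Q →L[ℝ] P × Q) (T (e - e₀)) :=
      φ.hasFDerivAt_symm he hφd
    have haff : HasFDerivAt (fun e ↦ T (e - e₀)) (T : V →L[ℝ] P × Q) e :=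
      (T : V →L[ℝ] P × Q).hasFDerivAt.comp e ((hasFDerivAt_id e).sub_const e₀)
    have hA : HasFDerivAt (fun e ↦ (φ.symm (T (e - e₀))).2)
        ((ContinuousLinearMap.snd ℝ P Q).comp ((D.symm : P × Q →L[ℝ] P × Q).comp
          (T : V →L[ℝ] P × Q))) e :=
      (ContinuousLinearMap.snd ℝ P Q).hasFDerivAt.comp e (hsd.comp e haff)
    rw [hA.fderiv]
    -- The differential equation for `u`, read as: the derivative of Θ carries the first factor onto
    -- the graph of `g e`.
    have hDap : ∀ ξ, D (ξ, 0) = (ξ, g e ξ) := by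
      intro ξ
      have h1 : D (ξ, 0) = (D : P × Q →L[ℝ] P × Q) (ξ, 0) := rfl
      rw [h1, hD, (hΘd z hzO).fderiv]
      have h2 := (huU z hzO).2 ξ
      have h3 : c (z.1, u z) = e := by
        show c (Θ z) = e
        rw [hz, hcT]
      rw [h3] at h2
      simp only [ContinuousLinearMap.prod_apply, ContinuousLinearMap.coe_fst', h2]
    constructor
    · intro b
      exact ⟨T.symm (D (0, b)), by simp⟩
    · ext v
      rw [hspan e heU, LinearMap.mem_ker]
      constructor
      · intro hv
        have h1 : (D.symm (T v)).2 = 0 := hv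
        have h2 : D ((D.symm (T v)).1, 0) = T v := by
          rw [← h1]
          exact D.apply_symm_apply (T v)
        rw [hDap] at h2
        show (T v).2 = g e (T v).1
        rw [← h2]
      · intro hv
        have h1 : D ((T v).1, 0) = T v := by
          rw [hDap]
          exact Prod.ext rfl hv.symm
        show (D.symm (T v)).2 = 0
        rw [← h1, D.symm_apply_apply]

end Frobenius

/-! ### Poincaré lemma with parameters and along fibres. -/

section Poincare

variable {V Q : Type} [NormedAddCommGroup V] [NormedSpace ℝ V] [FiniteDimensional ℝ V]
  [NormedAddCommGroup Q] [NormedSpace ℝ Q] [FiniteDimensional ℝ Q]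

/-- The Poincaré lemma with parameters, in coordinates adapted to a product. -/
theorem exists_partial_primitive {P : Type} [NormedAddCommGroup P] [NormedSpace ℝ P]
    [FiniteDimensional ℝ P] {b : P × Q → P →L[ℝ] ℝ} {U : Set (P × Q)} (hU : IsOpen U)
    (h0 : 0 ∈ U) (hb : ContDiffOn ℝ ∞ b U)
    (hsymm : ∀ z ∈ U, ∀ ξ η, fderiv ℝ b z (ξ, 0) η = fderiv ℝ b z (η, 0) ξ) :
    ∃ (s : P × Q → ℝ) (O : Set (P × Q)), IsOpen O ∧ 0 ∈ O ∧ O ⊆ U ∧ ContDiffOn ℝ ∞ s O ∧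
      ∀ z ∈ O, ∀ ξ, fderiv ℝ s z (ξ, 0) = b z ξ := by
  let c : P × (Q × ℝ) →L[ℝ] P × Q := (ContinuousLinearMap.fst ℝ P (Q × ℝ)).prod
    ((ContinuousLinearMap.fst ℝ Q ℝ).comp (ContinuousLinearMap.snd ℝ P (Q × ℝ)))
  -- The system dq = 0, ds = b(x, q) in the unknown (q, s): the parameter q rides along as a
  -- constant unknown, and integrability reduces to the closedness of `b` in `x`.
  let g : P × (Q × ℝ) → P →L[ℝ] (Q × ℝ) := fun z ↦ (ContinuousLinearMap.inr ℝ Q ℝ).comp (b (c z))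
  have hgd : ∀ z ∈ c ⁻¹' U, ∀ v ξ, fderiv ℝ g z v ξ = (0, fderiv ℝ b (c z) (c v) ξ) := by
    intro z hz v ξ
    have h1 : HasFDerivAt b (fderiv ℝ b (c z)) (c z) :=
      ((hb.contDiffAt (hU.mem_nhds hz)).differentiableAt (by simp)).hasFDerivAt
    have h2 : HasFDerivAt g _ z :=
      (hasFDerivAt_const (ContinuousLinearMap.inr ℝ Q ℝ) z).clm_comp (h1.comp z c.hasFDerivAt)
    rw [h2.fderiv]
    simp
  obtain ⟨u, O, hO, h0O, hu, huU, hu0⟩ := exists_solution_total g (hU.preimage c.continuous)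
    (by simpa using h0) (contDiffOn_const.clm_comp (hb.comp c.contDiff.contDiffOn fun z hz ↦ hz))
    (fun z hz ξ η ↦ by
      rw [hgd z hz, hgd z hz]
      exact congrArg _ (hsymm (c z) hz ξ η))
  obtain ⟨r, hr, hrO⟩ := Metric.isOpen_iff.1 hO 0 h0O
  have hud : ∀ z ∈ O, HasFDerivAt u (fderiv ℝ u z) z := fun z hz ↦
    ((hu.contDiffAt (hO.mem_nhds hz)).differentiableAt (by simp)).hasFDerivAt
  let j : P × Q →L[ℝ] P × (Q × ℝ) := (ContinuousLinearMap.fst ℝ P Q).prod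
    ((ContinuousLinearMap.inl ℝ Q ℝ).comp (ContinuousLinearMap.snd ℝ P Q))
  have hj : ∀ z ∈ Metric.ball (0 : P × Q) r, j z ∈ O := by
    intro z hz
    apply hrO
    rw [mem_ball_zero_iff] at hz ⊢
    refine lt_of_le_of_lt ?_ hz
    simp [j, Prod.norm_def]
  -- The solution does keep q constant: its `x`-derivative vanishes on a convex slice, and at `x =
  -- 0` it equals the initial value.
  have hfst : ∀ z ∈ Metric.ball (0 : P × Q) r, (u (j z)).1 = z.2 := by
    rintro ⟨t, x⟩ hz
    have hball : ∀ t' ∈ Metric.ball (0 : P) r, ((t', x) : P × Q) ∈ Metric.ball (0 : P × Q) r := by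
      intro t' ht'
      rw [mem_ball_zero_iff, Prod.norm_def, sup_lt_iff] at hz ⊢
      exact ⟨mem_ball_zero_iff.1 ht', hz.2⟩
    have ht : t ∈ Metric.ball (0 : P) r := by
      rw [mem_ball_zero_iff, Prod.norm_def, sup_lt_iff] at hz
      exact mem_ball_zero_iff.2 hz.1
    have hd : ∀ t' ∈ Metric.ball (0 : P) r,
        HasFDerivWithinAt (fun t' ↦ (u (j (t', x))).1) (0 : P →L[ℝ] Q) (Metric.ball 0 r) t' := by
      intro t' ht'
      have hjO := hj _ (hball t' ht')
      have h1 : HasFDerivAt (fun t' : P ↦ j (t', x))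
          (j.comp (ContinuousLinearMap.inl ℝ P Q)) t' :=
        j.hasFDerivAt.comp t' (hasFDerivAt_prodMk_left t' x)
      have h2 := (hasFDerivAt_fst (𝕜 := ℝ) (p := u (j (t', x)))).comp t'
        ((hud _ hjO).comp t' h1)
      refine (h2.congr_fderiv ?_).hasFDerivWithinAt
      refine ContinuousLinearMap.ext fun ξ ↦ ?_
      have h3 := (huU _ hjO).2 ξ
      have h4 : j (ξ, 0) = (ξ, 0) := by simp [j]
      simp only [ContinuousLinearMap.comp_apply, ContinuousLinearMap.inl_apply, h4, h3]
      rfl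
    have h5 := (convex_ball (0 : P) r).is_const_of_fderivWithin_eq_zero (𝕜 := ℝ)
      (fun t' ht' ↦ (hd t' ht').differentiableWithinAt)
      (fun t' ht' ↦ (hd t' ht').fderivWithin (Metric.isOpen_ball.uniqueDiffWithinAt ht'))
      ht (Metric.mem_ball_self hr)
    rw [h5, hu0 _ (hj _ (hball 0 (Metric.mem_ball_self hr))) rfl]
    rfl
  refine ⟨fun z ↦ (u (j z)).2, Metric.ball 0 r, Metric.isOpen_ball, Metric.mem_ball_self hr,
    fun z hz ↦ ?_, ?_, fun z hz ξ ↦ ?_⟩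
  · have := (huU _ (hj z hz)).1
    have h2 : ((j z).1, (u (j z)).1) ∈ U := this
    rw [hfst z hz] at h2
    exact h2
  · exact contDiff_snd.comp_contDiffOn (hu.comp j.contDiff.contDiffOn fun z hz ↦ hj z hz)
  · have h1 : HasFDerivAt (fun z ↦ (u (j z)).2) _ z :=
      (hasFDerivAt_snd (𝕜 := ℝ) (p := u (j z))).comp z
        ((hud _ (hj z hz)).comp z j.hasFDerivAt)
    rw [h1.fderiv]
    have h3 := (huU _ (hj z hz)).2 ξ
    have h4 : j (ξ, 0) = (ξ, 0) := by simp [j]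
    simp only [ContinuousLinearMap.comp_apply, h4, h3]
    show b (z.1, (u (j z)).1) ξ = b z ξ
    rw [hfst z hz]

/-- The Poincaré lemma along the fibres of a submersion: a 1-form that is closed along the fibres
is locally the differential of a function along the fibres. -/
theorem exists_primitive_along_fibres {f : V → Q} {θ : V → V →L[ℝ] ℝ} {U : Set V} (hU : IsOpen U)
    (hf : ContDiffOn ℝ ∞ f U) (hθ : ContDiffOn ℝ ∞ θ U) {e₀ : V} (he₀ : e₀ ∈ U)
    (hsurj : Function.Surjective (fderiv ℝ f e₀))
    (hclosed : ∀ e ∈ U, ∀ v w, fderiv ℝ f e v = 0 → fderiv ℝ f e w = 0 → dform θ e v w = 0) :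
    ∃ (s : V → ℝ) (O : Set V), IsOpen O ∧ e₀ ∈ O ∧ O ⊆ U ∧ ContDiffOn ℝ ∞ s O ∧
      ∀ e ∈ O, ∀ v, fderiv ℝ f e v = 0 → fderiv ℝ s e v = θ e v := by
  obtain ⟨k, hk⟩ : ∃ k, Module.finrank ℝ V = k + Module.finrank ℝ Q := by
    have h1 := (fderiv ℝ f e₀).toLinearMap.finrank_range_add_finrank_ker
    have h2 : LinearMap.range (fderiv ℝ f e₀).toLinearMap = ⊤ := LinearMap.range_eq_top.2 hsurj
    rw [h2, finrank_top] at h1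
    exact ⟨_, (add_comm _ _).trans h1 |>.symm⟩
  obtain ⟨L, hL⟩ := exists_prod_isInvertible _ hsurj hk
  let P := EuclideanSpace ℝ (Fin k)
  -- Coordinates at `e₀` in which the fibres of `f` are the slices with constant second factor.
  let Φ : V → P × Q := fun e ↦ (L (e - e₀), f e - f e₀)
  have hfd : ∀ e ∈ U, HasFDerivAt f (fderiv ℝ f e) e := fun e he ↦
    ((hf.contDiffAt (hU.mem_nhds he)).differentiableAt (by simp)).hasFDerivAt
  have hΦ : ContDiffOn ℝ ∞ Φ U :=
    (L.contDiff.comp (contDiff_id.sub contDiff_const)).contDiffOn.prodMk (hf.sub contDiffOn_const)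
  have hΦd : ∀ e ∈ U, HasFDerivAt Φ (L.prod (fderiv ℝ f e)) e := fun e he ↦
    (L.hasFDerivAt.comp e ((hasFDerivAt_id e).sub_const e₀)).prodMk ((hfd e he).sub_const _)
  obtain ⟨φ, hφ, h0φ, hφU, hφinv, hφsymm⟩ := exists_openPartialHomeomorph hU hΦ he₀
    (by rw [(hΦd e₀ he₀).fderiv]; exact hL)
  have hΦ0 : Φ e₀ = 0 := by simp [Φ]
  have h0t : 0 ∈ φ.target := by
    have := φ.map_source h0φ
    rwa [hφ, hΦ0] at this
  have hψd : ∀ z ∈ φ.target, HasFDerivAt φ.symm (fderiv ℝ φ.symm z) z := fun z hz ↦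
    ((hφsymm.contDiffAt (φ.open_target.mem_nhds hz)).differentiableAt (by simp)).hasFDerivAt
  have hψU : ∀ z ∈ φ.target, φ.symm z ∈ U := fun z hz ↦ hφU (φ.map_target hz)
  -- the derivative of the inverse
  have hright : ∀ z ∈ φ.target, ∀ ζ, L (fderiv ℝ φ.symm z ζ) = ζ.1 ∧
      fderiv ℝ f (φ.symm z) (fderiv ℝ φ.symm z ζ) = ζ.2 := by
    intro z hz ζ
    have h1 := (hΦd _ (hψU z hz)).comp z (hψd z hz)
    have h2 : (Φ ∘ φ.symm) =ᶠ[𝓝 z] id := by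
      filter_upwards [φ.open_target.mem_nhds hz] with z' hz'
      have := φ.right_inv hz'
      rwa [hφ] at this
    have h3 := congrArg (fun M ↦ M ζ) (h1.unique ((hasFDerivAt_id z).congr_of_eventuallyEq h2))
    exact ⟨congrArg Prod.fst h3, congrArg Prod.snd h3⟩
  have hleft : ∀ e ∈ φ.source, ∀ v, fderiv ℝ φ.symm (Φ e) (L v, fderiv ℝ f e v) = v := by
    intro e he v
    have het : Φ e ∈ φ.target := by rw [← hφ]; exact φ.map_source he
    have h1 := (hψd _ het).comp e (hΦd e (hφU he))
    have h2 : (φ.symm ∘ Φ) =ᶠ[𝓝 e] id := by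
      filter_upwards [φ.open_source.mem_nhds he] with e' he'
      have := φ.left_inv he'
      rwa [hφ] at this
    exact congrArg (fun M ↦ M v) (h1.unique ((hasFDerivAt_id e).congr_of_eventuallyEq h2))
  let a : P × Q → P × Q →L[ℝ] ℝ := fun z ↦ (θ (φ.symm z)).comp (fderiv ℝ φ.symm z)
  have ha : ContDiffOn ℝ ∞ a φ.target :=
    (hθ.comp hφsymm hψU).clm_comp (hφsymm.fderiv_of_isOpen φ.open_target (m := ∞) (by norm_cast))
  -- Only the part of the pulled back form tangent to the fibres matters; naturality of `dform`
  -- turns closedness along fibres into the symmetry required of `b`.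
  let b : P × Q → P →L[ℝ] ℝ := fun z ↦ (a z).comp (ContinuousLinearMap.inl ℝ P Q)
  have hbd : ∀ z ∈ φ.target, ∀ v ξ, fderiv ℝ b z v ξ = fderiv ℝ a z v (ξ, 0) := by
    intro z hz v ξ
    have h1 : HasFDerivAt a (fderiv ℝ a z) z :=
      ((ha.contDiffAt (φ.open_target.mem_nhds hz)).differentiableAt (by simp)).hasFDerivAt
    have h2 : HasFDerivAt b _ z :=
      h1.clm_comp (hasFDerivAt_const (ContinuousLinearMap.inl ℝ P Q) z)
    rw [h2.fderiv]
    simp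
  obtain ⟨s, O, hO, h0O, hOU, hs, hsb⟩ := exists_partial_primitive φ.open_target h0t
    (b := b) (ha.clm_comp contDiffOn_const) (fun z hz ξ η ↦ by
      rw [hbd z hz, hbd z hz]
      have h1 := dform_pullback (a := a) (b := θ)
        (hφsymm.contDiffAt (φ.open_target.mem_nhds hz))
        ((hθ.contDiffAt (hU.mem_nhds (hψU z hz))).differentiableAt (by simp))
        (Filter.Eventually.of_forall fun _ ↦ rfl) (ξ, 0) (η, 0)
      rw [hclosed _ (hψU z hz) _ _ (hright z hz _).2 (hright z hz _).2] at h1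
      exact sub_eq_zero.1 h1)
  have hO' : IsOpen (φ.source ∩ φ ⁻¹' O) := φ.isOpen_inter_preimage hO
  refine ⟨fun e ↦ s (Φ e), _, hO', ⟨h0φ, ?_⟩, fun e he ↦ hφU he.1, ?_, fun e he v hv ↦ ?_⟩
  · rw [mem_preimage, hφ, hΦ0]; exact h0O
  · exact hs.comp (hΦ.mono fun e he ↦ hφU he.1) fun e he ↦ by
      have := he.2
      rwa [hφ] at this
  · have heO : Φ e ∈ O := by
      have := he.2
      rwa [hφ] at this
    have hsd : HasFDerivAt s (fderiv ℝ s (Φ e)) (Φ e) :=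
      ((hs.contDiffAt (hO.mem_nhds heO)).differentiableAt (by simp)).hasFDerivAt
    have h1 : HasFDerivAt (fun e ↦ s (Φ e)) _ e := hsd.comp e (hΦd e (hφU he.1))
    rw [h1.fderiv]
    show fderiv ℝ s (Φ e) (L v, fderiv ℝ f e v) = _
    have h2 := hleft e he.1 v
    rw [hv] at h2 ⊢
    rw [hsb _ heO]
    show θ (φ.symm (Φ e)) (fderiv ℝ φ.symm (Φ e) (L v, 0)) = _
    rw [h2]
    have h3 := φ.left_inv he.1
    rw [hφ] at h3
    rw [h3]

end Poincare

end ContactFoliation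

end

noncomputable section

namespace ContactFoliation

open VectorField

/-! ### Hamiltonian fields of a 1-form and their brackets. -/

section LieDerivative

variable {V : Type*} [NormedAddCommGroup V] [NormedSpace ℝ V]

theorem symm_fderiv_fderiv {W : Type*} [NormedAddCommGroup W] [NormedSpace ℝ W] {X : V → W}
    {e : V} (hX : ContDiffAt ℝ ∞ X e) (v w : V) :
    fderiv ℝ (fderiv ℝ X) e v w = fderiv ℝ (fderiv ℝ X) e w v :=
  hX.isSymmSndFDerivAt (by rw [minSmoothness_of_isRCLikeNormedField]; norm_cast) v w

theorem hasFDerivAt_fderiv {W : Type*} [NormedAddCommGroup W] [NormedSpace ℝ W] {X : V → W}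
    {e : V} (hX : ContDiffAt ℝ ∞ X e) :
    HasFDerivAt (fderiv ℝ X) (fderiv ℝ (fderiv ℝ X) e) e :=
  ((hX.fderiv_right (m := 1) (by norm_cast)).differentiableAt (by simp)).hasFDerivAt

theorem ContDiffOn.hasFDerivAt_of_isOpen {W : Type*} [NormedAddCommGroup W] [NormedSpace ℝ W]
    {X : V → W} {O : Set V} (hX : ContDiffOn ℝ ∞ X O) (hO : IsOpen O) {e : V} (he : e ∈ O) :
    HasFDerivAt X (fderiv ℝ X e) e :=
  ((hX.contDiffAt (hO.mem_nhds he)).differentiableAt (by simp)).hasFDerivAt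

/-- The bracket acts on functions as the commutator. -/
theorem fderiv_apply_lieBracket {Q : Type*} [NormedAddCommGroup Q] [NormedSpace ℝ Q] {O : Set V}
    (hO : IsOpen O) {X Y : V → V} {c : V → Q}
    (hX : ContDiffOn ℝ ∞ X O) (hY : ContDiffOn ℝ ∞ Y O) (hc : ContDiffOn ℝ ∞ c O) {e : V}
    (he : e ∈ O) :
    fderiv ℝ c e (lieBracket ℝ X Y e) = fderiv ℝ (fun e ↦ fderiv ℝ c e (Y e)) e (X e) -
      fderiv ℝ (fun e ↦ fderiv ℝ c e (X e)) e (Y e) := by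
  have hce := hc.contDiffAt (hO.mem_nhds he)
  have h1 := (hasFDerivAt_fderiv hce).clm_apply (ContDiffOn.hasFDerivAt_of_isOpen hX hO he)
  have h2 := (hasFDerivAt_fderiv hce).clm_apply (ContDiffOn.hasFDerivAt_of_isOpen hY hO he)
  rw [h1.fderiv, h2.fderiv, lieBracket_eq]
  have := symm_fderiv_fderiv hce (X e) (Y e)
  simp [this]

/-- On `O`, the vector field `X` satisfies `a(X) = h` and `i_X da = -dh + m a`. -/
structure IsHamiltonianOn (a : V → V →L[ℝ] ℝ) (O : Set V) (X : V → V) (h m : V → ℝ) : Prop where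
  smooth_field : ContDiffOn ℝ ∞ X O
  smooth_fun : ContDiffOn ℝ ∞ h O
  smooth_factor : ContDiffOn ℝ ∞ m O
  apply_eq : ∀ e ∈ O, a e (X e) = h e
  dform_eq : ∀ e ∈ O, ∀ w, dform a e (X e) w = -fderiv ℝ h e w + m e * a e w

variable {a : V → V →L[ℝ] ℝ} {O : Set V} {X Y : V → V} {h g l m : V → ℝ}

namespace IsHamiltonianOn

/-- The Lie derivative of `a` along `X` is a multiple of `a`. -/
theorem lieDeriv_eq (hX : IsHamiltonianOn a O X h l) (hO : IsOpen O)
    (ha : ContDiffOn ℝ ∞ a O) {e : V} (he : e ∈ O) (w : V) :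
    fderiv ℝ a e (X e) w + a e (fderiv ℝ X e w) = l e * a e w := by
  have h1 := (ContDiffOn.hasFDerivAt_of_isOpen ha hO he).clm_apply
    (ContDiffOn.hasFDerivAt_of_isOpen hX.smooth_field hO he)
  have h2 := (ContDiffOn.hasFDerivAt_of_isOpen hX.smooth_fun hO he).congr_of_eventuallyEq
    (Filter.eventually_of_mem (hO.mem_nhds he) hX.apply_eq)
  have h3 := congrArg (fun L ↦ L w) (h1.unique h2)
  -- Cartan's formula: d(a(X)) = dh, from `h3`, cancels the -dh in i_X da.
  have h4 := hX.dform_eq e he w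
  simp only [dform] at h4
  simp at h3
  linarith

/-- Leibniz rule: X(a(Y)) = (L_X a)(Y) + a([X, Y]), with a(Y) = `g` and L_X a = `l` a. -/
theorem apply_lieBracket (hX : IsHamiltonianOn a O X h l) (hY : IsHamiltonianOn a O Y g m)
    (hO : IsOpen O) (ha : ContDiffOn ℝ ∞ a O) {e : V} (he : e ∈ O) :
    a e (lieBracket ℝ X Y e) = fderiv ℝ g e (X e) - l e * g e := by
  have h1 := hX.lieDeriv_eq hO ha he (Y e)
  have h2 := (ContDiffOn.hasFDerivAt_of_isOpen ha hO he).clm_apply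
    (ContDiffOn.hasFDerivAt_of_isOpen hY.smooth_field hO he)
  have h3 := (ContDiffOn.hasFDerivAt_of_isOpen hY.smooth_fun hO he).congr_of_eventuallyEq
    (Filter.eventually_of_mem (hO.mem_nhds he) hY.apply_eq)
  have h4 := congrArg (fun L ↦ L (X e)) (h2.unique h3)
  simp at h4
  rw [hY.apply_eq e he] at h1
  rw [lieBracket_eq]
  simp only [map_sub]
  linarith

/-- The derivative of the identity `L_X a = l a` along a second Hamiltonian field. -/
theorem fderiv_lieDeriv_eq (hX : IsHamiltonianOn a O X h l) (hO : IsOpen O)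
    (ha : ContDiffOn ℝ ∞ a O) {e : V} (he : e ∈ O) (y w : V) :
    fderiv ℝ (fderiv ℝ a) e y (X e) w + fderiv ℝ a e (fderiv ℝ X e y) w
      + fderiv ℝ a e y (fderiv ℝ X e w) + a e (fderiv ℝ (fderiv ℝ X) e y w)
      = fderiv ℝ l e y * a e w + l e * fderiv ℝ a e y w := by
  have had := ContDiffOn.hasFDerivAt_of_isOpen ha hO he
  have hXd := ContDiffOn.hasFDerivAt_of_isOpen hX.smooth_field hO he
  have hld := ContDiffOn.hasFDerivAt_of_isOpen hX.smooth_factor hO he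
  have ha2 := hasFDerivAt_fderiv (ha.contDiffAt (hO.mem_nhds he))
  have hX2 := hasFDerivAt_fderiv (hX.smooth_field.contDiffAt (hO.mem_nhds he))
  have hcw := hasFDerivAt_const (𝕜 := ℝ) w e
  have h1 := ((ha2.clm_apply hXd).clm_apply hcw).add (had.clm_apply (hX2.clm_apply hcw))
  have h2 := (hld.mul (had.clm_apply hcw)).congr_of_eventuallyEq
    (Filter.eventually_of_mem (hO.mem_nhds he) fun e he ↦ hX.lieDeriv_eq hO ha he w)
  have h3 := congrArg (fun L ↦ L y) (h1.unique h2)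
  simp at h3
  linarith

/-- The bracket of two Hamiltonian fields is Hamiltonian. -/
theorem dform_lieBracket (hX : IsHamiltonianOn a O X h l) (hY : IsHamiltonianOn a O Y g m)
    (hO : IsOpen O) (ha : ContDiffOn ℝ ∞ a O) {e : V} (he : e ∈ O) (w : V) :
    dform a e (lieBracket ℝ X Y e) w =
      -fderiv ℝ (fun e ↦ a e (lieBracket ℝ X Y e)) e w +
        (fderiv ℝ m e (X e) - fderiv ℝ l e (Y e)) * a e w := by
  have had := ContDiffOn.hasFDerivAt_of_isOpen ha hO he
  have hXd := ContDiffOn.hasFDerivAt_of_isOpen hX.smooth_field hO he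
  have hYd := ContDiffOn.hasFDerivAt_of_isOpen hY.smooth_field hO he
  have hXe := hX.smooth_field.contDiffAt (hO.mem_nhds he)
  have hYe := hY.smooth_field.contDiffAt (hO.mem_nhds he)
  have hX2 := hasFDerivAt_fderiv hXe
  have hY2 := hasFDerivAt_fderiv hYe
  have hb : HasFDerivAt (lieBracket ℝ X Y) _ e := (hY2.clm_apply hXd).sub (hX2.clm_apply hYd)
  have hab := had.clm_apply hb
  rw [hab.fderiv]
  -- The linear combination below is L_{[X,Y]} a = L_X(m a) - L_Y(l a) = (X m - Y l) a, expanded;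
  -- `h10` and `h11` account for the two products l m a, which cancel.
  have h1 := hX.fderiv_lieDeriv_eq hO ha he (Y e) w
  have h2 := hY.fderiv_lieDeriv_eq hO ha he (X e) w
  have h3 := hX.lieDeriv_eq hO ha he (fderiv ℝ Y e w)
  have h4 := hY.lieDeriv_eq hO ha he (fderiv ℝ X e w)
  have h5 := symm_fderiv_fderiv (ha.contDiffAt (hO.mem_nhds he)) (X e) (Y e)
  have h6 := symm_fderiv_fderiv hXe (Y e) w
  have h7 := symm_fderiv_fderiv hYe (X e) w
  have h8 := hX.lieDeriv_eq hO ha he w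
  have h9 := hY.lieDeriv_eq hO ha he w
  have h10 : m e * (fderiv ℝ a e (X e) w + a e (fderiv ℝ X e w)) = m e * (l e * a e w) := by
    rw [h8]
  have h11 : l e * (fderiv ℝ a e (Y e) w + a e (fderiv ℝ Y e w)) = l e * (m e * a e w) := by
    rw [h9]
  rw [h5] at h2
  rw [h6] at h1
  rw [h7] at h2
  rw [lieBracket_eq]
  simp [dform]
  linarith

end IsHamiltonianOn

end LieDerivative

end ContactFoliation

end

noncomputable section

namespace ContactFoliation

/-! ### Linear algebra of a covector and an alternating form in odd dimension. -/

section ContactLinearAlgebra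

variable {n : ℕ} {W : Type*} [AddCommGroup W] [Module ℝ W]

/-- Each argument occurs in exactly one factor: slot 0 in `a`, slot `j > 0` in the factor `(j - 1) /
2` of the product. -/
theorem exists_linear_update (a : W →ₗ[ℝ] ℝ) (B : W →ₗ[ℝ] W →ₗ[ℝ] ℝ) (v : Fin (2 * n + 1) → W)
    (j : Fin (2 * n + 1)) :
    ∃ l : W →ₗ[ℝ] ℝ, ∀ x, a (Function.update v j x ⟨0, by omega⟩) *
      ∏ i : Fin n, B (Function.update v j x ⟨2 * i + 1, by omega⟩)
        (Function.update v j x ⟨2 * i + 2, by omega⟩) = l x := by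
  have hne : ∀ (k : ℕ) (hk : k < 2 * n + 1) (x : W), k ≠ j →
      Function.update v j x ⟨k, hk⟩ = v ⟨k, hk⟩ := fun k hk x h ↦
    Function.update_of_ne (fun h' ↦ h (congrArg Fin.val h')) _ _
  have heq : ∀ (k : ℕ) (hk : k < 2 * n + 1) (x : W), k = j →
      Function.update v j x ⟨k, hk⟩ = x := by
    intro k hk x h
    have : (⟨k, hk⟩ : Fin (2 * n + 1)) = j := Fin.ext h
    rw [this, Function.update_self]
  rcases Nat.eq_zero_or_pos (j : ℕ) with hj | hj
  · refine ⟨(∏ i : Fin n, B (v ⟨2 * i + 1, by omega⟩) (v ⟨2 * i + 2, by omega⟩)) • a,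
      fun x ↦ ?_⟩
    rw [heq 0 _ x hj.symm, LinearMap.smul_apply, smul_eq_mul, mul_comm]
    congr 1
    refine Finset.prod_congr rfl fun i _ ↦ ?_
    rw [hne _ _ _ (by omega), hne _ _ _ (by omega)]
  · obtain ⟨i₀, hi₀⟩ : ∃ i : Fin n, 2 * (i : ℕ) + 1 = j ∨ 2 * (i : ℕ) + 2 = j :=
      ⟨⟨((j : ℕ) - 1) / 2, by omega⟩, by simp only; omega⟩
    have hprod : ∀ x, ∏ i : Fin n, B (Function.update v j x ⟨2 * i + 1, by omega⟩)
        (Function.update v j x ⟨2 * i + 2, by omega⟩) =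
        B (Function.update v j x ⟨2 * i₀ + 1, by omega⟩)
          (Function.update v j x ⟨2 * i₀ + 2, by omega⟩) *
        ∏ i ∈ Finset.univ.erase i₀, B (v ⟨2 * i + 1, by omega⟩) (v ⟨2 * i + 2, by omega⟩) := by
      intro x
      rw [← Finset.mul_prod_erase _ _ (Finset.mem_univ i₀)]
      congr 1
      refine Finset.prod_congr rfl fun i hi ↦ ?_
      have hi' : (i : ℕ) ≠ i₀ := fun h ↦ (Finset.mem_erase.1 hi).1 (Fin.ext h)
      rw [hne _ _ _ (by omega), hne _ _ _ (by omega)]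
    rcases hi₀ with h | h
    · refine ⟨(a (v ⟨0, by omega⟩) * ∏ i ∈ Finset.univ.erase i₀,
        B (v ⟨2 * i + 1, by omega⟩) (v ⟨2 * i + 2, by omega⟩)) •
          B.flip (v ⟨2 * i₀ + 2, by omega⟩), fun x ↦ ?_⟩
      rw [hprod, hne 0 _ _ (by omega), heq _ _ _ h, hne (2 * i₀ + 2) _ _ (by omega)]
      simp only [LinearMap.smul_apply, LinearMap.flip_apply, smul_eq_mul]
      ring
    · refine ⟨(a (v ⟨0, by omega⟩) * ∏ i ∈ Finset.univ.erase i₀,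
        B (v ⟨2 * i + 1, by omega⟩) (v ⟨2 * i + 2, by omega⟩)) •
          B (v ⟨2 * i₀ + 1, by omega⟩), fun x ↦ ?_⟩
      rw [hprod, hne 0 _ _ (by omega), heq _ _ _ h, hne (2 * i₀ + 1) _ _ (by omega)]
      simp only [LinearMap.smul_apply, smul_eq_mul]
      ring

/-- The multilinear map whose antisymmetrization is `a ∧ Bⁿ`. -/
def contactMultilinear (n : ℕ) (a : W →ₗ[ℝ] ℝ) (B : W →ₗ[ℝ] W →ₗ[ℝ] ℝ) :
    MultilinearMap ℝ (fun _ : Fin (2 * n + 1) ↦ W) ℝ :=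
  MultilinearMap.mk' (fun v ↦ a (v ⟨0, by omega⟩) *
      ∏ i : Fin n, B (v ⟨2 * i + 1, by omega⟩) (v ⟨2 * i + 2, by omega⟩))
    (fun v j x y ↦ by
      obtain ⟨l, hl⟩ := exists_linear_update a B v j
      rw [hl, hl, hl, map_add])
    (fun v j c x ↦ by
      obtain ⟨l, hl⟩ := exists_linear_update a B v j
      rw [hl, hl, map_smul])

/-- If `a ∧ Bⁿ ≠ 0` in dimension `2n + 1`, then `ker a ∩ ker B = 0`. -/
theorem eq_zero_of_contact [FiniteDimensional ℝ W] (hdim : Module.finrank ℝ W = 2 * n + 1)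
    (a : W →ₗ[ℝ] ℝ) (B : W →ₗ[ℝ] W →ₗ[ℝ] ℝ) (hB : ∀ v w, B v w = -B w v)
    {v : Fin (2 * n + 1) → W}
    (hv : ∑ σ : Equiv.Perm (Fin (2 * n + 1)), ((Equiv.Perm.sign σ : ℤ) : ℝ) *
      (a (v (σ ⟨0, by omega⟩)) *
        ∏ i : Fin n, B (v (σ ⟨2 * i + 1, by omega⟩)) (v (σ ⟨2 * i + 2, by omega⟩))) ≠ 0)
    {w : W} (haw : a w = 0) (hBw : ∀ u, B w u = 0) : w = 0 := by
  let vol := MultilinearMap.alternatization (contactMultilinear n a B)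
  have hvol : ∀ v, vol v = ∑ σ : Equiv.Perm (Fin (2 * n + 1)), ((Equiv.Perm.sign σ : ℤ) : ℝ) *
      (a (v (σ ⟨0, by omega⟩)) *
        ∏ i : Fin n, B (v (σ ⟨2 * i + 1, by omega⟩)) (v (σ ⟨2 * i + 2, by omega⟩))) := by
    intro v
    rw [MultilinearMap.alternatization_apply]
    refine Finset.sum_congr rfl fun σ _ ↦ ?_
    rw [Units.smul_def, zsmul_eq_mul]
    rfl
  rw [← hvol] at hv
  -- In each term of the antisymmetrization `w` is fed either to `a` or to one side of some `B`, and
  -- all of these vanish.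
  have hzero : ∀ j, vol (Function.update v j w) = 0 := by
    intro j
    rw [hvol]
    refine Finset.sum_eq_zero fun σ _ ↦ ?_
    refine mul_eq_zero_of_right _ ?_
    have hj : ∀ k, σ k = j → Function.update v j w (σ k) = w := fun k h ↦ by
      rw [h, Function.update_self]
    obtain ⟨k, hk⟩ := σ.surjective j
    rcases Nat.eq_zero_or_pos (k : ℕ) with h0 | h0
    · refine mul_eq_zero_of_left ?_ _
      rw [hj ⟨0, by omega⟩ (by rw [← hk]; congr 1; exact Fin.ext h0.symm), haw]
    · refine mul_eq_zero_of_right _ ?_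
      have hi : ((k : ℕ) - 1) / 2 < n := by omega
      refine Finset.prod_eq_zero (Finset.mem_univ ⟨((k : ℕ) - 1) / 2, hi⟩) ?_
      rcases Nat.even_or_odd (k : ℕ) with he | ho
      · rw [hB, hj ⟨2 * (((k : ℕ) - 1) / 2) + 2, by omega⟩
          (by rw [← hk]; congr 1; obtain ⟨t, ht⟩ := he; exact Fin.ext (by simp only; omega)),
          hBw, neg_zero]
      · rw [hj ⟨2 * (((k : ℕ) - 1) / 2) + 1, by omega⟩
          (by rw [← hk]; congr 1; obtain ⟨t, ht⟩ := ho; exact Fin.ext (by simp only; omega)), hBw]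
  by_contra hw
  have hli : LinearIndependent ℝ v := by
    by_contra hli
    exact hv (vol.map_linearDependent v hli)
  let b := basisOfLinearIndependentOfCardEqFinrank hli (by simp [hdim])
  have hb : ⇑b = v := coe_basisOfLinearIndependentOfCardEqFinrank hli (by simp [hdim])
  obtain ⟨j, hj⟩ : ∃ j, b.repr w j ≠ 0 := by
    by_contra! h
    exact hw (b.repr.map_eq_zero_iff.1 (Finsupp.ext h))
  have hsum := b.sum_repr w
  rw [hb] at hsum
  -- Expanding `w` in the basis `v` leaves only its `j`-th coordinate times `vol v`, which is
  -- nonzero.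
  have h1 := hzero j
  rw [← hsum, vol.map_update_sum, Finset.sum_eq_single j] at h1
  · rw [vol.map_update_smul, Function.update_eq_self, smul_eq_mul] at h1
    exact (mul_ne_zero hj hv) h1
  · intro i _ hij
    rw [vol.map_update_smul, vol.map_update_self v hij.symm, smul_zero]
  · simp

/-- An alternating form in odd dimension is degenerate. -/
theorem exists_ker_of_odd [FiniteDimensional ℝ W] (hdim : Module.finrank ℝ W = 2 * n + 1)
    (B : W →ₗ[ℝ] W →ₗ[ℝ] ℝ) (hB : ∀ v w, B v w = -B w v) : ∃ z ≠ 0, ∀ w, B z w = 0 := by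
  let b := Module.finBasisOfFinrankEq ℝ W hdim
  let A : Matrix (Fin (2 * n + 1)) (Fin (2 * n + 1)) ℝ := fun i j ↦ B (b i) (b j)
  have hA : A.transpose = -A := by
    ext i j
    exact hB _ _
  -- The size is odd, so det A = det Aᵀ = det(-A) = -det A.
  have hdet : A.det = 0 := by
    have h := A.det_transpose
    rw [hA, Matrix.det_neg, Fintype.card_fin, pow_succ, pow_mul] at h
    norm_num at h
    linarith
  obtain ⟨c, hc, hAc⟩ := Matrix.exists_vecMul_eq_zero_iff.2 hdet
  refine ⟨∑ i, c i • b i, ?_, ?_⟩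
  · intro h
    exact hc (funext (Fintype.linearIndependent_iff.1 b.linearIndependent c h))
  · have : B (∑ i, c i • b i) = 0 := b.ext fun j ↦ by
      have := congrFun hAc j
      simpa [Matrix.vecMul, dotProduct, A, LinearMap.sum_apply] using this
    intro w
    rw [this]; rfl

/-- The antisymmetrization of a bilinear form, pulled back by a linear map. -/
def skewBilin {V : Type*} [NormedAddCommGroup V] [NormedSpace ℝ V] [TopologicalSpace W]
    (B : V →L[ℝ] V →L[ℝ] ℝ) (c : W →L[ℝ] V) : W →ₗ[ℝ] W →ₗ[ℝ] ℝ :=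
  LinearMap.mk₂ ℝ (fun v w ↦ B (c v) (c w) - B (c w) (c v))
    (fun v v' w ↦ by simp only [map_add, add_apply]; ring)
    (fun c v w ↦ by simp only [map_smul, smul_apply, smul_eq_mul]; ring)
    (fun v w w' ↦ by simp only [map_add, add_apply]; ring)
    (fun c v w ↦ by simp only [map_smul, smul_apply, smul_eq_mul]; ring)

end ContactLinearAlgebra

/-! ### The contact structure at a point: Reeb vector, contact vectors, pseudo-orthogonals. -/

section PointwiseContact

variable {n : ℕ} {M : Type u} [TopologicalSpace M]
  [ChartedSpace (EuclideanSpace ℝ (Fin (2 * n + 1))) M]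

instance (x : M) : FiniteDimensional ℝ (TangentSpace (𝓡 (2 * n + 1)) x) :=
  inferInstanceAs (FiniteDimensional ℝ (EuclideanSpace ℝ (Fin (2 * n + 1))))

instance (x : M) : T2Space (TangentSpace (𝓡 (2 * n + 1)) x) :=
  inferInstanceAs (T2Space (EuclideanSpace ℝ (Fin (2 * n + 1))))

theorem finrank_tangentSpace (x : M) :
    Module.finrank ℝ (TangentSpace (𝓡 (2 * n + 1)) x) = 2 * n + 1 :=
  finrank_euclideanSpace_fin

variable (α : OneForm n M) (x : M)

/-- `dα` at a point, as a bilinear map. -/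
def extDerBilin : TangentSpace (𝓡 (2 * n + 1)) x →ₗ[ℝ] TangentSpace (𝓡 (2 * n + 1)) x →ₗ[ℝ] ℝ :=
  skewBilin (fderiv ℝ (inChart α x) (extChartAt (𝓡 (2 * n + 1)) x x))
    (mfderiv (𝓡 (2 * n + 1)) 𝓘(ℝ, EuclideanSpace ℝ (Fin (2 * n + 1)))
      (extChartAt (𝓡 (2 * n + 1)) x) x)

@[simp] theorem extDerBilin_apply (v w : TangentSpace (𝓡 (2 * n + 1)) x) :
    extDerBilin α x v w = extDer α x v w := rfl

variable {α x}

theorem extDer_swap (v w : TangentSpace (𝓡 (2 * n + 1)) x) :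
    extDer α x v w = -extDer α x w v := by
  simp only [extDer]; ring

theorem extDer_add_left (v v' w : TangentSpace (𝓡 (2 * n + 1)) x) :
    extDer α x (v + v') w = extDer α x v w + extDer α x v' w :=
  (extDerBilin α x).map_add₂ v v' w

theorem extDer_smul_left (c : ℝ) (v w : TangentSpace (𝓡 (2 * n + 1)) x) :
    extDer α x (c • v) w = c * extDer α x v w :=
  (extDerBilin α x).map_smul₂ c v w

theorem extDer_sub_left (v v' w : TangentSpace (𝓡 (2 * n + 1)) x) :
    extDer α x (v - v') w = extDer α x v w - extDer α x v' w :=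
  (extDerBilin α x).map_sub₂ v v' w

theorem extDer_add_right (v w w' : TangentSpace (𝓡 (2 * n + 1)) x) :
    extDer α x v (w + w') = extDer α x v w + extDer α x v w' :=
  (extDerBilin α x v).map_add w w'

theorem extDer_smul_right (c : ℝ) (v w : TangentSpace (𝓡 (2 * n + 1)) x) :
    extDer α x v (c • w) = c * extDer α x v w :=
  (extDerBilin α x v).map_smul c w

/-- `α ∧ (dα)ⁿ` does not vanish at `x`. -/
def IsContactAt (α : OneForm n M) (x : M) : Prop := ∃ v, contactVolume α x v ≠ 0

theorem IsContactForm.isContactAt [IsManifold (𝓡 (2 * n + 1)) ∞ M] (hα : IsContactForm α) (x : M) :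
    IsContactAt α x := hα.nonvanishing x

namespace IsContactAt

theorem eq_zero (h : IsContactAt α x) {w : TangentSpace (𝓡 (2 * n + 1)) x} (h1 : α x w = 0)
    (h2 : ∀ u, extDer α x w u = 0) : w = 0 := by
  obtain ⟨v, hv⟩ := h
  exact eq_zero_of_contact (finrank_tangentSpace x) (α x).toLinearMap (extDerBilin α x)
    (fun v w ↦ extDer_swap v w) (v := v) hv h1 h2

/-- The nondegeneracy principle by which all later identities between Reeb, contact and bracket
vectors are proved. -/
theorem eq_of_eq (h : IsContactAt α x) {v w : TangentSpace (𝓡 (2 * n + 1)) x}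
    (h1 : α x v = α x w) (h2 : ∀ u, extDer α x v u = extDer α x w u) : v = w :=
  sub_eq_zero.1 (h.eq_zero (by rw [map_sub, h1, sub_self]) fun u ↦ by
    rw [extDer_sub_left, h2, sub_self])

/-- The choice in `reeb` has a witness: `dα` has a nonzero kernel vector in odd dimension, and `α`
cannot vanish on it, so it can be normalized. -/
theorem reeb_spec (h : IsContactAt α x) :
    α x (reeb α x) = 1 ∧ ∀ w, extDer α x (reeb α x) w = 0 := by
  refine Classical.epsilon_spec (p := fun z ↦ α x z = 1 ∧ ∀ w, extDer α x z w = 0) ?_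
  obtain ⟨z, hz, hzw⟩ := exists_ker_of_odd (finrank_tangentSpace x) (extDerBilin α x)
    (fun v w ↦ extDer_swap v w)
  have hαz : α x z ≠ 0 := fun h0 ↦ hz (h.eq_zero h0 hzw)
  refine ⟨(α x z)⁻¹ • z, ?_, fun w ↦ ?_⟩
  · rw [map_smul, smul_eq_mul, inv_mul_cancel₀ hαz]
  · rw [extDer_smul_left]
    have : extDer α x z w = 0 := hzw w
    rw [this, mul_zero]

theorem apply_reeb (h : IsContactAt α x) : α x (reeb α x) = 1 := h.reeb_spec.1

theorem extDer_reeb_left (h : IsContactAt α x) (w : TangentSpace (𝓡 (2 * n + 1)) x) :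
    extDer α x (reeb α x) w = 0 := h.reeb_spec.2 w

theorem extDer_reeb_right (h : IsContactAt α x) (w : TangentSpace (𝓡 (2 * n + 1)) x) :
    extDer α x w (reeb α x) = 0 := by rw [extDer_swap, h.extDer_reeb_left, neg_zero]

/-- The map v ↦ i_v dα + α(v)α is injective, hence onto the dual; evaluation at the Reeb vector
shows that the preimage of -η is horizontal when η kills that vector. -/
theorem alphaSharp_spec (h : IsContactAt α x) {η : TangentSpace (𝓡 (2 * n + 1)) x →L[ℝ] ℝ}
    (hη : η (reeb α x) = 0) :
    α x (alphaSharp α x η) = 0 ∧ ∀ w, -(extDer α x (alphaSharp α x η) w) = η w := by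
  refine Classical.epsilon_spec (p := fun v ↦ α x v = 0 ∧ ∀ w, -(extDer α x v w) = η w) ?_
  let Ψ : TangentSpace (𝓡 (2 * n + 1)) x →ₗ[ℝ] Module.Dual ℝ (TangentSpace (𝓡 (2 * n + 1)) x) :=
    extDerBilin α x + LinearMap.smulRight (α x).toLinearMap (α x).toLinearMap
  have hΨ : ∀ v w, Ψ v w = extDer α x v w + α x v * α x w := fun v w ↦ rfl
  have hinj : Function.Injective Ψ := by
    refine (injective_iff_map_eq_zero _).2 fun v hv ↦ ?_
    have h1 : ∀ w, extDer α x v w + α x v * α x w = 0 := fun w ↦ by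
      rw [← hΨ, hv]; rfl
    have h2 : α x v = 0 := by
      have := h1 (reeb α x)
      rwa [h.extDer_reeb_right, h.apply_reeb, zero_add, mul_one] at this
    exact h.eq_zero h2 fun w ↦ by simpa [h2] using h1 w
  have hsurj := (LinearMap.injective_iff_surjective_of_finrank_eq_finrank
    (Subspace.dual_finrank_eq (K := ℝ)).symm).1 hinj
  obtain ⟨v, hv⟩ := hsurj (-η.toLinearMap)
  have h1 : ∀ w, extDer α x v w + α x v * α x w = -η w := fun w ↦ by
    rw [← hΨ, hv]; rfl
  have h2 : α x v = 0 := by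
    have := h1 (reeb α x)
    rwa [h.extDer_reeb_right, h.apply_reeb, zero_add, mul_one, hη, neg_zero] at this
  refine ⟨v, h2, fun w ↦ ?_⟩
  have := h1 w
  rw [h2, zero_mul, add_zero] at this
  rw [this, neg_neg]

theorem semiBasic_reeb (h : IsContactAt α x) (η : TangentSpace (𝓡 (2 * n + 1)) x →L[ℝ] ℝ) :
    semiBasic α x η (reeb α x) = 0 := by
  simp [semiBasic, h.apply_reeb]

theorem apply_lambdaSharp (h : IsContactAt α x) (η : TangentSpace (𝓡 (2 * n + 1)) x →L[ℝ] ℝ) :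
    α x (lambdaSharp α x η) = 0 :=
  (h.alphaSharp_spec (h.semiBasic_reeb η)).1

theorem extDer_lambdaSharp (h : IsContactAt α x) (η : TangentSpace (𝓡 (2 * n + 1)) x →L[ℝ] ℝ)
    (w : TangentSpace (𝓡 (2 * n + 1)) x) :
    extDer α x (lambdaSharp α x η) w = -η w + η (reeb α x) * α x w := by
  have := (h.alphaSharp_spec (h.semiBasic_reeb η)).2 w
  have h2 : semiBasic α x η w = η w - η (reeb α x) * α x w := by simp [semiBasic]
  rw [h2] at this
  show extDer α x (alphaSharp α x (semiBasic α x η)) w = _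
  linarith

theorem apply_contactField (h : IsContactAt α x) (f : M → ℝ) :
    α x (contactField α f x) = f x := by
  simp only [contactField, map_add, map_smul, h.apply_reeb, h.apply_lambdaSharp, smul_eq_mul,
    mul_one, add_zero]

theorem extDer_contactField (h : IsContactAt α x) (f : M → ℝ)
    (w : TangentSpace (𝓡 (2 * n + 1)) x) :
    extDer α x (contactField α f x) w =
      -differential f x w + differential f x (reeb α x) * α x w := by
  simp only [contactField]
  rw [extDer_add_left, extDer_smul_left, h.extDer_reeb_left, h.extDer_lambdaSharp, mul_zero,
    zero_add]

/-- A subspace containing the Reeb vector has the pseudo-orthogonal given by `dα`. -/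
theorem mem_pseudoOrth_of_reeb_mem (h : IsContactAt α x) {D : PlaneField n M} (hD : reeb α x ∈ D x)
    {v : TangentSpace (𝓡 (2 * n + 1)) x} :
    v ∈ pseudoOrth α D x ↔ ∀ u ∈ D x, extDer α x v u = 0 := by
  constructor
  · intro hv u hu
    obtain ⟨z, hz, y, hy, rfl⟩ := Submodule.mem_sup.1 hv
    obtain ⟨c, rfl⟩ := Submodule.mem_span_singleton.1 hz
    rw [extDer_add_left, extDer_smul_left, h.extDer_reeb_left, mul_zero, zero_add]
    induction hy using Submodule.span_induction with
    | mem y hy =>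
      obtain ⟨η, hη, rfl⟩ := hy
      rw [h.extDer_lambdaSharp, hη u hu, hη _ hD, zero_mul, neg_zero, zero_add]
    | zero => exact (extDerBilin α x).map_zero₂ u
    | add y y' _ _ h1 h2 =>
      have h1' := h1 (Submodule.mem_sup.2 ⟨_, hz, y, ‹_›, rfl⟩)
      have h2' := h2 (Submodule.mem_sup.2 ⟨_, hz, y', ‹_›, rfl⟩)
      rw [extDer_add_left, h1', h2', add_zero]
    | smul c' y _ h1 =>
      have h1' := h1 (Submodule.mem_sup.2 ⟨_, hz, y, ‹_›, rfl⟩)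
      rw [extDer_smul_left, h1', mul_zero]
  · intro hv
    -- With η = -i_v dα, which annihilates `D`, one has v = α(v)Z + Λ^♯η.
    let η : TangentSpace (𝓡 (2 * n + 1)) x →L[ℝ] ℝ :=
      (-(extDerBilin α x v)).toContinuousLinearMap
    have hη : ∀ u, η u = -extDer α x v u := fun u ↦ rfl
    refine Submodule.mem_sup.2 ⟨α x v • reeb α x, Submodule.smul_mem _ _
      (Submodule.mem_span_singleton_self _), lambdaSharp α x η, Submodule.subset_span
        ⟨η, fun u hu ↦ by rw [hη, hv u hu, neg_zero], rfl⟩, ?_⟩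
    refine h.eq_of_eq ?_ fun u ↦ ?_
    · simp [h.apply_reeb, h.apply_lambdaSharp]
    · rw [extDer_add_left, extDer_smul_left, h.extDer_reeb_left, h.extDer_lambdaSharp, hη, hη,
        h.extDer_reeb_right]
      simp

theorem mem_horizontal {v : TangentSpace (𝓡 (2 * n + 1)) x} :
    v ∈ horizontal α x ↔ α x v = 0 := Iff.rfl

/-- A subspace containing the Reeb vector is spanned by it and its horizontal part. -/
theorem sub_mem_horizontalPart (h : IsContactAt α x) {D : PlaneField n M} (hD : reeb α x ∈ D x)
    {v : TangentSpace (𝓡 (2 * n + 1)) x} (hv : v ∈ D x) :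
    v - α x v • reeb α x ∈ horizontalPart α D x :=
  ⟨Submodule.sub_mem _ hv (Submodule.smul_mem _ _ hD), by
    rw [SetLike.mem_coe, mem_horizontal]; simp [h.apply_reeb]⟩

/-- `D` is spanned by its horizontal part and the Reeb vector, and the latter is in the kernel of
`dα`. -/
theorem extDer_eq_zero_iff (h : IsContactAt α x) {D : PlaneField n M} (hD : reeb α x ∈ D x)
    {v : TangentSpace (𝓡 (2 * n + 1)) x} :
    (∀ u ∈ horizontalPart α D x, extDer α x v u = 0) ↔ ∀ u ∈ D x, extDer α x v u = 0 := by
  refine ⟨fun H u hu ↦ ?_, fun H u hu ↦ H u hu.1⟩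
  have h1 := H _ (h.sub_mem_horizontalPart hD hu)
  have h2 : u = (u - α x u • reeb α x) + α x u • reeb α x := by abel
  rw [h2, extDer_add_right, h1, extDer_smul_right, h.extDer_reeb_right, mul_zero, zero_add]

/-- The annihilator of D ∩ ℋ is larger than that of D, as it contains α; but Λ^♯ only sees the
semi-basic part, so the pseudo-orthogonal does not grow. -/
theorem mem_pseudoOrth_horizontalPart (h : IsContactAt α x) {D : PlaneField n M}
    (hD : reeb α x ∈ D x) {v : TangentSpace (𝓡 (2 * n + 1)) x} :
    v ∈ pseudoOrth α (horizontalPart α D) x ↔ ∀ u ∈ D x, extDer α x v u = 0 := by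
  rw [← h.extDer_eq_zero_iff hD]
  constructor
  · intro hv u hu
    obtain ⟨z, hz, y, hy, rfl⟩ := Submodule.mem_sup.1 hv
    obtain ⟨c, rfl⟩ := Submodule.mem_span_singleton.1 hz
    have hαu : α x u = 0 := hu.2
    rw [extDer_add_left, extDer_smul_left, h.extDer_reeb_left, mul_zero, zero_add]
    clear hv
    induction hy using Submodule.span_induction with
    | mem y hy =>
      obtain ⟨η, hη, rfl⟩ := hy
      rw [h.extDer_lambdaSharp, hη u hu, hαu, mul_zero, neg_zero, zero_add]
    | zero => exact (extDerBilin α x).map_zero₂ u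
    | add y y' _ _ h1 h2 => rw [extDer_add_left, h1, h2, add_zero]
    | smul c' y _ h1 => rw [extDer_smul_left, h1, mul_zero]
  · intro hv
    have h1 := (h.mem_pseudoOrth_of_reeb_mem hD).2 ((h.extDer_eq_zero_iff hD).1 hv)
    have h2 : lambdaSharp α x '' {η | ∀ v ∈ D x, η v = 0} ⊆
        lambdaSharp α x '' {η | ∀ v ∈ horizontalPart α D x, η v = 0} :=
      image_mono fun η hη u hu ↦ hη u hu.1
    have h3 : pseudoOrth α D x ≤ pseudoOrth α (horizontalPart α D) x :=
      sup_le_sup le_rfl (Submodule.span_mono h2)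
    exact h3 h1

/-- A subspace containing the Reeb vector is the `dα`-orthogonal of its pseudo-orthogonal. -/
theorem mem_iff_extDer_pseudoOrth (h : IsContactAt α x) {D : PlaneField n M} (hD : reeb α x ∈ D x)
    {v : TangentSpace (𝓡 (2 * n + 1)) x} :
    v ∈ D x ↔ ∀ w ∈ pseudoOrth α D x, extDer α x v w = 0 := by
  constructor
  · intro hv w hw
    rw [extDer_swap, (h.mem_pseudoOrth_of_reeb_mem hD).1 hw v hv, neg_zero]
  · intro hv
    by_contra hvD
    -- A covector separating `v` from `D` yields a vector of the pseudo-orthogonal that pairs with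
    -- `v` to η(v), which is nonzero.
    obtain ⟨η, hηv, hηD⟩ := Submodule.exists_le_ker_of_notMem hvD
    let η' : TangentSpace (𝓡 (2 * n + 1)) x →L[ℝ] ℝ := η.toContinuousLinearMap
    have hη' : ∀ u, η' u = η u := fun u ↦ rfl
    have hann : ∀ u ∈ D x, η' u = 0 := fun u hu ↦ hηD hu
    have h1 : lambdaSharp α x η' ∈ pseudoOrth α D x :=
      (le_sup_right : _ ≤ pseudoOrth α D x) (Submodule.subset_span ⟨η', hann, rfl⟩)
    have h2 := hv _ h1
    rw [extDer_swap, h.extDer_lambdaSharp, hann _ hD, zero_mul, add_zero, neg_neg] at h2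
    exact hηv h2

theorem reeb_mem_pseudoOrth (D : PlaneField n M) : reeb α x ∈ pseudoOrth α D x :=
  (le_sup_left : _ ≤ pseudoOrth α D x) (Submodule.mem_span_singleton_self _)

theorem contactField_one (h : IsContactAt α x) : contactField α (fun _ ↦ 1) x = reeb α x := by
  have hd : differential (n := n) (fun _ : M ↦ (1 : ℝ)) x = 0 := mfderiv_const
  refine h.eq_of_eq ?_ fun u ↦ ?_
  · rw [h.apply_contactField, h.apply_reeb]
  · rw [h.extDer_contactField, h.extDer_reeb_left, hd]
    simp

/-- The contact field of a function constant along `D` is pseudo-orthogonal to `D`. -/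
theorem contactField_mem_pseudoOrth (h : IsContactAt α x) {D : PlaneField n M}
    (hD : reeb α x ∈ D x) {f : M → ℝ} (hf : ∀ u ∈ D x, differential f x u = 0) :
    contactField α f x ∈ pseudoOrth α D x :=
  (h.mem_pseudoOrth_of_reeb_mem hD).2 fun u hu ↦ by
    rw [h.extDer_contactField, hf u hu, hf _ hD, zero_mul, neg_zero, zero_add]

section Frame

variable {q : ℕ} {f : Fin q → M → ℝ}
  {L : TangentSpace (𝓡 (2 * n + 1)) x →ₗ[ℝ] EuclideanSpace ℝ (Fin q)}

/-- In a vanishing combination, pairing through `dα` with a vector that `L` sends to the `j`-th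
basis vector isolates the coefficient of `f j`; then `α` isolates that of the function 1. -/
theorem linearIndependent_contactField (h : IsContactAt α x) (hL : Function.Surjective L)
    (hf : ∀ i v, differential (f i) x v = L v i) (hZ : L (reeb α x) = 0) :
    LinearIndependent ℝ fun i ↦
      contactField α ((Fin.cons (fun _ ↦ 1) f : Fin (q + 1) → M → ℝ) i) x := by
  rw [Fintype.linearIndependent_iff]
  intro c hc
  simp only [Fin.sum_univ_succ, Fin.cons_zero, Fin.cons_succ] at hc
  have hfZ : ∀ i, differential (f i) x (reeb α x) = 0 := fun i ↦ by rw [hf, hZ]; rfl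
  have hsucc : ∀ j : Fin q, c j.succ = 0 := by
    intro j
    obtain ⟨w, hw⟩ := hL (EuclideanSpace.single j 1)
    have h1 := congrArg (fun v ↦ extDerBilin α x v w) hc
    simp only [map_add, map_smul, map_sum, LinearMap.add_apply, LinearMap.smul_apply,
      LinearMap.sum_apply, map_zero, LinearMap.zero_apply, extDerBilin_apply, smul_eq_mul] at h1
    rw [h.contactField_one, h.extDer_reeb_left, mul_zero, zero_add, Finset.sum_eq_single j] at h1
    · rw [h.extDer_contactField, hfZ, hf, hw] at h1
      simpa using h1
    · intro i _ hij
      rw [h.extDer_contactField, hfZ, hf, hw]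
      simp [hij]
    · simp
  have hzero : c 0 = 0 := by
    simp only [hsucc, zero_smul, Finset.sum_const_zero, add_zero] at hc
    rw [h.contactField_one] at hc
    have := congrArg (α x) hc
    simpa [h.apply_reeb] using this
  exact Fin.cases hzero hsucc

/-- The pseudo-orthogonal is spanned by the contact fields of `1` and of defining functions. -/
theorem span_contactField (h : IsContactAt α x) {D : PlaneField n M}
    (hf : ∀ i v, differential (f i) x v = L v i) (hD : D x = LinearMap.ker L)
    (hZ : reeb α x ∈ D x) :
    Submodule.span ℝ (range fun i ↦
      contactField α ((Fin.cons (fun _ ↦ 1) f : Fin (q + 1) → M → ℝ) i) x) =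
      pseudoOrth α D x := by
  have hker : ∀ u, u ∈ D x → L u = 0 := fun u hu ↦ by rw [hD] at hu; exact hu
  have hfD : ∀ i, ∀ u ∈ D x, differential (f i) x u = 0 := fun i u hu ↦ by
    rw [hf, hker u hu]; rfl
  apply le_antisymm
  · rw [Submodule.span_le]
    rintro _ ⟨i, rfl⟩
    refine Fin.cases ?_ (fun j ↦ ?_) i
    · simp only [Fin.cons_zero, SetLike.mem_coe]
      rw [h.contactField_one]
      exact reeb_mem_pseudoOrth D
    · simp only [Fin.cons_succ, SetLike.mem_coe]
      exact h.contactField_mem_pseudoOrth hZ (hfD j)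
  · intro v hv
    rw [h.mem_pseudoOrth_of_reeb_mem hZ] at hv
    -- The form i_v dα kills ker `L`, so it factors through `L`; its components supply the
    -- coefficients of the contact vectors.
    have hmem : extDerBilin α x v ∈ (LinearMap.ker L).dualAnnihilator := by
      rw [Submodule.mem_dualAnnihilator, ← hD]
      exact hv
    rw [← LinearMap.range_dualMap_eq_dualAnnihilator_ker] at hmem
    obtain ⟨l, hl⟩ := hmem
    have hl' : ∀ w, extDer α x v w = ∑ i, l (EuclideanSpace.single i 1) * L w i := by
      intro w
      have h1 : extDer α x v w = l (L w) := by
        rw [← extDerBilin_apply, ← hl]; rfl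
      have h2 : L w = ∑ i, (L w i) • EuclideanSpace.single i (1 : ℝ) := by
        have := (EuclideanSpace.basisFun (Fin q) ℝ).sum_repr (L w)
        simpa using this.symm
      rw [h1]
      conv_lhs => rw [h2]
      simp [mul_comm]
    set y := ∑ i, (-l (EuclideanSpace.single i 1)) • contactField α (f i) x with hy
    -- `y` has the same contraction with `dα` as `v`, so they differ by a multiple of the Reeb
    -- vector, which is the contact vector of 1.
    have hvy : v = y + (α x v - α x y) • reeb α x := by
      refine h.eq_of_eq ?_ fun w ↦ ?_
      · simp [h.apply_reeb]
      · rw [extDer_add_left, extDer_smul_left, h.extDer_reeb_left, mul_zero, add_zero, hl', hy,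
          ← extDerBilin_apply]
        simp only [map_sum, map_smul, LinearMap.sum_apply, LinearMap.smul_apply,
          extDerBilin_apply, smul_eq_mul]
        refine Finset.sum_congr rfl fun i _ ↦ ?_
        rw [h.extDer_contactField, hfD i _ hZ, hf]
        ring
    rw [hvy]
    have hmem : ∀ i, contactField α ((Fin.cons (fun _ ↦ 1) f : Fin (q + 1) → M → ℝ) i) x ∈
        Submodule.span ℝ (range fun i ↦
          contactField α ((Fin.cons (fun _ ↦ 1) f : Fin (q + 1) → M → ℝ) i) x) :=
      fun i ↦ Submodule.subset_span ⟨i, rfl⟩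
    refine Submodule.add_mem _ (Submodule.sum_mem _ fun i _ ↦ Submodule.smul_mem _ _ ?_)
      (Submodule.smul_mem _ _ ?_)
    · exact hmem i.succ
    · have := hmem 0
      simp only [Fin.cons_zero] at this
      rwa [h.contactField_one] at this

end Frame

end IsContactAt

section Flag

variable {F : PlaneField n M}

/-- Isotropy of the horizontal part extends to all of `F`, one argument at a time, because the
missing direction is the Reeb vector. -/
theorem IsPreIsotropic.extDer_eq_zero (hF : IsPreIsotropic α F) (h : ∀ x, IsContactAt α x)
    (hZ : ∀ x, reeb α x ∈ F x) {u v : TangentSpace (𝓡 (2 * n + 1)) x} (hu : u ∈ F x)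
    (hv : v ∈ F x) : extDer α x u v = 0 := by
  have h1 : ∀ u ∈ horizontalPart α F x, ∀ v ∈ F x, extDer α x u v = 0 := fun u hu ↦
    ((h x).extDer_eq_zero_iff (hZ x)).1 (hF.isotropic x u hu)
  rw [extDer_swap, ((h x).extDer_eq_zero_iff (hZ x)).1 (fun w hw ↦ ?_) u hu, neg_zero]
  rw [extDer_swap, h1 w hw v hv, neg_zero]

theorem pseudoOrth_horizontalPart (h : ∀ x, IsContactAt α x) (hZ : ∀ x, reeb α x ∈ F x) :
    pseudoOrth α (horizontalPart α F) = pseudoOrth α F := by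
  funext x
  ext v
  rw [(h x).mem_pseudoOrth_horizontalPart (hZ x), (h x).mem_pseudoOrth_of_reeb_mem (hZ x)]

theorem IsPreIsotropic.satisfiesFlag (hF : IsPreIsotropic α F) (h : ∀ x, IsContactAt α x)
    (hZ : ∀ x, reeb α x ∈ F x) : SatisfiesFlag α F where
  horizontalPart_le _ := inf_le_left
  le_pseudoOrth x _ hu := ((h x).mem_pseudoOrth_horizontalPart (hZ x)).2 fun _ hv ↦
    hF.extDer_eq_zero h hZ hu hv
  pseudoOrth_eq := pseudoOrth_horizontalPart h hZ

theorem SatisfiesFlag.isPreIsotropic (hF : SatisfiesFlag α F) (h : ∀ x, IsContactAt α x)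
    (hZ : ∀ x, reeb α x ∈ F x) : IsPreIsotropic α F where
  transversal x := by
    refine eq_top_iff.2 fun v _ ↦ Submodule.mem_sup.2 ⟨α x v • reeb α x,
      Submodule.smul_mem _ _ (hZ x), v - α x v • reeb α x, ?_, by abel⟩
    rw [IsContactAt.mem_horizontal]
    simp [(h x).apply_reeb]
  isotropic x u hu v hv :=
    ((h x).mem_pseudoOrth_horizontalPart (hZ x)).1 (hF.le_pseudoOrth x hu.1) v hv.1

end Flag

end PointwiseContact

end ContactFoliation

end

noncomputable section

namespace ContactFoliation

/-! ### Forms, fields and brackets read in a chart. -/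

section Charts

set_option linter.unusedSectionVars false

variable {n : ℕ} {M : Type u} [TopologicalSpace M]
  [ChartedSpace (EuclideanSpace ℝ (Fin (2 * n + 1))) M]

/-- The inverse of the preferred chart at `x`. -/
abbrev chartInv (n : ℕ) {M : Type u} [TopologicalSpace M]
    [ChartedSpace (EuclideanSpace ℝ (Fin (2 * n + 1))) M] (x : M) :
    EuclideanSpace ℝ (Fin (2 * n + 1)) → M :=
  (extChartAt (𝓡 (2 * n + 1)) x).symm

/-- The target of the preferred chart at `x`. -/
abbrev chartTarget (n : ℕ) {M : Type u} [TopologicalSpace M]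
    [ChartedSpace (EuclideanSpace ℝ (Fin (2 * n + 1))) M] (x : M) :
    Set (EuclideanSpace ℝ (Fin (2 * n + 1))) :=
  (extChartAt (𝓡 (2 * n + 1)) x).target

/-- The derivative of the inverse of the preferred chart at `x`. -/
def chartFrame (n : ℕ) {M : Type u} [TopologicalSpace M]
    [ChartedSpace (EuclideanSpace ℝ (Fin (2 * n + 1))) M] (x : M)
    (e : EuclideanSpace ℝ (Fin (2 * n + 1))) :
    EuclideanSpace ℝ (Fin (2 * n + 1)) →L[ℝ] TangentSpace (𝓡 (2 * n + 1)) (chartInv n x e) :=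
  mfderiv 𝓘(ℝ, EuclideanSpace ℝ (Fin (2 * n + 1))) (𝓡 (2 * n + 1))
    (extChartAt (𝓡 (2 * n + 1)) x).symm e

variable (α : OneForm n M) (x : M)

theorem inChart_apply (e v : EuclideanSpace ℝ (Fin (2 * n + 1))) :
    inChart α x e v = α (chartInv n x e) (chartFrame n x e v) := rfl

theorem isOpen_chartTarget : IsOpen (chartTarget n x) := isOpen_extChartAt_target x

variable [IsManifold (𝓡 (2 * n + 1)) ∞ M]

instance : IsManifold (𝓡 (2 * n + 1)) 1 M := IsManifold.of_le (n := ∞) (by norm_cast)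

variable {x} {e : EuclideanSpace ℝ (Fin (2 * n + 1))}

theorem contMDiffAt_chartInv (he : e ∈ chartTarget n x) :
    ContMDiffAt 𝓘(ℝ, EuclideanSpace ℝ (Fin (2 * n + 1))) (𝓡 (2 * n + 1)) ∞ (chartInv n x) e :=
  (contMDiffOn_extChartAt_symm x).contMDiffAt ((isOpen_chartTarget x).mem_nhds he)

theorem mdifferentiableAt_chartInv (he : e ∈ chartTarget n x) :
    MDifferentiableAt 𝓘(ℝ, EuclideanSpace ℝ (Fin (2 * n + 1))) (𝓡 (2 * n + 1)) (chartInv n x) e :=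
  (contMDiffAt_chartInv he).mdifferentiableAt (by simp)

theorem isInvertible_chartFrame (he : e ∈ chartTarget n x) : (chartFrame n x e).IsInvertible := by
  have := isInvertible_mfderivWithin_extChartAt_symm (I := 𝓡 (2 * n + 1)) he
  rwa [ModelWithCorners.range_eq_univ, mfderivWithin_univ] at this

theorem chartFrame_apply_inverse (he : e ∈ chartTarget n x)
    (v : TangentSpace (𝓡 (2 * n + 1)) (chartInv n x e)) :
    chartFrame n x e ((chartFrame n x e).inverse v) = v := by
  obtain ⟨A, hA⟩ := isInvertible_chartFrame he
  rw [← hA]; simp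

theorem chartFrame_bijective (he : e ∈ chartTarget n x) :
    Function.Bijective (chartFrame n x e) := by
  obtain ⟨A, hA⟩ := isInvertible_chartFrame he
  rw [← hA]; exact A.bijective

section Maps

variable {Q : Type*} [NormedAddCommGroup Q] [NormedSpace ℝ Q]

/-- The derivative of a map, read in the chart. -/
theorem mfderiv_chartFrame {f : M → Q} (he : e ∈ chartTarget n x)
    (hf : MDifferentiableAt (𝓡 (2 * n + 1)) 𝓘(ℝ, Q) f (chartInv n x e))
    (v : EuclideanSpace ℝ (Fin (2 * n + 1))) :
    mfderiv (𝓡 (2 * n + 1)) 𝓘(ℝ, Q) f (chartInv n x e) (chartFrame n x e v) =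
      fderiv ℝ (f ∘ chartInv n x) e v := by
  rw [← mfderiv_eq_fderiv, mfderiv_comp e hf (mdifferentiableAt_chartInv he)]
  rfl

theorem contDiffOn_comp_chartInv {f : M → Q} {U : Set M}
    (hf : ContMDiffOn (𝓡 (2 * n + 1)) 𝓘(ℝ, Q) ∞ f U) :
    ContDiffOn ℝ ∞ (f ∘ chartInv n x) (chartTarget n x ∩ chartInv n x ⁻¹' U) := by
  rw [← contMDiffOn_iff_contDiffOn]
  exact hf.comp ((contMDiffOn_extChartAt_symm x).mono inter_subset_left) inter_subset_right

theorem isOpen_chart_preimage {U : Set M} (hU : IsOpen U) :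
    IsOpen (chartTarget n x ∩ chartInv n x ⁻¹' U) :=
  (continuousOn_extChartAt_symm x).isOpen_inter_preimage (isOpen_chartTarget x) hU

theorem contMDiffAt_of_comp_chartInv {f : M → Q} (he : e ∈ chartTarget n x)
    (hf : ContDiffAt ℝ ∞ (f ∘ chartInv n x) e) :
    ContMDiffAt (𝓡 (2 * n + 1)) 𝓘(ℝ, Q) ∞ f (chartInv n x e) := by
  have hs : chartInv n x e ∈ (extChartAt (𝓡 (2 * n + 1)) x).source :=
    (extChartAt (𝓡 (2 * n + 1)) x).map_target he
  have h1 : ContMDiffAt (𝓡 (2 * n + 1)) 𝓘(ℝ, EuclideanSpace ℝ (Fin (2 * n + 1))) ∞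
      (extChartAt (𝓡 (2 * n + 1)) x) (chartInv n x e) :=
    contMDiffAt_extChartAt' (by rwa [extChartAt_source] at hs)
  have h2 : ContMDiffAt 𝓘(ℝ, EuclideanSpace ℝ (Fin (2 * n + 1))) 𝓘(ℝ, Q) ∞
      (f ∘ chartInv n x) (extChartAt (𝓡 (2 * n + 1)) x (chartInv n x e)) := by
    rw [(extChartAt (𝓡 (2 * n + 1)) x).right_inv he]
    exact hf.contMDiffAt
  refine (h2.comp _ h1).congr_of_eventuallyEq ?_
  filter_upwards [(isOpen_extChartAt_source (I := 𝓡 (2 * n + 1)) x).mem_nhds hs] with y hy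
  simp only [Function.comp, chartInv]
  rw [(extChartAt (𝓡 (2 * n + 1)) x).left_inv hy]

end Maps

variable {α}

/-- For a constant vector, its image under the tangent map of the inverse chart is a smooth section
along that map; pairing it with the bundle section `α` is smooth. -/
theorem contDiffOn_inChart (hα : IsContactForm α) (x : M) :
    ContDiffOn ℝ ∞ (inChart α x) (chartTarget n x) := by
  rw [contDiffOn_clm_apply]
  intro v
  have h1 : ContMDiffOn (𝓘(ℝ, EuclideanSpace ℝ (Fin (2 * n + 1)))).tangent
      (𝓡 (2 * n + 1)).tangent ∞ (tangentMapWithin 𝓘(ℝ, EuclideanSpace ℝ (Fin (2 * n + 1)))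
        (𝓡 (2 * n + 1)) (chartInv n x) (chartTarget n x)) _ :=
    (contMDiffOn_extChartAt_symm (n := ∞) x).contMDiffOn_tangentMapWithin
      (by norm_cast) (isOpen_chartTarget x).uniqueMDiffOn
  have h2 : ContMDiff 𝓘(ℝ, EuclideanSpace ℝ (Fin (2 * n + 1)))
      (𝓘(ℝ, EuclideanSpace ℝ (Fin (2 * n + 1)))).tangent ∞
      (fun e ↦ (⟨e, v⟩ : TangentBundle 𝓘(ℝ, EuclideanSpace ℝ (Fin (2 * n + 1)))
        (EuclideanSpace ℝ (Fin (2 * n + 1))))) :=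
    contMDiff_vectorSpace_iff_contDiff.2 contDiff_const
  have h3 := h1.comp (h2.contMDiffOn (s := chartTarget n x)) (fun e he ↦ he)
  have h4 : ContMDiffOn 𝓘(ℝ, EuclideanSpace ℝ (Fin (2 * n + 1))) (𝓡 (2 * n + 1)).tangent ∞
      (fun e ↦ TotalSpace.mk' (EuclideanSpace ℝ (Fin (2 * n + 1)))
        (E := fun y : M ↦ TangentSpace (𝓡 (2 * n + 1)) y) (chartInv n x e) (chartFrame n x e v))
      (chartTarget n x) := by
    refine h3.congr fun e he ↦ ?_
    simp only [Function.comp, tangentMapWithin]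
    rw [mfderivWithin_of_isOpen (isOpen_chartTarget x) he]
    rfl
  have h5 := hα.smooth.comp_contMDiffOn (contMDiffOn_extChartAt_symm (n := ∞) x)
  have h6 := ContMDiffOn.clm_bundle_apply (E₂ := Bundle.Trivial M ℝ) (F₂ := ℝ) h5 h4
  intro e he
  have h7 := (contMDiffWithinAt_totalSpace.1 (h6 e he)).2
  exact h7.contDiffWithinAt

/-- The exterior derivative computed in another chart. -/
theorem extDer_chartFrame (hα : IsContactForm α) (he : e ∈ chartTarget n x)
    (v w : EuclideanSpace ℝ (Fin (2 * n + 1))) :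
    extDer α (chartInv n x e) (chartFrame n x e v) (chartFrame n x e w) =
      dform (inChart α x) e v w := by
  set y := chartInv n x e with hy
  -- `extDer` at `y` is computed in the chart centred at `y`; the transition τ pulls that expression
  -- back to the chart at `x`.
  set τ : EuclideanSpace ℝ (Fin (2 * n + 1)) → EuclideanSpace ℝ (Fin (2 * n + 1)) :=
    extChartAt (𝓡 (2 * n + 1)) y ∘ chartInv n x with hτ
  have hd : ∀ e' ∈ chartTarget n x, chartInv n x e' ∈ (extChartAt (𝓡 (2 * n + 1)) y).source →
      ContDiffAt ℝ ∞ τ e' := by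
    intro e' he' hs
    rw [← contMDiffAt_iff_contDiffAt]
    exact (contMDiffAt_extChartAt' (by rwa [extChartAt_source] at hs)).comp e'
      (contMDiffAt_chartInv he')
  have hO : IsOpen (chartTarget n x ∩
      chartInv n x ⁻¹' (extChartAt (𝓡 (2 * n + 1)) y).source) :=
    isOpen_chart_preimage (isOpen_extChartAt_source y)
  have heO : e ∈ chartTarget n x ∩ chartInv n x ⁻¹' (extChartAt (𝓡 (2 * n + 1)) y).source :=
    ⟨he, mem_extChartAt_source y⟩
  have hsource := (hd e he heO.2)
  have hinv : ∀ e' ∈ chartTarget n x ∩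
      chartInv n x ⁻¹' (extChartAt (𝓡 (2 * n + 1)) y).source,
      chartInv n y (τ e') = chartInv n x e' := fun e' he' ↦
    (extChartAt (𝓡 (2 * n + 1)) y).left_inv he'.2
  have hpull : inChart α x =ᶠ[𝓝 e] fun e' ↦ (inChart α y (τ e')).comp (fderiv ℝ τ e') := by
    filter_upwards [hO.mem_nhds heO] with e' he'
    ext v
    have hτe' : τ e' ∈ chartTarget n y := (extChartAt (𝓡 (2 * n + 1)) y).map_source he'.2
    have h1 : chartInv n x =ᶠ[𝓝 e'] chartInv n y ∘ τ := by
      filter_upwards [hO.mem_nhds he'] with e'' he''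
      exact (hinv e'' he'').symm
    have h2 := h1.mfderiv_eq (I := 𝓘(ℝ, EuclideanSpace ℝ (Fin (2 * n + 1))))
      (I' := 𝓡 (2 * n + 1))
    have h3 := mfderiv_comp e' (mdifferentiableAt_chartInv hτe')
      ((hd e' he'.1 he'.2).differentiableAt (by simp)).mdifferentiableAt
    rw [h3, mfderiv_eq_fderiv] at h2
    -- Transports the covector between the equal base points given by `hinv`; the tangent spaces all
    -- have the model space as underlying type.
    have h4 : ∀ (p q : M) (u : EuclideanSpace ℝ (Fin (2 * n + 1))), p = q →
        α p (show TangentSpace (𝓡 (2 * n + 1)) p from u) =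
          α q (show TangentSpace (𝓡 (2 * n + 1)) q from u) := by
      rintro p q u rfl; rfl
    have h5 := h4 _ _ (chartFrame n y (τ e') (fderiv ℝ τ e' v)) (hinv e' he')
    have h6 := congrArg (fun L ↦ L v) h2
    rw [inChart_apply]
    refine Eq.trans ?_ h5.symm
    congr 1
  have h7 := dform_pullback hsource
    ((((contDiffOn_inChart hα y).contDiffAt ((isOpen_chartTarget y).mem_nhds
      (mem_extChartAt_target y))).differentiableAt (by simp)) :
        DifferentiableAt ℝ (inChart α y) (τ e)) hpull v w
  rw [h7]
  have h8 : ∀ v, mfderiv (𝓡 (2 * n + 1)) 𝓘(ℝ, EuclideanSpace ℝ (Fin (2 * n + 1)))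
      (extChartAt (𝓡 (2 * n + 1)) y) y (chartFrame n x e v) = fderiv ℝ τ e v := fun v ↦
    mfderiv_chartFrame he (mdifferentiableAt_extChartAt (mem_chart_source _ y)) v
  rw [← h8, ← h8]
  rfl

/-- A vector field, read in the preferred chart at `x`. -/
def chartField (x : M) (X : ∀ y : M, TangentSpace (𝓡 (2 * n + 1)) y)
    (e : EuclideanSpace ℝ (Fin (2 * n + 1))) : EuclideanSpace ℝ (Fin (2 * n + 1)) :=
  (chartFrame n x e).inverse (X (chartInv n x e))

theorem chartFrame_chartField (he : e ∈ chartTarget n x)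
    (X : ∀ y : M, TangentSpace (𝓡 (2 * n + 1)) y) :
    chartFrame n x e (chartField x X e) = X (chartInv n x e) :=
  chartFrame_apply_inverse he _

theorem differential_chartInv {f : M → ℝ} {U : Set M} (hU : IsOpen U)
    (hf : ContMDiffOn (𝓡 (2 * n + 1)) 𝓘(ℝ, ℝ) ∞ f U)
    (he : e ∈ chartTarget n x ∩ chartInv n x ⁻¹' U) (v : EuclideanSpace ℝ (Fin (2 * n + 1))) :
    differential f (chartInv n x e) (chartFrame n x e v) = fderiv ℝ (f ∘ chartInv n x) e v :=
  mfderiv_chartFrame he.1 ((hf.contMDiffAt (hU.mem_nhds he.2)).mdifferentiableAt (by simp)) v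

theorem differential_field {f : M → ℝ} {U : Set M} (hU : IsOpen U)
    (hf : ContMDiffOn (𝓡 (2 * n + 1)) 𝓘(ℝ, ℝ) ∞ f U)
    (he : e ∈ chartTarget n x ∩ chartInv n x ⁻¹' U)
    (X : ∀ y : M, TangentSpace (𝓡 (2 * n + 1)) y) :
    differential f (chartInv n x e) (X (chartInv n x e)) =
      fderiv ℝ (f ∘ chartInv n x) e (chartField x X e) := by
  rw [← differential_chartInv hU hf he, chartFrame_chartField he.1]

/-- `da + a ⊗ a`, as a map to the dual. -/
def contactMusical {V : Type*} [NormedAddCommGroup V] [NormedSpace ℝ V] (a : V → V →L[ℝ] ℝ)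
    (e : V) : V →L[ℝ] V →L[ℝ] ℝ :=
  fderiv ℝ a e - (fderiv ℝ a e).flip + (a e).smulRight (a e)

theorem contactMusical_apply {V : Type*} [NormedAddCommGroup V] [NormedSpace ℝ V]
    (a : V → V →L[ℝ] ℝ) (e v w : V) : contactMusical a e v w = dform a e v w + a e v * a e w := rfl

theorem contDiffOn_contactMusical {V : Type*} [NormedAddCommGroup V] [NormedSpace ℝ V]
    [FiniteDimensional ℝ V] {a : V → V →L[ℝ] ℝ} {O : Set V} (hO : IsOpen O)
    (ha : ContDiffOn ℝ ∞ a O) : ContDiffOn ℝ ∞ (contactMusical a) O := by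
  have h1 : ContDiffOn ℝ ∞ (fderiv ℝ a) O := ha.fderiv_of_isOpen hO (by norm_cast)
  have hc : ∀ v : V, ContDiffOn ℝ ∞ (fun _ : V ↦ v) O := fun v ↦ contDiffOn_const
  rw [contDiffOn_clm_apply]
  intro v
  rw [contDiffOn_clm_apply]
  intro w
  exact (((h1.clm_apply (hc v)).clm_apply (hc w)).sub ((h1.clm_apply (hc w)).clm_apply (hc v))).add
    ((ha.clm_apply (hc v)).mul (ha.clm_apply (hc w)))

theorem finrank_continuousDual (V : Type*) [NormedAddCommGroup V] [NormedSpace ℝ V]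
    [FiniteDimensional ℝ V] : Module.finrank ℝ V = Module.finrank ℝ (V →L[ℝ] ℝ) := by
  have h := (LinearMap.toContinuousLinearMap (𝕜 := ℝ) (E := V) (F' := ℝ)).finrank_eq
  rw [← h]
  exact Subspace.dual_finrank_eq.symm

theorem contactMusical_inChart (hα : IsContactForm α) (he : e ∈ chartTarget n x)
    (v w : EuclideanSpace ℝ (Fin (2 * n + 1))) :
    contactMusical (inChart α x) e v w =
      extDer α (chartInv n x e) (chartFrame n x e v) (chartFrame n x e w) +
        α (chartInv n x e) (chartFrame n x e v) * α (chartInv n x e) (chartFrame n x e w) := by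
  rw [contactMusical_apply, extDer_chartFrame hα he]
  rfl

theorem isInvertible_contactMusical (hα : IsContactForm α) (he : e ∈ chartTarget n x) :
    (contactMusical (inChart α x) e).IsInvertible := by
  have h := hα.isContactAt (chartInv n x e)
  refine isInvertible_of_injective _ ((injective_iff_map_eq_zero _).2 fun v hv ↦ ?_) ?_
  · obtain ⟨_, hsurj⟩ := chartFrame_bijective he
    have h1 : ∀ w, extDer α (chartInv n x e) (chartFrame n x e v) w +
        α (chartInv n x e) (chartFrame n x e v) * α (chartInv n x e) w = 0 := by
      intro w
      obtain ⟨w, rfl⟩ := hsurj w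
      rw [← contactMusical_inChart hα he, hv]; rfl
    have h2 : α (chartInv n x e) (chartFrame n x e v) = 0 := by
      have := h1 (reeb α _)
      rwa [h.extDer_reeb_right, h.apply_reeb, zero_add, mul_one] at this
    have h3 := h.eq_zero h2 fun w ↦ by simpa [h2] using h1 w
    exact (chartFrame_bijective he).1 (h3.trans (map_zero _).symm)
  · exact finrank_continuousDual _

/-- The source of smoothness: Reeb and contact vectors are chosen point by point, but here they
become the inverse of a smooth family of operators applied to an explicit covector. -/
theorem chartField_eq_inverse (hα : IsContactForm α) (he : e ∈ chartTarget n x)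
    {X : ∀ y : M, TangentSpace (𝓡 (2 * n + 1)) y}
    {η : EuclideanSpace ℝ (Fin (2 * n + 1)) →L[ℝ] ℝ}
    (hη : contactMusical (inChart α x) e (chartField x X e) = η) :
    chartField x X e = (contactMusical (inChart α x) e).inverse η := by
  obtain ⟨A, hA⟩ := isInvertible_contactMusical hα he
  rw [← hη, ← hA]
  simp

theorem contDiffOn_chartField_reeb (hα : IsContactForm α) (x : M) :
    ContDiffOn ℝ ∞ (chartField x (reeb α)) (chartTarget n x) := by
  have h1 := contDiffOn_inverse
    (contDiffOn_contactMusical (isOpen_chartTarget x) (contDiffOn_inChart hα x))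
    fun e he ↦ isInvertible_contactMusical hα he
  refine (h1.clm_apply (contDiffOn_inChart hα x)).congr fun e he ↦ ?_
  refine chartField_eq_inverse hα he ?_
  ext w
  have h := hα.isContactAt (chartInv n x e)
  rw [contactMusical_inChart hα he, chartFrame_chartField he, h.extDer_reeb_left, h.apply_reeb,
    zero_add, one_mul]
  rfl

/-- In a chart, contact fields are Hamiltonian. -/
theorem isHamiltonianOn_chartField (hα : IsContactForm α) (x : M) {f : M → ℝ} {U : Set M}
    (hU : IsOpen U) (hf : ContMDiffOn (𝓡 (2 * n + 1)) 𝓘(ℝ, ℝ) ∞ f U) :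
    IsHamiltonianOn (inChart α x) (chartTarget n x ∩ chartInv n x ⁻¹' U)
      (chartField x (contactField α f)) (f ∘ chartInv n x)
      fun e ↦ fderiv ℝ (f ∘ chartInv n x) e (chartField x (reeb α) e) := by
  set O := chartTarget n x ∩ chartInv n x ⁻¹' U with hO_def
  have hO : IsOpen O := isOpen_chart_preimage hU
  have hfO : ContDiffOn ℝ ∞ (f ∘ chartInv n x) O := contDiffOn_comp_chartInv hf
  have hfd : ContDiffOn ℝ ∞ (fderiv ℝ (f ∘ chartInv n x)) O :=
    hfO.fderiv_of_isOpen hO (by norm_cast)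
  have haO := (contDiffOn_inChart hα x).mono (inter_subset_left : O ⊆ _)
  have hm : ContDiffOn ℝ ∞ (fun e ↦ fderiv ℝ (f ∘ chartInv n x) e (chartField x (reeb α) e)) O :=
    hfd.clm_apply ((contDiffOn_chartField_reeb hα x).mono inter_subset_left)
  have happly : ∀ e ∈ O, inChart α x e (chartField x (contactField α f) e) =
      (f ∘ chartInv n x) e := by
    intro e he
    rw [inChart_apply, chartFrame_chartField he.1, (hα.isContactAt _).apply_contactField]
    rfl
  have hdform : ∀ e ∈ O, ∀ w, dform (inChart α x) e (chartField x (contactField α f) e) w =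
      -fderiv ℝ (f ∘ chartInv n x) e w +
        fderiv ℝ (f ∘ chartInv n x) e (chartField x (reeb α) e) * inChart α x e w := by
    intro e he w
    rw [← extDer_chartFrame hα he.1, chartFrame_chartField he.1,
      (hα.isContactAt _).extDer_contactField, differential_chartInv hU hf he,
      differential_field hU hf he]
    rfl
  refine ⟨?_, hfO, hm, happly, hdform⟩
  have h1 := (contDiffOn_inverse
    (contDiffOn_contactMusical (isOpen_chartTarget x) (contDiffOn_inChart hα x))
    fun e he ↦ isInvertible_contactMusical hα he).mono (inter_subset_left : O ⊆ _)
  -- The covector is -df + (Zf + f)α: the contraction with `dα` plus the term f α from α ⊗ α.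
  refine (h1.clm_apply (hfd.neg.add ((hm.add hfO).smul haO))).congr fun e he ↦ ?_
  refine chartField_eq_inverse hα he.1 ?_
  ext w
  rw [contactMusical_apply, hdform e he, happly e he]
  simp
  ring

/-- The Jacobi bracket, read in a chart around the point. -/
theorem jacobiBracket_eq_lieBracket (f g : M → ℝ) (y : M) :
    jacobiBracket α f g y = inChart α y (extChartAt (𝓡 (2 * n + 1)) y y)
      (VectorField.lieBracket ℝ (chartField y (contactField α f))
        (chartField y (contactField α g)) (extChartAt (𝓡 (2 * n + 1)) y y)) := by
  have h0 : ∀ X : (∀ y : M, TangentSpace (𝓡 (2 * n + 1)) y),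
      VectorField.mpullbackWithin 𝓘(ℝ, EuclideanSpace ℝ (Fin (2 * n + 1))) (𝓡 (2 * n + 1))
        (extChartAt (𝓡 (2 * n + 1)) y).symm X (range (𝓡 (2 * n + 1))) = chartField y X := by
    intro X
    rw [ModelWithCorners.range_eq_univ, VectorField.mpullbackWithin_univ]
    rfl
  have h1 : ∀ p : M, p = y → ∀ (u : TangentSpace (𝓡 (2 * n + 1)) y),
      α y u = α p (show TangentSpace (𝓡 (2 * n + 1)) p from u) := by
    rintro p rfl u; rfl
  rw [jacobiBracket, ← VectorField.mlieBracketWithin_univ, VectorField.mlieBracketWithin_apply,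
    h0, h0, ModelWithCorners.range_eq_univ, preimage_univ, univ_inter,
    VectorField.lieBracketWithin_univ, h1 _ (extChartAt_to_inv (I := 𝓡 (2 * n + 1)) y),
    inChart_apply]
  congr 1
  set u := VectorField.lieBracket ℝ (chartField y (contactField α f))
        (chartField y (contactField α g)) (extChartAt (𝓡 (2 * n + 1)) y y)
  -- The manifold bracket applies the inverse of the derivative of the chart, which is the
  -- derivative of the inverse chart.
  have h2 := mfderiv_extChartAt_comp_mfderivWithin_extChartAt_symm' (I := 𝓡 (2 * n + 1))
    (mem_extChartAt_source (I := 𝓡 (2 * n + 1)) y)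
  rw [ModelWithCorners.range_eq_univ, mfderivWithin_univ] at h2
  obtain ⟨A, hA⟩ := isInvertible_mfderiv_extChartAt (I := 𝓡 (2 * n + 1))
    (mem_extChartAt_source (I := 𝓡 (2 * n + 1)) y)
  have h3 : mfderiv (𝓡 (2 * n + 1)) 𝓘(ℝ, EuclideanSpace ℝ (Fin (2 * n + 1)))
      (extChartAt (𝓡 (2 * n + 1)) y) y (chartFrame n y (extChartAt (𝓡 (2 * n + 1)) y y) u) = u :=
    congrArg (fun L ↦ L u) h2
  rw [← hA] at h3 ⊢
  rw [ContinuousLinearMap.inverse_equiv]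
  exact (A.symm_apply_eq).2 h3.symm

/-- The working formula [f, g] = X_f g - (Zf) g; when Z kills `f`, the bracket is just the
derivative of `g` along X_f. -/
theorem jacobiBracket_eq (hα : IsContactForm α) {f g : M → ℝ} {U : Set M}
    (hU : IsOpen U) (hf : ContMDiffOn (𝓡 (2 * n + 1)) 𝓘(ℝ, ℝ) ∞ f U)
    (hg : ContMDiffOn (𝓡 (2 * n + 1)) 𝓘(ℝ, ℝ) ∞ g U) {y : M} (hy : y ∈ U) :
    jacobiBracket α f g y = differential g y (contactField α f y) -
      differential f y (reeb α y) * g y := by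
  have he : extChartAt (𝓡 (2 * n + 1)) y y ∈ chartTarget n y ∩ chartInv n y ⁻¹' U :=
    ⟨mem_extChartAt_target y, by rwa [mem_preimage, chartInv, extChartAt_to_inv]⟩
  have hX := isHamiltonianOn_chartField hα y hU hf
  have hY := isHamiltonianOn_chartField hα y hU hg
  rw [jacobiBracket_eq_lieBracket, hX.apply_lieBracket hY (isOpen_chart_preimage hU)
    ((contDiffOn_inChart hα y).mono inter_subset_left) he, ← differential_field hU hg he,
    ← differential_field hU hf he]
  have : chartInv n y (extChartAt (𝓡 (2 * n + 1)) y y) = y := extChartAt_to_inv y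
  rw [this, Function.comp_apply, this]

end Charts

end ContactFoliation

end

noncomputable section

namespace ContactFoliation

open VectorField

/-! ### Passing from charts back to the manifold. -/

section Transfer

theorem inverse_apply_of_apply_eq {E F : Type*} [TopologicalSpace E] [AddCommGroup E] [Module ℝ E]
    [TopologicalSpace F] [AddCommGroup F] [Module ℝ F] {L : E →L[ℝ] F} (hL : L.IsInvertible)
    {u : E} {v : F} (h : L u = v) : L.inverse v = u := by
  obtain ⟨A, rfl⟩ := hL
  rw [ContinuousLinearMap.inverse_equiv]
  exact A.symm_apply_eq.2 h.symm

set_option linter.unusedSectionVars false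

variable {n : ℕ} {M : Type u} [TopologicalSpace M]
  [ChartedSpace (EuclideanSpace ℝ (Fin (2 * n + 1))) M] [IsManifold (𝓡 (2 * n + 1)) ∞ M]
  {α : OneForm n M} {x : M} {e : EuclideanSpace ℝ (Fin (2 * n + 1))} {D : PlaneField n M} {q : ℕ}

/-- The part of the domain of the preferred chart lying over a set of the chart. -/
def chartDomain (n : ℕ) {M : Type u} [TopologicalSpace M]
    [ChartedSpace (EuclideanSpace ℝ (Fin (2 * n + 1))) M] (x : M)
    (O : Set (EuclideanSpace ℝ (Fin (2 * n + 1)))) : Set M :=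
  (extChartAt (𝓡 (2 * n + 1)) x).source ∩ extChartAt (𝓡 (2 * n + 1)) x ⁻¹' O

theorem isOpen_chartDomain {O : Set (EuclideanSpace ℝ (Fin (2 * n + 1)))} (hO : IsOpen O) :
    IsOpen (chartDomain n x O) :=
  isOpen_extChartAt_preimage' x hO

theorem mem_chartDomain_self {O : Set (EuclideanSpace ℝ (Fin (2 * n + 1)))}
    (hx : extChartAt (𝓡 (2 * n + 1)) x x ∈ O) : x ∈ chartDomain n x O :=
  ⟨mem_extChartAt_source x, hx⟩

theorem exists_of_mem_chartDomain {O : Set (EuclideanSpace ℝ (Fin (2 * n + 1)))} {y : M}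
    (hy : y ∈ chartDomain n x O) : ∃ e ∈ O, e ∈ chartTarget n x ∧ chartInv n x e = y :=
  ⟨_, hy.2, (extChartAt (𝓡 (2 * n + 1)) x).map_source hy.1,
    (extChartAt (𝓡 (2 * n + 1)) x).left_inv hy.1⟩

theorem self_mem_chart_preimage {U : Set M} (hx : x ∈ U) :
    extChartAt (𝓡 (2 * n + 1)) x x ∈ chartTarget n x ∩ chartInv n x ⁻¹' U :=
  ⟨mem_extChartAt_target x, by rwa [mem_preimage, chartInv, extChartAt_to_inv]⟩

section Lift

variable {Q : Type*} [NormedAddCommGroup Q] [NormedSpace ℝ Q]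

theorem lift_comp_chartInv_eventuallyEq (f : EuclideanSpace ℝ (Fin (2 * n + 1)) → Q)
    (he : e ∈ chartTarget n x) :
    (f ∘ extChartAt (𝓡 (2 * n + 1)) x) ∘ chartInv n x =ᶠ[𝓝 e] f := by
  filter_upwards [(isOpen_chartTarget x).mem_nhds he] with e' he'
  simp only [Function.comp]
  rw [(extChartAt (𝓡 (2 * n + 1)) x).right_inv he']

theorem contMDiffAt_lift {f : EuclideanSpace ℝ (Fin (2 * n + 1)) → Q}
    (he : e ∈ chartTarget n x) (hf : ContDiffAt ℝ ∞ f e) :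
    ContMDiffAt (𝓡 (2 * n + 1)) 𝓘(ℝ, Q) ∞ (f ∘ extChartAt (𝓡 (2 * n + 1)) x)
      (chartInv n x e) :=
  contMDiffAt_of_comp_chartInv he (hf.congr_of_eventuallyEq (lift_comp_chartInv_eventuallyEq f he))

theorem mfderiv_lift {f : EuclideanSpace ℝ (Fin (2 * n + 1)) → Q}
    (he : e ∈ chartTarget n x) (hf : ContDiffAt ℝ ∞ f e)
    (v : EuclideanSpace ℝ (Fin (2 * n + 1))) :
    mfderiv (𝓡 (2 * n + 1)) 𝓘(ℝ, Q) (f ∘ extChartAt (𝓡 (2 * n + 1)) x) (chartInv n x e)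
      (chartFrame n x e v) = fderiv ℝ f e v := by
  rw [mfderiv_chartFrame he ((contMDiffAt_lift he hf).mdifferentiableAt (by simp)),
    (lift_comp_chartInv_eventuallyEq f he).fderiv_eq]

theorem contMDiffOn_lift {f : EuclideanSpace ℝ (Fin (2 * n + 1)) → Q}
    {O : Set (EuclideanSpace ℝ (Fin (2 * n + 1)))} (hO : IsOpen O) (hf : ContDiffOn ℝ ∞ f O) :
    ContMDiffOn (𝓡 (2 * n + 1)) 𝓘(ℝ, Q) ∞ (f ∘ extChartAt (𝓡 (2 * n + 1)) x)
      (chartDomain n x O) := by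
  intro y hy
  obtain ⟨e, he, het, rfl⟩ := exists_of_mem_chartDomain hy
  exact (contMDiffAt_lift het (hf.contDiffAt (hO.mem_nhds he))).contMDiffWithinAt

end Lift

/-- Reduces integrability to the model space, where Frobenius' theorem and the Poincaré lemma live:
a submersion there is composed with the chart. -/
theorem isFoliation_of_chart
    (h : ∀ x : M, ∃ (O : Set (EuclideanSpace ℝ (Fin (2 * n + 1))))
      (f : EuclideanSpace ℝ (Fin (2 * n + 1)) → EuclideanSpace ℝ (Fin q)), IsOpen O ∧
      extChartAt (𝓡 (2 * n + 1)) x x ∈ O ∧ ContDiffOn ℝ ∞ f O ∧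
      ∀ e ∈ O, e ∈ chartTarget n x → Function.Surjective (fderiv ℝ f e) ∧
        ∀ v, chartFrame n x e v ∈ D (chartInv n x e) ↔ fderiv ℝ f e v = 0) :
    IsFoliation D q := by
  intro x
  obtain ⟨O, f, hO, hx, hf, hfO⟩ := h x
  refine ⟨chartDomain n x O, isOpen_chartDomain hO, mem_chartDomain_self hx,
    f ∘ extChartAt (𝓡 (2 * n + 1)) x, contMDiffOn_lift hO hf, fun y hy ↦ ?_⟩
  obtain ⟨e, he, het, rfl⟩ := exists_of_mem_chartDomain hy
  obtain ⟨hs, hk⟩ := hfO e he het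
  have hd := mfderiv_lift het (hf.contDiffAt (hO.mem_nhds he))
  refine ⟨fun u ↦ ?_, ?_⟩
  · obtain ⟨v, hv⟩ := hs u
    exact ⟨chartFrame n x e v, (hd v).trans hv⟩
  · ext v
    obtain ⟨v, rfl⟩ := (chartFrame_bijective het).2 v
    rw [hk, ← hd]
    rfl

theorem isDistribution_of_chart {k : ℕ}
    (h : ∀ x : M, ∃ (O : Set (EuclideanSpace ℝ (Fin (2 * n + 1))))
      (X : Fin k → EuclideanSpace ℝ (Fin (2 * n + 1)) → EuclideanSpace ℝ (Fin (2 * n + 1))),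
      IsOpen O ∧ extChartAt (𝓡 (2 * n + 1)) x x ∈ O ∧ (∀ i, ContDiffOn ℝ ∞ (X i) O) ∧
      ∀ e ∈ O, e ∈ chartTarget n x → LinearIndependent ℝ (fun i ↦ X i e) ∧
        ∀ v, chartFrame n x e v ∈ D (chartInv n x e) ↔
          v ∈ Submodule.span ℝ (range fun i ↦ X i e)) :
    IsDistribution D k := by
  intro x
  obtain ⟨O, X, hO, hx, hX, hXO⟩ := h x
  let Y : Fin k → ∀ y : M, TangentSpace (𝓡 (2 * n + 1)) y := fun i ↦
    mpullback (𝓡 (2 * n + 1)) 𝓘(ℝ, EuclideanSpace ℝ (Fin (2 * n + 1)))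
      (extChartAt (𝓡 (2 * n + 1)) x) (X i)
  have hY : ∀ i, ∀ e ∈ chartTarget n x, Y i (chartInv n x e) = chartFrame n x e (X i e) := by
    intro i e he
    have hs := (extChartAt (𝓡 (2 * n + 1)) x).map_target he
    have h2 : mfderiv (𝓡 (2 * n + 1)) 𝓘(ℝ, EuclideanSpace ℝ (Fin (2 * n + 1)))
        (extChartAt (𝓡 (2 * n + 1)) x) (chartInv n x e) (chartFrame n x e (X i e)) = X i e := by
      have h3 := mfderiv_lift (f := id) he contDiffAt_id (X i e)
      rw [fderiv_id] at h3
      exact h3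
    show (mfderiv (𝓡 (2 * n + 1)) 𝓘(ℝ, EuclideanSpace ℝ (Fin (2 * n + 1)))
      (extChartAt (𝓡 (2 * n + 1)) x) (chartInv n x e)).inverse
        (X i (extChartAt (𝓡 (2 * n + 1)) x (chartInv n x e))) = _
    rw [(extChartAt (𝓡 (2 * n + 1)) x).right_inv he]
    exact inverse_apply_of_apply_eq (isInvertible_mfderiv_extChartAt (I := 𝓡 (2 * n + 1)) hs) h2
  refine ⟨chartDomain n x O, isOpen_chartDomain hO, mem_chartDomain_self hx, Y, fun i y hy ↦ ?_,
    fun y hy ↦ ?_⟩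
  · have h1 : ContMDiffAt 𝓘(ℝ, EuclideanSpace ℝ (Fin (2 * n + 1)))
        (𝓘(ℝ, EuclideanSpace ℝ (Fin (2 * n + 1)))).tangent ∞
        (fun e ↦ (⟨e, X i e⟩ : TangentBundle 𝓘(ℝ, EuclideanSpace ℝ (Fin (2 * n + 1)))
          (EuclideanSpace ℝ (Fin (2 * n + 1))))) (extChartAt (𝓡 (2 * n + 1)) x y) :=
      (contMDiffOn_vectorSpace_iff_contDiffOn.2 (hX i)).contMDiffAt (hO.mem_nhds hy.2)
    exact (ContMDiffAt.mpullback_vectorField_preimage h1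
      (contMDiffAt_extChartAt' (by have := hy.1; rwa [extChartAt_source] at this))
      (isInvertible_mfderiv_extChartAt hy.1) (by norm_cast)).contMDiffWithinAt
  · obtain ⟨e, he, het, rfl⟩ := exists_of_mem_chartDomain hy
    obtain ⟨hli, hsp⟩ := hXO e he het
    have h1 : (fun i ↦ Y i (chartInv n x e)) =
        (chartFrame n x e).toLinearMap ∘ fun i ↦ X i e := by
      funext i
      exact hY i e het
    rw [h1]
    refine ⟨hli.map' _ (LinearMap.ker_eq_bot.2 (chartFrame_bijective het).1), ?_⟩
    rw [range_comp, ← Submodule.map_span]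
    ext v
    obtain ⟨v, rfl⟩ := (chartFrame_bijective het).2 v
    rw [hsp]
    constructor
    · exact fun hv ↦ ⟨v, hv, rfl⟩
    · rintro ⟨w, hw, hwv⟩
      rwa [← (chartFrame_bijective het).1 hwv]

theorem mdifferentiableAt_of_contMDiffOn {Q : Type*} [NormedAddCommGroup Q] [NormedSpace ℝ Q]
    {f : M → Q} {U : Set M} (hU : IsOpen U) (hf : ContMDiffOn (𝓡 (2 * n + 1)) 𝓘(ℝ, Q) ∞ f U)
    {y : M} (hy : y ∈ U) : MDifferentiableAt (𝓡 (2 * n + 1)) 𝓘(ℝ, Q) f y :=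
  (hf.contMDiffAt (hU.mem_nhds hy)).mdifferentiableAt (by simp)

section Components

variable {f : M → EuclideanSpace ℝ (Fin q)} {U : Set M}

theorem contMDiffOn_component (hf : ContMDiffOn (𝓡 (2 * n + 1)) (𝓡 q) ∞ f U) (i : Fin q) :
    ContMDiffOn (𝓡 (2 * n + 1)) 𝓘(ℝ, ℝ) ∞ (fun y ↦ f y i) U :=
  (EuclideanSpace.proj (𝕜 := ℝ) i).contDiff.contMDiff.comp_contMDiffOn hf

theorem differential_component (hU : IsOpen U)
    (hf : ContMDiffOn (𝓡 (2 * n + 1)) (𝓡 q) ∞ f U) {y : M} (hy : y ∈ U) (i : Fin q)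
    (v : TangentSpace (𝓡 (2 * n + 1)) y) :
    differential (fun y ↦ f y i) y v =
      EuclideanSpace.proj (𝕜 := ℝ) i (mfderiv (𝓡 (2 * n + 1)) (𝓡 q) f y v) := by
  have h1 := mfderiv_comp y (I'' := 𝓘(ℝ, ℝ))
    ((EuclideanSpace.proj (𝕜 := ℝ) i).differentiableAt (x := f y)).mdifferentiableAt
    (mdifferentiableAt_of_contMDiffOn hU hf hy)
  rw [mfderiv_eq_fderiv, (EuclideanSpace.proj (𝕜 := ℝ) i).fderiv] at h1
  exact congrArg (fun L ↦ L v) h1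

/-- The components of a submersion defining a foliation are first integrals. -/
theorem isFirstIntegralOn_component (hU : IsOpen U)
    (hf : ContMDiffOn (𝓡 (2 * n + 1)) (𝓡 q) ∞ f U)
    (hD : ∀ y ∈ U, D y = LinearMap.ker (mfderiv (𝓡 (2 * n + 1)) (𝓡 q) f y).toLinearMap)
    (i : Fin q) : IsFirstIntegralOn D U fun y ↦ f y i := by
  refine ⟨contMDiffOn_component hf i, fun y hy v hv ↦ ?_⟩
  rw [hD y hy] at hv
  rw [differential_component hU hf hy]
  have : mfderiv (𝓡 (2 * n + 1)) (𝓡 q) f y v = (0 : EuclideanSpace ℝ (Fin q)) := hv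
  rw [this, map_zero]

end Components

theorem isFirstIntegralOn_const (c : ℝ) (U : Set M) : IsFirstIntegralOn D U fun _ ↦ c :=
  ⟨contMDiffOn_const, fun x _ v _ ↦ by
    have : differential (n := n) (fun _ : M ↦ c) x = 0 := mfderiv_const
    rw [this]; rfl⟩

theorem isFirstIntegralOn_cons {f : Fin q → M → ℝ} {U : Set M}
    (hf : ∀ i, IsFirstIntegralOn D U (f i)) (i : Fin (q + 1)) :
    IsFirstIntegralOn D U ((Fin.cons (fun _ ↦ 1) f : Fin (q + 1) → M → ℝ) i) := by
  refine Fin.cases ?_ (fun j ↦ ?_) i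
  · exact isFirstIntegralOn_const 1 U
  · exact hf j

theorem IsFirstIntegralOn.anti {D' : PlaneField n M} {f : M → ℝ} {U : Set M}
    (hf : IsFirstIntegralOn D U f) (h : ∀ x, D' x ≤ D x) : IsFirstIntegralOn D' U f :=
  ⟨hf.1, fun x hx v hv ↦ hf.2 x hx v (h x hv)⟩

end Transfer

/-! ### The Jacobi bracket and the Lie bracket of contact fields. -/

section Jacobi

set_option linter.unusedSectionVars false

variable {n : ℕ} {M : Type u} [TopologicalSpace M]
  [ChartedSpace (EuclideanSpace ℝ (Fin (2 * n + 1))) M] [IsManifold (𝓡 (2 * n + 1)) ∞ M]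
  {α : OneForm n M} {x : M} {e : EuclideanSpace ℝ (Fin (2 * n + 1))} {D : PlaneField n M}
  {f g : M → ℝ} {U : Set M}

/-- At each point the bracket was computed in the chart centred there; one fixed chart is needed in
order to differentiate it. -/
theorem jacobiBracket_chartInv (hα : IsContactForm α) (hU : IsOpen U)
    (hf : ContMDiffOn (𝓡 (2 * n + 1)) 𝓘(ℝ, ℝ) ∞ f U)
    (hg : ContMDiffOn (𝓡 (2 * n + 1)) 𝓘(ℝ, ℝ) ∞ g U)
    (he : e ∈ chartTarget n x ∩ chartInv n x ⁻¹' U) :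
    jacobiBracket α f g (chartInv n x e) = inChart α x e
      (lieBracket ℝ (chartField x (contactField α f)) (chartField x (contactField α g)) e) := by
  have hX := isHamiltonianOn_chartField hα x hU hf
  have hY := isHamiltonianOn_chartField hα x hU hg
  rw [jacobiBracket_eq hα hU hf hg he.2, hX.apply_lieBracket hY (isOpen_chart_preimage hU)
    ((contDiffOn_inChart hα x).mono inter_subset_left) he, ← differential_field hU hg he,
    ← differential_field hU hf he]
  rfl

theorem contMDiffOn_jacobiBracket (hα : IsContactForm α) (hU : IsOpen U)
    (hf : ContMDiffOn (𝓡 (2 * n + 1)) 𝓘(ℝ, ℝ) ∞ f U)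
    (hg : ContMDiffOn (𝓡 (2 * n + 1)) 𝓘(ℝ, ℝ) ∞ g U) :
    ContMDiffOn (𝓡 (2 * n + 1)) 𝓘(ℝ, ℝ) ∞ (jacobiBracket α f g) U := by
  intro x hx
  have hO : IsOpen (chartTarget n x ∩ chartInv n x ⁻¹' U) := isOpen_chart_preimage hU
  have he := self_mem_chart_preimage (n := n) hx
  have hX := isHamiltonianOn_chartField hα x hU hf
  have hY := isHamiltonianOn_chartField hα x hU hg
  have h1 : ContDiffAt ℝ ∞ (fun e ↦ fderiv ℝ (g ∘ chartInv n x) e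
      (chartField x (contactField α f) e) - fderiv ℝ (f ∘ chartInv n x) e
        (chartField x (reeb α) e) * (g ∘ chartInv n x) e) (extChartAt (𝓡 (2 * n + 1)) x x) :=
    ((((hY.smooth_fun.fderiv_of_isOpen hO (by norm_cast)).clm_apply hX.smooth_field).sub
      (hX.smooth_factor.mul hY.smooth_fun)).contDiffAt (hO.mem_nhds he))
  have h2 := contMDiffAt_of_comp_chartInv (f := jacobiBracket α f g) he.1
    (h1.congr_of_eventuallyEq (by
      filter_upwards [hO.mem_nhds he] with e he
      rw [← differential_field hU hg he, ← differential_field hU hf he]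
      exact jacobiBracket_eq hα hU hf hg he.2))
  rw [chartInv, extChartAt_to_inv] at h2
  exact h2.contMDiffWithinAt

/-- The bracket of contact fields is the contact field of the Jacobi bracket. -/
theorem chartFrame_lieBracket (hα : IsContactForm α) (hU : IsOpen U)
    (hf : ContMDiffOn (𝓡 (2 * n + 1)) 𝓘(ℝ, ℝ) ∞ f U)
    (hg : ContMDiffOn (𝓡 (2 * n + 1)) 𝓘(ℝ, ℝ) ∞ g U)
    (he : e ∈ chartTarget n x ∩ chartInv n x ⁻¹' U) :
    chartFrame n x e
      (lieBracket ℝ (chartField x (contactField α f)) (chartField x (contactField α g)) e) =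
      contactField α (jacobiBracket α f g) (chartInv n x e) := by
  have hO : IsOpen (chartTarget n x ∩ chartInv n x ⁻¹' U) := isOpen_chart_preimage hU
  have hX := isHamiltonianOn_chartField hα x hU hf
  have hY := isHamiltonianOn_chartField hα x hU hg
  have ha := (contDiffOn_inChart hα x).mono
    (inter_subset_left : chartTarget n x ∩ chartInv n x ⁻¹' U ⊆ _)
  have hJ := contMDiffOn_jacobiBracket hα hU hf hg
  have h := hα.isContactAt (chartInv n x e)
  -- The factor of `α` produced by `dform_lieBracket` is messy, but its form is irrelevant:
  -- evaluation at the Reeb vector determines it below.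
  obtain ⟨c, hc⟩ : ∃ c, ∀ w, extDer α (chartInv n x e) (chartFrame n x e
      (lieBracket ℝ (chartField x (contactField α f)) (chartField x (contactField α g)) e)) w =
      -differential (jacobiBracket α f g) (chartInv n x e) w + c * α (chartInv n x e) w := by
    refine ⟨fderiv ℝ (fun e ↦ fderiv ℝ (g ∘ chartInv n x) e (chartField x (reeb α) e)) e
      (chartField x (contactField α f) e) -
        fderiv ℝ (fun e ↦ fderiv ℝ (f ∘ chartInv n x) e (chartField x (reeb α) e)) e
      (chartField x (contactField α g) e), fun w ↦ ?_⟩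
    obtain ⟨w, rfl⟩ := (chartFrame_bijective he.1).2 w
    rw [extDer_chartFrame hα he.1, hX.dform_lieBracket hY hO ha he,
      differential_chartInv hU hJ he]
    have hJe : (fun e ↦ inChart α x e (lieBracket ℝ (chartField x (contactField α f))
        (chartField x (contactField α g)) e)) =ᶠ[𝓝 e] jacobiBracket α f g ∘ chartInv n x := by
      filter_upwards [hO.mem_nhds he] with e' he'
      exact (jacobiBracket_chartInv hα hU hf hg he').symm
    rw [hJe.fderiv_eq]
    rfl
  refine h.eq_of_eq ?_ fun w ↦ ?_
  · rw [h.apply_contactField, jacobiBracket_chartInv hα hU hf hg he]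
    rfl
  · have hcz := hc (reeb α _)
    rw [h.extDer_reeb_right, h.apply_reeb] at hcz
    rw [hc, h.extDer_contactField]
    have : c = differential (jacobiBracket α f g) (chartInv n x e) (reeb α _) := by linarith
    rw [this]

end Jacobi

end ContactFoliation

end

noncomputable section

namespace ContactFoliation

open VectorField

/-! ### Distributions and foliations attached to `F`, and completeness. -/

section Foliations

set_option linter.unusedSectionVars false

variable {n : ℕ} {M : Type u} [TopologicalSpace M]
  [ChartedSpace (EuclideanSpace ℝ (Fin (2 * n + 1))) M] [IsManifold (𝓡 (2 * n + 1)) ∞ M]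
  {α : OneForm n M} {x : M} {e : EuclideanSpace ℝ (Fin (2 * n + 1))} {D F : PlaneField n M}
  {q p r k : ℕ}

section Submersion

variable {f : M → EuclideanSpace ℝ (Fin q)} {U : Set M}

theorem chartFrame_mem_iff (hU : IsOpen U) (hf : ContMDiffOn (𝓡 (2 * n + 1)) (𝓡 q) ∞ f U)
    (he : e ∈ chartTarget n x ∩ chartInv n x ⁻¹' U)
    (hD : D (chartInv n x e) =
      LinearMap.ker (mfderiv (𝓡 (2 * n + 1)) (𝓡 q) f (chartInv n x e)).toLinearMap)
    (v : EuclideanSpace ℝ (Fin (2 * n + 1))) :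
    chartFrame n x e v ∈ D (chartInv n x e) ↔ fderiv ℝ (f ∘ chartInv n x) e v = 0 := by
  rw [hD, ← mfderiv_chartFrame he.1 (mdifferentiableAt_of_contMDiffOn hU hf he.2)]
  rfl

theorem surjective_fderiv_chart (hU : IsOpen U)
    (hf : ContMDiffOn (𝓡 (2 * n + 1)) (𝓡 q) ∞ f U)
    (he : e ∈ chartTarget n x ∩ chartInv n x ⁻¹' U)
    (hs : Function.Surjective (mfderiv (𝓡 (2 * n + 1)) (𝓡 q) f (chartInv n x e))) :
    Function.Surjective (fderiv ℝ (f ∘ chartInv n x) e) := by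
  intro u
  obtain ⟨v, hv⟩ := hs u
  obtain ⟨v, rfl⟩ := (chartFrame_bijective he.1).2 v
  exact ⟨v, (mfderiv_chartFrame he.1 (mdifferentiableAt_of_contMDiffOn hU hf he.2) v).symm.trans hv⟩

end Submersion

theorem IsFoliation.isDistribution (hD : IsFoliation D q) (hk : k + q = 2 * n + 1) :
    IsDistribution D k := by
  refine isDistribution_of_chart fun x ↦ ?_
  obtain ⟨U, hU, hx, f, hf, hfU⟩ := hD x
  have he := self_mem_chart_preimage (n := n) hx
  have hO : IsOpen (chartTarget n x ∩ chartInv n x ⁻¹' U) := isOpen_chart_preimage hU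
  have hfO := contDiffOn_comp_chartInv (x := x) hf
  obtain ⟨X, O, hOo, heO, hOU, hX, hXO⟩ := exists_frame_ker (k := k)
    (Q := EuclideanSpace ℝ (Fin q)) (by simp [hk]) hO
    (hfO.fderiv_of_isOpen hO (m := ∞) (by norm_cast)) he
    (surjective_fderiv_chart hU hf he (hfU _ he.2).1)
  refine ⟨O, X, hOo, heO, hX, fun e he het ↦ ⟨(hXO e he).1, fun v ↦ ?_⟩⟩
  rw [← (hXO e he).2, chartFrame_mem_iff hU hf (hOU he) (hfU _ (hOU he).2).2]
  rfl

/-- In a chart, the horizontal part of a foliation containing the Reeb field is defined by the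
submersion and the contact form. -/
theorem chartFrame_mem_horizontalPart (v : EuclideanSpace ℝ (Fin (2 * n + 1))) :
    chartFrame n x e v ∈ horizontalPart α F (chartInv n x e) ↔
      chartFrame n x e v ∈ F (chartInv n x e) ∧ inChart α x e v = 0 := Iff.rfl

theorem exists_submersion_chart (hF : IsFoliation F p) (x : M) :
    ∃ (O : Set (EuclideanSpace ℝ (Fin (2 * n + 1))))
      (f : EuclideanSpace ℝ (Fin (2 * n + 1)) → EuclideanSpace ℝ (Fin p)), IsOpen O ∧
      O ⊆ chartTarget n x ∧ extChartAt (𝓡 (2 * n + 1)) x x ∈ O ∧ ContDiffOn ℝ ∞ f O ∧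
      ∀ e ∈ O, Function.Surjective (fderiv ℝ f e) ∧
        ∀ v, chartFrame n x e v ∈ F (chartInv n x e) ↔ fderiv ℝ f e v = 0 := by
  obtain ⟨U, hU, hx, f, hf, hfU⟩ := hF x
  exact ⟨_, f ∘ chartInv n x, isOpen_chart_preimage hU, inter_subset_left,
    self_mem_chart_preimage hx, contDiffOn_comp_chartInv hf, fun e he ↦
      ⟨surjective_fderiv_chart hU hf he (hfU _ he.2).1,
        chartFrame_mem_iff hU hf he (hfU _ he.2).2⟩⟩

theorem surjective_prod_of_reeb {W Q : Type*} [AddCommGroup W] [Module ℝ W] [AddCommGroup Q]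
    [Module ℝ Q] {L : W →ₗ[ℝ] Q} {a : W →ₗ[ℝ] ℝ} (hL : Function.Surjective L) {z : W}
    (hz : L z = 0) (ha : a z = 1) : Function.Surjective (L.prod a) := by
  rintro ⟨u, t⟩
  obtain ⟨v, rfl⟩ := hL u
  exact ⟨v + (t - a v) • z, by simp [hz, ha]⟩

/-- The horizontal part is the kernel of the pair (df, α), which is onto because the Reeb vector
lies in ker df and has α = 1. -/
theorem IsFoliation.isDistribution_horizontalPart (hF : IsFoliation F p) (hα : IsContactForm α)
    (hZ : ∀ x, reeb α x ∈ F x) (hpr : p + r = 2 * n) :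
    IsDistribution (horizontalPart α F) r := by
  refine isDistribution_of_chart fun x ↦ ?_
  obtain ⟨O, f, hO, hOt, hx, hf, hfO⟩ := exists_submersion_chart hF x
  obtain ⟨X, O', hO', heO', hOO', hX, hXO'⟩ := exists_frame_ker (k := r)
    (Q := EuclideanSpace ℝ (Fin p) × ℝ) (by simp; omega) hO
    (Ω := fun e ↦ (fderiv ℝ f e).prod (inChart α x e))
    (by
      have h1 := hf.fderiv_of_isOpen hO (m := ∞) (by norm_cast)
      have h2 := (contDiffOn_inChart hα x).mono hOt
      rw [contDiffOn_clm_apply]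
      exact fun v ↦ (h1.clm_apply contDiffOn_const).prodMk (h2.clm_apply contDiffOn_const)) hx
    (surjective_prod_of_reeb (L := (fderiv ℝ f _).toLinearMap) (a := (inChart α x _).toLinearMap)
      (hfO _ hx).1 (z := chartField x (reeb α) _)
      (((hfO _ hx).2 _).1 (by rw [chartFrame_chartField (hOt hx)]; exact hZ _))
      (by
        show inChart α x _ _ = 1
        rw [inChart_apply, chartFrame_chartField (hOt hx), (hα.isContactAt _).apply_reeb]))
  refine ⟨O', X, hO', heO', hX, fun e he het ↦ ⟨(hXO' e he).1, fun v ↦ ?_⟩⟩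
  rw [← (hXO' e he).2, chartFrame_mem_horizontalPart, (hfO e (hOO' he)).2]
  exact Prod.mk_eq_zero.symm

/-- The contact fields of `1` and of the components of a defining submersion frame the
pseudo-orthogonal. -/
theorem frame_pseudoOrth (hα : IsContactForm α) (hZ : ∀ x, reeb α x ∈ F x) {U : Set M}
    (hU : IsOpen U) {f : M → EuclideanSpace ℝ (Fin p)}
    (hf : ContMDiffOn (𝓡 (2 * n + 1)) (𝓡 p) ∞ f U)
    (hfU : ∀ y ∈ U, Function.Surjective (mfderiv (𝓡 (2 * n + 1)) (𝓡 p) f y) ∧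
      F y = LinearMap.ker (mfderiv (𝓡 (2 * n + 1)) (𝓡 p) f y).toLinearMap)
    (he : e ∈ chartTarget n x ∩ chartInv n x ⁻¹' U) :
    LinearIndependent ℝ (fun i ↦ chartField x (contactField α
      ((Fin.cons (fun _ ↦ 1) (fun i y ↦ f y i) : Fin (p + 1) → M → ℝ) i)) e) ∧
    ∀ v, chartFrame n x e v ∈ pseudoOrth α F (chartInv n x e) ↔
      v ∈ Submodule.span ℝ (range fun i ↦ chartField x (contactField α
        ((Fin.cons (fun _ ↦ 1) (fun i y ↦ f y i) : Fin (p + 1) → M → ℝ) i)) e) := by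
  have h := hα.isContactAt (chartInv n x e)
  obtain ⟨hs, hk⟩ := hfU _ he.2
  have hcomp : (fun i ↦ contactField α
      ((Fin.cons (fun _ ↦ 1) (fun i y ↦ f y i) : Fin (p + 1) → M → ℝ) i) (chartInv n x e)) =
      (chartFrame n x e).toLinearMap ∘ fun i ↦ chartField x (contactField α
      ((Fin.cons (fun _ ↦ 1) (fun i y ↦ f y i) : Fin (p + 1) → M → ℝ) i)) e := by
    funext i
    exact (chartFrame_chartField he.1 _).symm
  have hd := fun i v ↦ differential_component hU hf he.2 i v
  have hzk := hZ (chartInv n x e)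
  rw [hk] at hzk
  have h1 := h.linearIndependent_contactField
    (L := (mfderiv (𝓡 (2 * n + 1)) (𝓡 p) f (chartInv n x e)).toLinearMap) hs hd hzk
  have h2 := h.span_contactField
    (L := (mfderiv (𝓡 (2 * n + 1)) (𝓡 p) f (chartInv n x e)).toLinearMap) hd hk (hZ _)
  rw [hcomp] at h1 h2
  refine ⟨h1.of_comp _, fun v ↦ ?_⟩
  rw [← h2, range_comp, ← Submodule.map_span]
  constructor
  · rintro ⟨w, hw, hwv⟩
    rwa [← (chartFrame_bijective he.1).1 hwv]
  · exact fun hv ↦ ⟨v, hv, rfl⟩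

theorem IsFoliation.isDistribution_pseudoOrth (hF : IsFoliation F p) (hα : IsContactForm α)
    (hZ : ∀ x, reeb α x ∈ F x) : IsDistribution (pseudoOrth α F) (p + 1) := by
  refine isDistribution_of_chart fun x ↦ ?_
  obtain ⟨U, hU, hx, f, hf, hfU⟩ := hF x
  have hfi := isFirstIntegralOn_cons (isFirstIntegralOn_component hU hf fun y hy ↦ (hfU y hy).2)
  refine ⟨chartTarget n x ∩ chartInv n x ⁻¹' U, fun i ↦ chartField x (contactField α
    ((Fin.cons (fun _ ↦ 1) (fun i y ↦ f y i) : Fin (p + 1) → M → ℝ) i)),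
    isOpen_chart_preimage hU, self_mem_chart_preimage hx,
    fun i ↦ (isHamiltonianOn_chartField hα x hU (hfi i).1).smooth_field,
    fun e he _ ↦ frame_pseudoOrth hα hZ hU hf hfU he⟩

/-- The horizontal part of a pre-isotropic foliation is a foliation: the contact form has a local
primitive along the leaves. -/
theorem IsPreIsotropic.isFoliation_horizontalPart (hpre : IsPreIsotropic α F)
    (hF : IsFoliation F p) (hα : IsContactForm α) (hZ : ∀ x, reeb α x ∈ F x) :
    IsFoliation (horizontalPart α F) (p + 1) := by
  refine isFoliation_of_chart fun x ↦ ?_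
  obtain ⟨O, f, hO, hOt, hx, hf, hfO⟩ := exists_submersion_chart hF x
  -- Pre-isotropy makes `dα` vanish on `F`, so `α` is closed along the leaves. The pair (f, s) is
  -- then the submersion sought, since ds = α on `F`.
  obtain ⟨s, O', hO', hxO', hOO', hs, hsO'⟩ := exists_primitive_along_fibres hO hf
    ((contDiffOn_inChart hα x).mono hOt) hx (hfO _ hx).1 (by
      intro e he v w hv hw
      rw [← extDer_chartFrame hα (hOt he)]
      exact hpre.extDer_eq_zero hα.isContactAt hZ (((hfO e he).2 v).2 hv)
        (((hfO e he).2 w).2 hw))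
  let A : (EuclideanSpace ℝ (Fin p) × ℝ) ≃L[ℝ] EuclideanSpace ℝ (Fin (p + 1)) :=
    ContinuousLinearEquiv.ofFinrankEq (by simp)
  refine ⟨O', fun e ↦ A (f e, s e), hO', hxO',
    A.contDiff.comp_contDiffOn ((hf.mono hOO').prodMk hs), fun e he het ↦ ?_⟩
  have hfd := ContDiffOn.hasFDerivAt_of_isOpen hf hO (hOO' he)
  have hsd := ContDiffOn.hasFDerivAt_of_isOpen hs hO' he
  have hd := (A.hasFDerivAt (x := (f e, s e))).comp e (hfd.prodMk hsd)
  have hd' : ∀ v, fderiv ℝ (fun e ↦ A (f e, s e)) e v = A (fderiv ℝ f e v, fderiv ℝ s e v) :=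
    fun v ↦ by
      have h1 : fderiv ℝ (fun e ↦ A (f e, s e)) e = _ := hd.fderiv
      rw [h1]; rfl
  have hz : fderiv ℝ f e (chartField x (reeb α) e) = 0 :=
    ((hfO _ (hOO' he)).2 _).1 (by rw [chartFrame_chartField het]; exact hZ _)
  refine ⟨fun u ↦ ?_, fun v ↦ ?_⟩
  · obtain ⟨v, hv⟩ := surjective_prod_of_reeb (L := (fderiv ℝ f e).toLinearMap)
      (a := (fderiv ℝ s e).toLinearMap) (hfO e (hOO' he)).1 hz (by
        show fderiv ℝ s e _ = 1
        rw [hsO' e he _ hz, inChart_apply, chartFrame_chartField het,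
          (hα.isContactAt _).apply_reeb]) (A.symm u)
    refine ⟨v, ?_⟩
    have hv' : (fderiv ℝ f e v, fderiv ℝ s e v) = A.symm u := hv
    rw [hd', hv', A.apply_symm_apply]
  · rw [hd', map_eq_zero_iff A A.injective, Prod.mk_eq_zero, chartFrame_mem_horizontalPart,
      (hfO e (hOO' he)).2]
    exact and_congr_right fun hv ↦ by rw [hsO' e he v hv]

/-- The pseudo-orthogonal of a complete foliation is a foliation. -/
theorem IsAlphaComplete.isFoliation_pseudoOrth (hc : IsAlphaComplete α F)
    (hF : IsFoliation F p) (hα : IsContactForm α) (hZ : ∀ x, reeb α x ∈ F x)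
    (hpr : p + r = 2 * n) : IsFoliation (pseudoOrth α F) r := by
  refine isFoliation_of_chart fun x ↦ ?_
  obtain ⟨U, hU, hx, f, hf, hfU⟩ := hF x
  have hfi := isFirstIntegralOn_cons (isFirstIntegralOn_component hU hf fun y hy ↦ (hfU y hy).2)
  have hfr := fun e he ↦ frame_pseudoOrth (e := e) (x := x) hα hZ hU hf hfU he
  -- Involutivity: the bracket of two frame fields is the contact field of a Jacobi bracket, by
  -- completeness a first integral of `F`, so it lies in the pseudo-orthogonal.
  obtain ⟨A, O, hO, hxO, hOU, hA, hAO⟩ := exists_submersion_of_involutive (k := p + 1) (q := r)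
    (by simp; omega) (isOpen_chart_preimage hU)
    (fun i ↦ (isHamiltonianOn_chartField hα x hU (hfi i).1).smooth_field)
    (fun e he ↦ (hfr e he).1) (fun e he i j ↦ by
      rw [← (hfr e he).2, chartFrame_lieBracket hα hU (hfi i).1 (hfi j).1 he]
      exact (hα.isContactAt _).contactField_mem_pseudoOrth (hZ _)
        ((hc U hU _ _ (hfi i) (hfi j)).2 _ he.2)) (self_mem_chart_preimage hx)
  refine ⟨O, A, hO, hxO, hA, fun e he _ ↦ ⟨(hAO e he).1, fun v ↦ ?_⟩⟩
  rw [(hfr e (hOU he)).2, ← (hAO e he).2]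
  rfl

/-- The contact field of a first integral of the horizontal part is pseudo-orthogonal. -/
theorem IsContactAt.contactField_mem_of_horizontalPart (h : IsContactAt α x)
    (hZ : reeb α x ∈ F x) {f : M → ℝ} (hf : ∀ u ∈ horizontalPart α F x, differential f x u = 0) :
    contactField α f x ∈ pseudoOrth α F x := by
  rw [h.mem_pseudoOrth_of_reeb_mem hZ, ← h.extDer_eq_zero_iff hZ]
  intro u hu
  have hαu : α x u = 0 := hu.2
  rw [h.extDer_contactField, hf u hu, hαu, mul_zero, neg_zero, add_zero]

/-- Differentiate df(X) = 0 along `Y` and df(Y) = 0 along `X`; the second derivatives of `f` agree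
by symmetry. -/
theorem lieBracket_mem_ker {V Q : Type*} [NormedAddCommGroup V] [NormedSpace ℝ V]
    [NormedAddCommGroup Q] [NormedSpace ℝ Q] {O : Set V} (hO : IsOpen O) {f : V → Q}
    (hf : ContDiffOn ℝ ∞ f O) {X Y : V → V} (hX : ContDiffOn ℝ ∞ X O) (hY : ContDiffOn ℝ ∞ Y O)
    (hfX : ∀ e ∈ O, fderiv ℝ f e (X e) = 0) (hfY : ∀ e ∈ O, fderiv ℝ f e (Y e) = 0) {e : V}
    (he : e ∈ O) : fderiv ℝ f e (lieBracket ℝ X Y e) = 0 := by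
  have hfe := hf.contDiffAt (hO.mem_nhds he)
  have h1 := ((hasFDerivAt_fderiv hfe).clm_apply
    (ContDiffOn.hasFDerivAt_of_isOpen hX hO he)).congr_of_eventuallyEq
      (f₁ := fun _ ↦ (0 : Q)) (Filter.eventually_of_mem (hO.mem_nhds he) fun e he ↦ (hfX e he).symm)
  have h2 := ((hasFDerivAt_fderiv hfe).clm_apply
    (ContDiffOn.hasFDerivAt_of_isOpen hY hO he)).congr_of_eventuallyEq
      (f₁ := fun _ ↦ (0 : Q)) (Filter.eventually_of_mem (hO.mem_nhds he) fun e he ↦ (hfY e he).symm)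
  have h3 := congrArg (fun L ↦ L (Y e)) (h1.unique (hasFDerivAt_const (0 : Q) e))
  have h4 := congrArg (fun L ↦ L (X e)) (h2.unique (hasFDerivAt_const (0 : Q) e))
  have h5 := symm_fderiv_fderiv hfe (X e) (Y e)
  simp at h3 h4
  rw [lieBracket_eq, map_sub, eq_neg_of_add_eq_zero_left h3, eq_neg_of_add_eq_zero_left h4, h5,
    sub_self]

/-- Contact fields of first integrals of F ∩ ℋ are tangent to E, hence so is their bracket
X_{[f,g]}. Its contraction with `dα` therefore kills F, and on horizontal vectors this contraction
is -d[f,g]. -/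
theorem IsFoliation.isAlphaComplete_horizontalPart (hE : IsFoliation (pseudoOrth α F) q)
    (hα : IsContactForm α) (hZ : ∀ x, reeb α x ∈ F x) :
    IsAlphaComplete α (horizontalPart α F) := by
  intro U hU f g hf hg
  refine ⟨contMDiffOn_jacobiBracket hα hU hf.1 hg.1, fun x hx u hu ↦ ?_⟩
  obtain ⟨O, A, hO, hOt, hxO, hA, hAO⟩ := exists_submersion_chart hE x
  have hOU : IsOpen (chartTarget n x ∩ chartInv n x ⁻¹' U) := isOpen_chart_preimage hU
  have hxU := self_mem_chart_preimage (n := n) hx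
  have hmem : ∀ {h : M → ℝ}, IsFirstIntegralOn (horizontalPart α F) U h →
      ∀ e ∈ O ∩ (chartTarget n x ∩ chartInv n x ⁻¹' U),
        fderiv ℝ A e (chartField x (contactField α h) e) = 0 := by
    intro h hh e he
    rw [← (hAO e he.1).2, chartFrame_chartField he.2.1]
    exact (hα.isContactAt _).contactField_mem_of_horizontalPart (hZ _) (hh.2 _ he.2.2)
  have h1 := lieBracket_mem_ker (hO.inter hOU) (hA.mono inter_subset_left)
    ((isHamiltonianOn_chartField hα x hU hf.1).smooth_field.mono inter_subset_right)
    ((isHamiltonianOn_chartField hα x hU hg.1).smooth_field.mono inter_subset_right)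
    (hmem hf) (hmem hg) ⟨hxO, hxU⟩
  rw [← (hAO _ hxO).2, chartFrame_lieBracket hα hU hf.1 hg.1 hxU, chartInv,
    extChartAt_to_inv, (hα.isContactAt x).mem_pseudoOrth_of_reeb_mem (hZ x)] at h1
  have h2 := h1 u hu.1
  have hαu : α x u = 0 := hu.2
  rw [(hα.isContactAt x).extDer_contactField, hαu, mul_zero, add_zero] at h2
  linarith

theorem jacobiBracket_eq_zero_of_apply {f g : M → ℝ} {U : Set M} (hα : IsContactForm α)
    (hU : IsOpen U) (hf : ContMDiffOn (𝓡 (2 * n + 1)) 𝓘(ℝ, ℝ) ∞ f U)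
    (hg : ContMDiffOn (𝓡 (2 * n + 1)) 𝓘(ℝ, ℝ) ∞ g U) (hx : x ∈ U)
    (hfZ : differential f x (reeb α x) = 0) (hgf : differential g x (contactField α f x) = 0) :
    jacobiBracket α f g x = 0 := by
  rw [jacobiBracket_eq hα hU hf hg hx, hfZ, hgf, zero_mul, sub_zero]

/-- The bracket is the contact field of a function vanishing on an open set. This gives the
commuting frames behind the affine charts. -/
theorem lieBracket_chartField_eq_zero (hα : IsContactForm α) {f g : M → ℝ} {U : Set M}
    (hU : IsOpen U) (hf : ContMDiffOn (𝓡 (2 * n + 1)) 𝓘(ℝ, ℝ) ∞ f U)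
    (hg : ContMDiffOn (𝓡 (2 * n + 1)) 𝓘(ℝ, ℝ) ∞ g U)
    (hJ : ∀ y ∈ U, jacobiBracket α f g y = 0)
    (he : e ∈ chartTarget n x ∩ chartInv n x ⁻¹' U) :
    lieBracket ℝ (chartField x (contactField α f)) (chartField x (contactField α g)) e = 0 := by
  have h := hα.isContactAt (chartInv n x e)
  have hd : differential (n := n) (jacobiBracket α f g) (chartInv n x e) = 0 := by
    have hJ0 : jacobiBracket α f g =ᶠ[𝓝 (chartInv n x e)] fun _ ↦ 0 :=
      Filter.eventually_of_mem (hU.mem_nhds he.2) hJ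
    rw [differential, hJ0.mfderiv_eq]
    exact mfderiv_const
  refine (chartFrame_bijective he.1).1 ?_
  rw [map_zero, chartFrame_lieBracket hα hU hf hg he]
  refine h.eq_zero ?_ fun u ↦ ?_
  · rw [h.apply_contactField, hJ _ he.2]
  · rw [h.extDer_contactField, hd]
    simp

/-- The Reeb field kills the bracket of functions killed by the Reeb field. -/
theorem differential_jacobiBracket_reeb (hα : IsContactForm α) {f g : M → ℝ} {U : Set M}
    (hU : IsOpen U) (hf : ContMDiffOn (𝓡 (2 * n + 1)) 𝓘(ℝ, ℝ) ∞ f U)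
    (hg : ContMDiffOn (𝓡 (2 * n + 1)) 𝓘(ℝ, ℝ) ∞ g U)
    (hfZ : ∀ x ∈ U, differential f x (reeb α x) = 0)
    (hgZ : ∀ x ∈ U, differential g x (reeb α x) = 0) (hx : x ∈ U) :
    differential (jacobiBracket α f g) x (reeb α x) = 0 := by
  have hO : IsOpen (chartTarget n x ∩ chartInv n x ⁻¹' U) := isOpen_chart_preimage hU
  have he := self_mem_chart_preimage (n := n) hx
  have hX := isHamiltonianOn_chartField hα x hU hf
  have hZs := (contDiffOn_chartField_reeb hα x).mono
    (inter_subset_left : chartTarget n x ∩ chartInv n x ⁻¹' U ⊆ _)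
  have h1 := contMDiffOn_const (I := 𝓡 (2 * n + 1)) (I' := 𝓘(ℝ, ℝ)) (n := ∞) (s := U) (c := (1 : ℝ))
  have hone : ∀ y, contactField α (fun _ ↦ 1) y = reeb α y := fun y ↦
    (hα.isContactAt y).contactField_one
  have hchart : chartField x (contactField α (fun _ ↦ 1)) = chartField x (reeb α) := by
    rw [show contactField α (fun _ ↦ 1) = reeb α from funext hone]
  -- Z = X_1 commutes with X_f, because [1, f] = Zf = 0.
  have hbr0 : lieBracket ℝ (chartField x (reeb α)) (chartField x (contactField α f))
      (extChartAt (𝓡 (2 * n + 1)) x x) = 0 := by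
    rw [← hchart]
    refine lieBracket_chartField_eq_zero hα hU h1 hf (fun y hy ↦ ?_) he
    refine jacobiBracket_eq_zero_of_apply hα hU h1 hf hy ?_ ?_
    · exact (isFirstIntegralOn_const (D := fun _ ↦ ⊤) 1 U).2 y hy _ trivial
    · rw [hone, hfZ y hy]
  -- Hence Z(X_f g) = X_f(Zg) = 0, and X_f g is the Jacobi bracket since Zf = 0.
  have hcomm := fderiv_apply_lieBracket hO hZs hX.smooth_field
    (contDiffOn_comp_chartInv (x := x) hg) he
  have hgz : (fun e ↦ fderiv ℝ (g ∘ chartInv n x) e (chartField x (reeb α) e))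
      =ᶠ[𝓝 (extChartAt (𝓡 (2 * n + 1)) x x)] fun _ ↦ 0 := by
    filter_upwards [hO.mem_nhds he] with e he
    rw [← differential_field hU hg he, hgZ _ he.2]
  rw [hbr0, map_zero, hgz.fderiv_eq, fderiv_const_apply, zero_apply, sub_zero] at hcomm
  have hJ := contMDiffOn_jacobiBracket hα hU hf hg
  have hJe : jacobiBracket α f g ∘ chartInv n x =ᶠ[𝓝 (extChartAt (𝓡 (2 * n + 1)) x x)]
      fun e ↦ fderiv ℝ (g ∘ chartInv n x) e (chartField x (contactField α f) e) := by
    filter_upwards [hO.mem_nhds he] with e he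
    rw [← differential_field hU hg he, Function.comp_apply, jacobiBracket_eq hα hU hf hg he.2,
      hfZ _ he.2, zero_mul, sub_zero]
  have h2 := differential_field hU hJ he (reeb α)
  rw [hJe.fderiv_eq, ← hcomm, chartInv, extChartAt_to_inv] at h2
  exact h2

/-- First integrals of F are first integrals of F ∩ ℋ, so their bracket is constant along F ∩ ℋ; the
remaining direction, the Reeb field, is covered by `differential_jacobiBracket_reeb`. -/
theorem IsAlphaComplete.of_horizontalPart (hc : IsAlphaComplete α (horizontalPart α F))
    (hα : IsContactForm α) (hZ : ∀ x, reeb α x ∈ F x) : IsAlphaComplete α F := by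
  intro U hU f g hf hg
  have hle : ∀ x, horizontalPart α F x ≤ F x := fun x ↦ inf_le_left
  have hJ := hc U hU f g (hf.anti hle) (hg.anti hle)
  refine ⟨hJ.1, fun x hx u hu ↦ ?_⟩
  have h1 := hJ.2 x hx _ ((hα.isContactAt x).sub_mem_horizontalPart (hZ x) hu)
  rw [map_sub, map_smul, differential_jacobiBracket_reeb hα hU hf.1 hg.1
    (fun y hy ↦ hf.2 y hy _ (hZ y)) (fun y hy ↦ hg.2 y hy _ (hZ y)) hx, smul_zero, sub_zero] at h1
  exact h1

/-- First integrals of a foliation commute with those of its pseudo-orthogonal. -/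
theorem jacobiBracket_eq_zero {f y : M → ℝ} {U : Set M} (hα : IsContactForm α)
    (hZ : ∀ x, reeb α x ∈ F x) (hU : IsOpen U) (hf : IsFirstIntegralOn F U f)
    (hy : IsFirstIntegralOn (pseudoOrth α F) U y) (hx : x ∈ U) : jacobiBracket α f y x = 0 :=
  jacobiBracket_eq_zero_of_apply hα hU hf.1 hy.1 hx (hf.2 x hx _ (hZ x))
    (hy.2 x hx _ ((hα.isContactAt x).contactField_mem_pseudoOrth (hZ x) (hf.2 x hx)))

theorem jacobiBracket_one_eq_zero {f : M → ℝ} {U : Set M} (hα : IsContactForm α)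
    (hZ : ∀ x, reeb α x ∈ F x) (hU : IsOpen U) (hf : IsFirstIntegralOn F U f) (hx : x ∈ U) :
    jacobiBracket α f (fun _ ↦ 1) x = 0 :=
  jacobiBracket_eq_zero hα hZ hU hf (isFirstIntegralOn_const 1 U) hx

end Foliations

end ContactFoliation

end

noncomputable section

namespace ContactFoliation

open VectorField

/-! ### Derivatives of vector-valued functions. -/

section TangentDeriv

set_option linter.unusedSectionVars false

variable {n k : ℕ} {M : Type u} [TopologicalSpace M]
  [ChartedSpace (EuclideanSpace ℝ (Fin (2 * n + 1))) M]
  {Q R : Type*} [NormedAddCommGroup Q] [NormedSpace ℝ Q] [NormedAddCommGroup R] [NormedSpace ℝ R]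

/-- The derivative of a vector-valued function, with values in the vector space. -/
def tangentDeriv (f : M → Q) (x : M) : TangentSpace (𝓡 (2 * n + 1)) x →L[ℝ] Q :=
  mfderiv (𝓡 (2 * n + 1)) 𝓘(ℝ, Q) f x

theorem fderiv_comp_eq_tangentDeriv {f : M → Q} {ρ : R → M} {w : R}
    (hf : MDifferentiableAt (𝓡 (2 * n + 1)) 𝓘(ℝ, Q) f (ρ w))
    (hρ : MDifferentiableAt 𝓘(ℝ, R) (𝓡 (2 * n + 1)) ρ w) (v : R) :
    fderiv ℝ (f ∘ ρ) w v = tangentDeriv f (ρ w) (mfderiv 𝓘(ℝ, R) (𝓡 (2 * n + 1)) ρ w v) := by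
  rw [← mfderiv_eq_fderiv, mfderiv_comp w hf hρ]
  rfl

end TangentDeriv

/-! ### A criterion for an affine structure on integral manifolds. -/

section AffineStructure

set_option linter.unusedSectionVars false

/-- A map whose derivative is `m` composed with the identity, with `m` constant, is affine. -/
theorem exists_affine_of_fderiv {k : ℕ}
    {G : EuclideanSpace ℝ (Fin k) → EuclideanSpace ℝ (Fin k)}
    {m : EuclideanSpace ℝ (Fin k) → EuclideanSpace ℝ (Fin k) →L[ℝ] EuclideanSpace ℝ (Fin k)}
    {N : Set (EuclideanSpace ℝ (Fin k))} (hN : IsOpen N) {z : EuclideanSpace ℝ (Fin k)}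
    (hz : z ∈ N) (hG : DifferentiableOn ℝ G N) (hm : DifferentiableOn ℝ m N)
    (hdm : ∀ w ∈ N, fderiv ℝ m w = 0) (hdG : ∀ w ∈ N, fderiv ℝ G w = m w) :
    ∃ a : EuclideanSpace ℝ (Fin k) →ᵃ[ℝ] EuclideanSpace ℝ (Fin k), ∀ᶠ w in 𝓝 z, G w = a w := by
  obtain ⟨ε, hε, hεN⟩ := Metric.isOpen_iff.1 hN z hz
  have hpre : IsPreconnected (Metric.ball z ε) := (convex_ball z ε).isPreconnected
  have hz' : z ∈ Metric.ball z ε := Metric.mem_ball_self hε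
  have hconst : ∀ w ∈ Metric.ball z ε, m w = m z := fun w hw ↦
    Metric.isOpen_ball.is_const_of_fderiv_eq_zero hpre (hm.mono hεN)
      (fun w hw ↦ hdm w (hεN hw)) hw hz'
  obtain ⟨c, hc⟩ := Metric.isOpen_ball.exists_eq_add_of_fderiv_eq hpre (hG.mono hεN)
    (g := m z) (m z).differentiable.differentiableOn
    (fun w hw ↦ by rw [hdG w (hεN hw), hconst w hw, (m z).fderiv])
  refine ⟨(m z).toLinearMap.toAffineMap + AffineMap.const ℝ _ c, ?_⟩
  filter_upwards [Metric.isOpen_ball.mem_nhds hz'] with w hw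
  exact hc hw

variable {n k : ℕ} {M : Type u} [TopologicalSpace M]
  [ChartedSpace (EuclideanSpace ℝ (Fin (2 * n + 1))) M]
  {D : PlaneField n M} {L : Type u} [TopologicalSpace L]
  [ChartedSpace (EuclideanSpace ℝ (Fin k)) L] [IsManifold (𝓡 k) ∞ L] {ι : L → M}
  {c : OpenPartialHomeomorph L (EuclideanSpace ℝ (Fin k))} {w : EuclideanSpace ℝ (Fin k)}

/-- The parametrization of an integral manifold by a chart. -/
theorem IsIntegralManifold.contMDiffAt_comp_symm (hι : IsIntegralManifold D (k := k) ι)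
    (hc : c ∈ IsManifold.maximalAtlas (𝓡 k) ∞ L) (hw : w ∈ c.target) :
    ContMDiffAt (𝓡 k) (𝓡 (2 * n + 1)) ∞ (ι ∘ c.symm) w :=
  hι.smooth.contMDiffAt.comp w (contMDiffAt_symm_of_mem_maximalAtlas hc hw)

theorem IsIntegralManifold.mfderiv_comp_symm (hι : IsIntegralManifold D (k := k) ι)
    (hc : c ∈ IsManifold.maximalAtlas (𝓡 k) ∞ L) (hw : w ∈ c.target) :
    (∀ v, mfderiv (𝓡 k) (𝓡 (2 * n + 1)) (ι ∘ c.symm) w v ∈ D (ι (c.symm w))) ∧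
      Function.Injective (mfderiv (𝓡 k) (𝓡 (2 * n + 1)) (ι ∘ c.symm) w) := by
  have hs : MDifferentiableAt (𝓡 k) (𝓡 k) c.symm w :=
    (contMDiffAt_symm_of_mem_maximalAtlas hc hw).mdifferentiableAt (by simp)
  have hcs : MDifferentiableAt (𝓡 k) (𝓡 k) c (c.symm w) :=
    (contMDiffAt_of_mem_maximalAtlas hc (c.map_target hw)).mdifferentiableAt (by simp)
  have h1 := mfderiv_comp w (hι.smooth.mdifferentiableAt (by simp)) hs
  rw [h1]
  constructor
  · intro v
    rw [← hι.tangent]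
    exact ⟨mfderiv (𝓡 k) (𝓡 k) c.symm w v, rfl⟩
  · refine (hι.immersion _).comp ?_
    have h2 := mfderiv_comp w hcs hs
    have h3 : c ∘ c.symm =ᶠ[𝓝 w] id := by
      filter_upwards [c.open_target.mem_nhds hw] with w' hw'
      exact c.right_inv hw'
    rw [h3.mfderiv_eq, mfderiv_id] at h2
    intro u v huv
    have h4 := congrArg (fun L ↦ L u) h2
    have h5 := congrArg (fun L ↦ L v) h2
    have h6 : mfderiv (𝓡 k) (𝓡 k) c (c.symm w) (mfderiv (𝓡 k) (𝓡 k) c.symm w u) =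
      mfderiv (𝓡 k) (𝓡 k) c (c.symm w) (mfderiv (𝓡 k) (𝓡 k) c.symm w v) :=
      congrArg (fun t ↦ mfderiv (𝓡 k) (𝓡 k) c (c.symm w) t) huv
    exact h4.trans (h6.trans h5.symm)

/-- Local functions on `M` whose restrictions to an integral manifold are immersive, with
transitions that are affine along the integral manifold, give an affine structure. -/
theorem IsIntegralManifold.hasAffineStructure (hι : IsIntegralManifold D (k := k) ι) {J : Type*}
    (U : J → Set M) (C : J → M → EuclideanSpace ℝ (Fin k)) (hU : ∀ a, IsOpen (U a))
    (hC : ∀ a, ContMDiffOn (𝓡 (2 * n + 1)) (𝓡 k) ∞ (C a) (U a)) (hcov : ∀ x, ∃ a, x ∈ U a)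
    (hinj : ∀ a, ∀ x ∈ U a, ∀ u ∈ D x, tangentDeriv (C a) x u = 0 → u = 0)
    (htrans : ∀ a b, ∃ m : M → EuclideanSpace ℝ (Fin k) →L[ℝ] EuclideanSpace ℝ (Fin k),
      ContMDiffOn (𝓡 (2 * n + 1))
        𝓘(ℝ, EuclideanSpace ℝ (Fin k) →L[ℝ] EuclideanSpace ℝ (Fin k)) ∞ m (U a ∩ U b) ∧
      ∀ x ∈ U a ∩ U b, ∀ u ∈ D x, tangentDeriv m x u = 0 ∧
        tangentDeriv (C b) x u = m x (tangentDeriv (C a) x u)) :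
    HasAffineStructure k L := by
  have hd : ∀ {Q : Type} [NormedAddCommGroup Q] [NormedSpace ℝ Q] {f : M → Q} {V : Set M},
      IsOpen V → ContMDiffOn (𝓡 (2 * n + 1)) 𝓘(ℝ, Q) ∞ f V → ∀ x ∈ V,
      MDifferentiableAt (𝓡 (2 * n + 1)) 𝓘(ℝ, Q) f x := fun hV hf x hx ↦
    (hf.contMDiffAt (hV.mem_nhds hx)).mdifferentiableAt (by simp)
  -- The atlas consists of the smooth charts that are restrictions of some `C a` to the integral
  -- manifold.
  refine ⟨{c | c ∈ IsManifold.maximalAtlas (𝓡 k) ∞ L ∧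
    ∃ a, ∀ l ∈ c.source, ι l ∈ U a ∧ c l = C a (ι l)}, fun c hc ↦ hc.1, fun l ↦ ?_, ?_⟩
  · obtain ⟨a, ha⟩ := hcov (ι l)
    have hc₁ := IsManifold.chart_mem_maximalAtlas (I := 𝓡 k) (n := ∞) l
    set c₁ := chartAt (EuclideanSpace ℝ (Fin k)) l with hc₁_def
    set s := c₁.target ∩ c₁.symm ⁻¹' (ι ⁻¹' U a) with hs_def
    have hs : IsOpen s := c₁.isOpen_inter_preimage_symm ((hU a).preimage hι.smooth.continuous)
    have hg : ContDiffOn ℝ ∞ (C a ∘ ι ∘ c₁.symm) s := fun w hw ↦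
      (((hC a).contMDiffAt ((hU a).mem_nhds hw.2)).comp w
        (hι.contMDiffAt_comp_symm hc₁ hw.1)).contDiffAt.contDiffWithinAt
    have hl : c₁ l ∈ s := ⟨c₁.map_source (mem_chart_source _ l), by
      rw [mem_preimage, mem_preimage, c₁.left_inv (mem_chart_source _ l)]; exact ha⟩
    have hinv : (fderiv ℝ (C a ∘ ι ∘ c₁.symm) (c₁ l)).IsInvertible := by
      refine isInvertible_of_injective _ ((injective_iff_map_eq_zero _).2 fun v hv ↦ ?_) rfl
      rw [fderiv_comp_eq_tangentDeriv (ρ := ι ∘ c₁.symm) (hd (hU a) (hC a) _ hl.2)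
        ((hι.contMDiffAt_comp_symm hc₁ hl.1).mdifferentiableAt (by simp))] at hv
      obtain ⟨h1, h2⟩ := hι.mfderiv_comp_symm hc₁ hl.1
      exact h2 ((hinj a _ hl.2 _ (h1 v) hv).trans (map_zero _).symm)
    obtain ⟨c₂, hc₂, hl₂, hs₂, -, hsymm⟩ := exists_openPartialHomeomorph hs hg hl hinv
    refine ⟨c₁.trans c₂, ⟨OpenPartialHomeomorph.mem_maximalAtlas_of_contMDiffOn _ ?_ ?_, a, ?_⟩, ?_⟩
    · rw [OpenPartialHomeomorph.coe_trans, OpenPartialHomeomorph.trans_source]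
      refine ContMDiffOn.comp (t := c₂.source) ?_
        ((contMDiffOn_of_mem_maximalAtlas hc₁).mono inter_subset_left) inter_subset_right
      rw [hc₂]
      exact (hg.mono hs₂).contMDiffOn
    · rw [OpenPartialHomeomorph.coe_trans_symm, OpenPartialHomeomorph.trans_target]
      exact ContMDiffOn.comp (t := c₁.target) (contMDiffOn_symm_of_mem_maximalAtlas hc₁)
        (hsymm.contMDiffOn.mono inter_subset_left) inter_subset_right
    · intro l' hl'
      rw [OpenPartialHomeomorph.trans_source] at hl'
      have h1 := (hs₂ hl'.2).2
      rw [mem_preimage, mem_preimage, c₁.left_inv hl'.1] at h1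
      refine ⟨h1, ?_⟩
      rw [OpenPartialHomeomorph.coe_trans, Function.comp_apply, hc₂, Function.comp_apply,
        Function.comp_apply, c₁.left_inv hl'.1]
    · rw [OpenPartialHomeomorph.trans_source]
      exact ⟨mem_chart_source _ l, hl₂⟩
  · rintro c ⟨hc, a, hca⟩ c' ⟨hc', b, hcb⟩ z hz
    obtain ⟨m, hm, hmD⟩ := htrans a b
    set N := (c.symm.trans c').source
    have hN : IsOpen N := (c.symm.trans c').open_source
    have hNt : ∀ w ∈ N, w ∈ c.target ∧ c.symm w ∈ c'.source := by
      exact fun w hw ↦ hw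
    have hρU : ∀ w ∈ N, ι (c.symm w) ∈ U a ∩ U b := fun w hw ↦
      ⟨(hca _ (c.map_target (hNt w hw).1)).1, (hcb _ (hNt w hw).2).1⟩
    have hρ : ∀ w ∈ N, MDifferentiableAt (𝓡 k) (𝓡 (2 * n + 1)) (ι ∘ c.symm) w := fun w hw ↦
      (hι.contMDiffAt_comp_symm hc (hNt w hw).1).mdifferentiableAt (by simp)
    have hmd := fun w hw ↦ hd ((hU a).inter (hU b)) hm _ (hρU w hw)
    have hCb := fun w hw ↦ hd (hU b) (hC b) _ (hρU w hw).2
    have hCa := fun w hw ↦ hd (hU a) (hC a) _ (hρU w hw).1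
    have hGeq : ∀ w ∈ N, c' (c.symm w) = (C b ∘ ι ∘ c.symm) w := fun w hw ↦
      (hcb _ (hNt w hw).2).2
    -- In the chart given by `C a` this function is the identity, so the derivative of the
    -- transition is the matrix `m` itself, constant along the integral manifold.
    have hid : ∀ w ∈ N, (C a ∘ ι ∘ c.symm) w = w := fun w hw ↦
      (hca _ (c.map_target (hNt w hw).1)).2.symm.trans (c.right_inv (hNt w hw).1)
    obtain ⟨A, hA⟩ := exists_affine_of_fderiv (G := C b ∘ ι ∘ c.symm) (m := m ∘ ι ∘ c.symm) hN hz
      (fun w hw ↦ (((hCb w hw).comp w (hρ w hw)).differentiableAt).differentiableWithinAt)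
      (fun w hw ↦ (((hmd w hw).comp w (hρ w hw)).differentiableAt).differentiableWithinAt)
      (fun w hw ↦ by
        ext1 v
        rw [fderiv_comp_eq_tangentDeriv (ρ := ι ∘ c.symm) (hmd w hw) (hρ w hw)]
        exact (hmD _ (hρU w hw) _ ((hι.mfderiv_comp_symm hc (hNt w hw).1).1 v)).1)
      (fun w hw ↦ by
        ext1 v
        have h1 : C a ∘ ι ∘ c.symm =ᶠ[𝓝 w] id := by
          filter_upwards [hN.mem_nhds hw] with w' hw'
          exact hid w' hw'
        have h2 := fderiv_comp_eq_tangentDeriv (ρ := ι ∘ c.symm) (hCa w hw) (hρ w hw) v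
        rw [h1.fderiv_eq, fderiv_id] at h2
        rw [fderiv_comp_eq_tangentDeriv (ρ := ι ∘ c.symm) (hCb w hw) (hρ w hw)]
        refine (hmD _ (hρU w hw) _ ((hι.mfderiv_comp_symm hc (hNt w hw).1).1 v)).2.trans ?_
        exact congrArg (m (ι (c.symm w))) h2.symm)
    refine ⟨A, ?_⟩
    filter_upwards [hA, hN.mem_nhds hz] with w hw hwN
    rw [hGeq w hwN, hw]

end AffineStructure

/-! ### Functions dual to a commuting frame. -/

section DualFunctions

variable {V Q : Type} [NormedAddCommGroup V] [NormedSpace ℝ V] [FiniteDimensional ℝ V]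
  [NormedAddCommGroup Q] [NormedSpace ℝ Q] [FiniteDimensional ℝ Q] {k : ℕ}

/-- Independent vector fields have a dual family of forms locally. -/
theorem exists_coframe {X : Fin k → V → V} {U : Set V} (hU : IsOpen U)
    (hX : ∀ i, ContDiffOn ℝ ∞ (X i) U) {e₀ : V} (he₀ : e₀ ∈ U)
    (hli : LinearIndependent ℝ fun i ↦ X i e₀) :
    ∃ (θ : V → V →L[ℝ] EuclideanSpace ℝ (Fin k)) (O : Set V), IsOpen O ∧ e₀ ∈ O ∧ O ⊆ U ∧
      ContDiffOn ℝ ∞ θ O ∧ ∀ e ∈ O, ∀ j, θ e (X j e) = EuclideanSpace.single j 1 := by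
  obtain ⟨L₀, hL₀⟩ := (frameMap fun i ↦ X i e₀).toLinearMap.exists_leftInverse_of_injective
    (LinearMap.ker_eq_bot.2 (frameMap_injective hli))
  let L : V →L[ℝ] EuclideanSpace ℝ (Fin k) := L₀.toContinuousLinearMap
  have hL : L.comp (frameMap fun i ↦ X i e₀) = ContinuousLinearMap.id ℝ _ := by
    ext1 v
    exact congrArg (fun A ↦ A v) hL₀
  have hs : ContDiffOn ℝ ∞ (fun e ↦ L.comp (frameMap fun i ↦ X i e)) U :=
    contDiffOn_const.clm_comp (contDiffOn_frameMap hX)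
  have hO : IsOpen (U ∩ (fun e ↦ L.comp (frameMap fun i ↦ X i e)) ⁻¹' {A | A.IsInvertible}) :=
    hs.continuousOn.isOpen_inter_preimage hU isOpen_setOf_isInvertible
  refine ⟨fun e ↦ (L.comp (frameMap fun i ↦ X i e)).inverse.comp L, _, hO, ⟨he₀, ?_⟩,
    inter_subset_left, ?_, fun e he j ↦ ?_⟩
  · rw [mem_preimage, hL]
    exact ⟨ContinuousLinearEquiv.refl ℝ _, rfl⟩
  · exact (contDiffOn_inverse (hs.mono inter_subset_left) fun e he ↦ he.2).clm_comp contDiffOn_const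
  · refine inverse_apply_of_apply_eq he.2 ?_
    rw [ContinuousLinearMap.comp_apply, frameMap_single]
    rfl

/-- A commuting frame of the fibres of a submersion is dual to local functions. -/
theorem exists_dual_functions {X : Fin k → V → V} {U : Set V} (hU : IsOpen U)
    (hX : ∀ i, ContDiffOn ℝ ∞ (X i) U) {e₀ : V} (he₀ : e₀ ∈ U)
    (hli : LinearIndependent ℝ fun i ↦ X i e₀)
    (hcomm : ∀ e ∈ U, ∀ i j, lieBracket ℝ (X i) (X j) e = 0) {f : V → Q}
    (hf : ContDiffOn ℝ ∞ f U) (hsurj : Function.Surjective (fderiv ℝ f e₀))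
    (hker : ∀ e ∈ U, ∀ v, fderiv ℝ f e v = 0 ↔ v ∈ Submodule.span ℝ (range fun i ↦ X i e)) :
    ∃ (c : V → EuclideanSpace ℝ (Fin k)) (O : Set V), IsOpen O ∧ e₀ ∈ O ∧ O ⊆ U ∧
      ContDiffOn ℝ ∞ c O ∧ ∀ e ∈ O, ∀ j, fderiv ℝ c e (X j e) = EuclideanSpace.single j 1 := by
  obtain ⟨θ, O₁, hO₁, he₁, hO₁U, hθ, hθX⟩ := exists_coframe hU hX he₀ hli
  have hθi : ∀ i, ContDiffOn ℝ ∞ (fun e ↦ (EuclideanSpace.proj (𝕜 := ℝ) i).comp (θ e)) O₁ :=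
    fun i ↦ contDiffOn_const.clm_comp hθ
  have hclosed : ∀ i, ∀ e ∈ O₁, ∀ v w, fderiv ℝ f e v = 0 → fderiv ℝ f e w = 0 →
      dform (fun e ↦ (EuclideanSpace.proj (𝕜 := ℝ) i).comp (θ e)) e v w = 0 := by
    intro i e he
    -- dθ(X_j, X_l) = X_j θ(X_l) - X_l θ(X_j) - θ([X_j, X_l]): the pairings are constant and the
    -- fields commute.
    have hframe : ∀ j l, dform (fun e ↦ (EuclideanSpace.proj (𝕜 := ℝ) i).comp (θ e)) e
        (X j e) (X l e) = 0 := by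
      intro j l
      have hd := ContDiffOn.hasFDerivAt_of_isOpen (hθi i) hO₁ he
      have h1 := fun j ↦ (hd.clm_apply (ContDiffOn.hasFDerivAt_of_isOpen ((hX j).mono hO₁U) hO₁
        he)).congr_of_eventuallyEq (f₁ := fun _ ↦ (EuclideanSpace.single j (1 : ℝ) :
          EuclideanSpace ℝ (Fin k)) i) (Filter.eventually_of_mem (hO₁.mem_nhds he) fun e he ↦ by
            simp [hθX e he j])
      have h2 := congrArg (fun L ↦ L (X j e)) ((h1 l).unique (hasFDerivAt_const _ e))
      have h3 := congrArg (fun L ↦ L (X l e)) ((h1 j).unique (hasFDerivAt_const _ e))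
      have h4 := hcomm e (hO₁U he) j l
      rw [lieBracket_eq, sub_eq_zero] at h4
      simp [h4] at h2 h3
      simp only [dform]
      linarith
    intro v w hv hw
    rw [hker e (hO₁U he)] at hv hw
    induction hv using Submodule.span_induction with
    | mem v hv =>
      obtain ⟨j, rfl⟩ := hv
      induction hw using Submodule.span_induction with
      | mem w hw =>
        obtain ⟨l, rfl⟩ := hw
        exact hframe j l
      | zero => simp [dform]
      | add w w' _ _ h1 h2 => simp only [dform, map_add, add_apply] at h1 h2 ⊢; linarith
      | smul c w _ h1 =>
        simp only [dform, map_smul, smul_apply, smul_eq_mul] at h1 ⊢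
        rw [← mul_sub, h1, mul_zero]
    | zero => simp [dform]
    | add w w' _ _ h1 h2 => simp only [dform, map_add, add_apply] at h1 h2 ⊢; linarith
    | smul c w _ h1 =>
      simp only [dform, map_smul, smul_apply, smul_eq_mul] at h1 ⊢
      rw [← mul_sub, h1, mul_zero]
  -- A primitive along the fibres suffices, since the frame is tangent to them.
  choose s O hO heO hOO₁ hs hsO using fun i ↦
    exists_primitive_along_fibres hO₁ (hf.mono hO₁U) (hθi i) he₁ hsurj (hclosed i)
  refine ⟨fun e ↦ WithLp.toLp 2 fun i ↦ s i e, O₁ ∩ ⋂ i, O i,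
    hO₁.inter (isOpen_iInter_of_finite hO),
    ⟨he₁, mem_iInter.2 heO⟩, inter_subset_left.trans hO₁U, ?_, fun e he j ↦ ?_⟩
  · rw [contDiffOn_euclidean]
    exact fun i ↦ (hs i).mono (inter_subset_right.trans (iInter_subset _ i))
  · have hei := fun i ↦ mem_iInter.1 he.2 i
    have hci : ContDiffOn ℝ ∞ (fun e ↦ WithLp.toLp 2 fun i ↦ s i e : V → EuclideanSpace ℝ (Fin k))
        (⋂ i, O i) := contDiffOn_euclidean.2 fun i ↦ (hs i).mono (iInter_subset _ i)
    have hd := ContDiffOn.hasFDerivAt_of_isOpen hci (isOpen_iInter_of_finite hO) he.2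
    ext i
    have h1 := ((EuclideanSpace.proj (𝕜 := ℝ) i).hasFDerivAt.comp e hd).unique
      (ContDiffOn.hasFDerivAt_of_isOpen (hs i) (hO i) (hei i))
    have h2 := congrArg (fun L ↦ L (X j e)) h1
    have h3 := hsO i e (hei i) (X j e)
      ((hker e (hO₁U he.1) _).2 (Submodule.subset_span ⟨j, rfl⟩))
    rw [ContinuousLinearMap.comp_apply, hθX e he.1] at h3
    exact h2.trans h3

end DualFunctions

end ContactFoliation

end

noncomputable section

namespace ContactFoliation

open VectorField

/-! ### Adapted coordinates along the leaves of `F` and of its horizontal part. -/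

section AdaptedFunctions

set_option linter.unusedSectionVars false

variable {n k p r : ℕ} {M : Type u} [TopologicalSpace M]
  [ChartedSpace (EuclideanSpace ℝ (Fin (2 * n + 1))) M] [IsManifold (𝓡 (2 * n + 1)) ∞ M]
  {α : OneForm n M} {F : PlaneField n M} {x : M} {e : EuclideanSpace ℝ (Fin (2 * n + 1))}

theorem IsPreIsotropic.le_pseudoOrth (hpre : IsPreIsotropic α F) (hα : IsContactForm α)
    (hZ : ∀ x, reeb α x ∈ F x) (x : M) : F x ≤ pseudoOrth α F x := fun _ hv ↦
  ((hα.isContactAt x).mem_pseudoOrth_of_reeb_mem (hZ x)).2 fun _ hu ↦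
    hpre.extDer_eq_zero hα.isContactAt hZ hv hu

/-- With this, `frame_pseudoOrth` applied to E gives a frame of F by contact fields of first
integrals of E. -/
theorem pseudoOrth_pseudoOrth (hα : IsContactForm α) (hZ : ∀ x, reeb α x ∈ F x) :
    pseudoOrth α (pseudoOrth α F) = F := by
  funext x
  ext v
  rw [(hα.isContactAt x).mem_pseudoOrth_of_reeb_mem (IsContactAt.reeb_mem_pseudoOrth F),
    ← (hα.isContactAt x).mem_iff_extDer_pseudoOrth (hZ x)]

/-- Functions `C` on `U` dual to the contact fields, framing `F`, of the first integrals `h` of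
the pseudo-orthogonal of `F`. -/
structure IsAdaptedOn (α : OneForm n M) (F : PlaneField n M) (U : Set M) (h : Fin k → M → ℝ)
    (C : M → EuclideanSpace ℝ (Fin k)) : Prop where
  isOpen : IsOpen U
  smooth : ContMDiffOn (𝓡 (2 * n + 1)) (𝓡 k) ∞ C U
  firstIntegral : ∀ j, IsFirstIntegralOn (pseudoOrth α F) U (h j)
  dual : ∀ x ∈ U, ∀ j, tangentDeriv C x (contactField α (h j) x) = EuclideanSpace.single j 1
  span : ∀ x ∈ U, F x = Submodule.span ℝ (range fun j ↦ contactField α (h j) x)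

/-- The contact fields of 1 and of the components of a submersion defining E frame F. They commute:
these functions are first integrals of E, hence of F ⊆ E, so their Jacobi brackets vanish. Dual
functions then exist. -/
theorem exists_isAdaptedOn (hpre : IsPreIsotropic α F) (hF : IsFoliation F p)
    (hα : IsContactForm α) (hZ : ∀ x, reeb α x ∈ F x) (hE : IsFoliation (pseudoOrth α F) r)
    (x : M) : ∃ (U : Set M) (h : Fin (r + 1) → M → ℝ) (C : M → EuclideanSpace ℝ (Fin (r + 1))),
      x ∈ U ∧ IsAdaptedOn α F U h C ∧ h 0 = fun _ ↦ 1 := by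
  obtain ⟨U, hU, hx, y, hy, hyU⟩ := hE x
  have hZE : ∀ x, reeb α x ∈ pseudoOrth α F x := fun x ↦ IsContactAt.reeb_mem_pseudoOrth F
  set h : Fin (r + 1) → M → ℝ := Fin.cons (fun _ ↦ 1) (fun i x ↦ y x i) with hh
  have hfi : ∀ j, IsFirstIntegralOn (pseudoOrth α F) U (h j) :=
    isFirstIntegralOn_cons (isFirstIntegralOn_component hU hy fun z hz ↦ (hyU z hz).2)
  have hfr := fun e he ↦ frame_pseudoOrth (e := e) (x := x) hα hZE hU hy hyU he
  rw [pseudoOrth_pseudoOrth hα hZ] at hfr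
  obtain ⟨O₁, f, hO₁, hO₁t, hxO₁, hf, hfO₁⟩ := exists_submersion_chart hF x
  have hOU : IsOpen (chartTarget n x ∩ chartInv n x ⁻¹' U) := isOpen_chart_preimage hU
  have hxU := self_mem_chart_preimage (n := n) hx
  obtain ⟨c, O, hO, hxO, hOO, hc, hcO⟩ := exists_dual_functions
    (X := fun i ↦ chartField x (contactField α (h i))) (hO₁.inter hOU)
    (fun i ↦ (isHamiltonianOn_chartField hα x hU (hfi i).1).smooth_field.mono inter_subset_right)
    ⟨hxO₁, hxU⟩ (hfr _ hxU).1
    (fun e he i j ↦ lieBracket_chartField_eq_zero hα hU (hfi i).1 (hfi j).1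
      (fun z hz ↦ jacobiBracket_eq_zero hα hZ hU
        ((hfi i).anti fun z ↦ hpre.le_pseudoOrth hα hZ z) (hfi j) hz) he.2)
    (hf.mono inter_subset_left) (hfO₁ _ hxO₁).1
    (fun e he v ↦ by rw [← (hfO₁ e he.1).2, (hfr e he.2).2])
  have hsub : chartDomain n x O ⊆ U := by
    intro z hz
    obtain ⟨e, he, -, rfl⟩ := exists_of_mem_chartDomain hz
    exact (hOO he).2.2
  refine ⟨chartDomain n x O, h, c ∘ extChartAt (𝓡 (2 * n + 1)) x, mem_chartDomain_self hxO,
    ⟨isOpen_chartDomain hO, contMDiffOn_lift hO hc, fun j ↦ ⟨(hfi j).1.mono hsub,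
      fun z hz ↦ (hfi j).2 z (hsub hz)⟩, fun z hz j ↦ ?_, fun z hz ↦ ?_⟩, rfl⟩
  · obtain ⟨e, he, het, rfl⟩ := exists_of_mem_chartDomain hz
    rw [← hcO e he j, ← chartFrame_chartField het (contactField α (h j))]
    exact mfderiv_lift het (hc.contDiffAt (hO.mem_nhds he)) _
  · have hz' := hsub hz
    have h1 := (hα.isContactAt z).span_contactField
      (L := (mfderiv (𝓡 (2 * n + 1)) (𝓡 r) y z).toLinearMap)
      (fun i v ↦ differential_component hU hy hz' i v) (hyU z hz').2 (hZE z)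
    rw [pseudoOrth_pseudoOrth hα hZ] at h1
    exact h1.symm

namespace IsAdaptedOn

variable {U U' : Set M} {h h' : Fin k → M → ℝ} {C C' : M → EuclideanSpace ℝ (Fin k)}

theorem frameMap_tangentDeriv (hC : IsAdaptedOn α F U h C) (hx : x ∈ U)
    {Q : Type*} [NormedAddCommGroup Q] [NormedSpace ℝ Q]
    (A : TangentSpace (𝓡 (2 * n + 1)) x →L[ℝ] Q) {u : TangentSpace (𝓡 (2 * n + 1)) x}
    (hu : u ∈ F x) :
    A u = frameMap (fun j ↦ A (contactField α (h j) x)) (tangentDeriv C x u) := by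
  rw [hC.span x hx] at hu
  induction hu using Submodule.span_induction with
  | mem u hu =>
    obtain ⟨j, rfl⟩ := hu
    rw [hC.dual x hx, frameMap_single]
  | zero => simp
  | add u v _ _ h1 h2 => rw [map_add, map_add, map_add, h1, h2]
  | smul c u _ h1 => rw [map_smul, map_smul, map_smul, h1]

theorem eq_sum (hC : IsAdaptedOn α F U h C) (hx : x ∈ U) {u : TangentSpace (𝓡 (2 * n + 1)) x}
    (hu : u ∈ F x) : u = ∑ j, tangentDeriv C x u j • contactField α (h j) x := by
  have h1 := hC.frameMap_tangentDeriv hx (Q := EuclideanSpace ℝ (Fin (2 * n + 1)))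
    (ContinuousLinearMap.id ℝ _) hu
  rw [frameMap_apply] at h1
  exact h1

/-- The matrix relating two adapted families. -/
def transition (h : Fin k → M → ℝ) (α : OneForm n M) (C' : M → EuclideanSpace ℝ (Fin k)) (x : M) :
    EuclideanSpace ℝ (Fin k) →L[ℝ] EuclideanSpace ℝ (Fin k) :=
  frameMap fun j ↦ tangentDeriv C' x (contactField α (h j) x)

/-- The entries of the matrix are the X_{h_j} C'. Fields of the two families commute too, so
X_{h'_l} X_{h_j} C' = X_{h_j} X_{h'_l} C', and this is zero because X_{h'_l} C' is constant by
duality. The X_{h'_l} span F. -/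
theorem transition_spec (hC : IsAdaptedOn α F U h C) (hC' : IsAdaptedOn α F U' h' C')
    (hpre : IsPreIsotropic α F) (hα : IsContactForm α) (hZ : ∀ x, reeb α x ∈ F x) :
    ContMDiffOn (𝓡 (2 * n + 1)) 𝓘(ℝ, EuclideanSpace ℝ (Fin k) →L[ℝ] EuclideanSpace ℝ (Fin k)) ∞
      (transition h α C') (U ∩ U') ∧
    ∀ x ∈ U ∩ U', ∀ u ∈ F x, tangentDeriv (transition h α C') x u = 0 ∧
      tangentDeriv C' x u = transition h α C' x (tangentDeriv C x u) := by
  have hUU : IsOpen (U ∩ U') := hC.isOpen.inter hC'.isOpen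
  have hfi : ∀ j, ContMDiffOn (𝓡 (2 * n + 1)) 𝓘(ℝ, ℝ) ∞ (h j) (U ∩ U') := fun j ↦
    (hC.firstIntegral j).1.mono inter_subset_left
  have hfi' : ∀ j, ContMDiffOn (𝓡 (2 * n + 1)) 𝓘(ℝ, ℝ) ∞ (h' j) (U ∩ U') := fun j ↦
    (hC'.firstIntegral j).1.mono inter_subset_right
  have hO : ∀ x, IsOpen (chartTarget n x ∩ chartInv n x ⁻¹' (U ∩ U')) := fun x ↦
    isOpen_chart_preimage hUU
  have hC's : ContMDiffOn (𝓡 (2 * n + 1)) (𝓡 k) ∞ C' (U ∩ U') := hC'.smooth.mono inter_subset_right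
  have hcd := fun x ↦ contDiffOn_comp_chartInv (x := x) hC's
  have hX := fun x j ↦ (isHamiltonianOn_chartField hα x hUU (hfi j)).smooth_field
  have hX' := fun x j ↦ (isHamiltonianOn_chartField hα x hUU (hfi' j)).smooth_field
  have hread : ∀ x, ∀ e ∈ chartTarget n x ∩ chartInv n x ⁻¹' (U ∩ U'), ∀ f : M → ℝ,
      tangentDeriv C' (chartInv n x e) (contactField α f (chartInv n x e)) =
        fderiv ℝ (C' ∘ chartInv n x) e (chartField x (contactField α f) e) := by
    intro x e he f
    rw [← chartFrame_chartField he.1 (contactField α f)]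
    exact mfderiv_chartFrame he.1 (mdifferentiableAt_of_contMDiffOn hUU hC's he.2) _
  have hg : ∀ x j, ContDiffOn ℝ ∞ (fun e ↦ fderiv ℝ (C' ∘ chartInv n x) e
      (chartField x (contactField α (h j)) e)) (chartTarget n x ∩ chartInv n x ⁻¹' (U ∩ U')) :=
    fun x j ↦ ((hcd x).fderiv_of_isOpen (hO x) (by norm_cast)).clm_apply (hX x j)
  have hm : ∀ x, ContDiffOn ℝ ∞ (transition h α C' ∘ chartInv n x)
      (chartTarget n x ∩ chartInv n x ⁻¹' (U ∩ U')) := fun x ↦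
    (contDiffOn_frameMap (hg x)).congr fun e he ↦ by
      simp only [Function.comp_apply, transition, hread x e he]
  have hsm : ContMDiffOn (𝓡 (2 * n + 1))
      𝓘(ℝ, EuclideanSpace ℝ (Fin k) →L[ℝ] EuclideanSpace ℝ (Fin k)) ∞
      (transition h α C') (U ∩ U') := by
    intro x hx
    have he := self_mem_chart_preimage (n := n) hx
    have h1 := contMDiffAt_of_comp_chartInv he.1 ((hm x).contDiffAt ((hO x).mem_nhds he))
    rw [chartInv, extChartAt_to_inv] at h1
    exact h1.contMDiffWithinAt
  refine ⟨hsm, fun x hx u hu ↦ ⟨?_, hC.frameMap_tangentDeriv hx.1 _ hu⟩⟩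
  rw [hC'.span x hx.2] at hu
  induction hu using Submodule.span_induction with
  | zero => exact map_zero _
  | add u v _ _ h1 h2 => rw [map_add, h1, h2, add_zero]
  | smul c u _ h1 =>
    rw [map_smul, h1]
    exact smul_zero (A := EuclideanSpace ℝ (Fin k) →L[ℝ] EuclideanSpace ℝ (Fin k)) c
  | mem u hu =>
    obtain ⟨l, rfl⟩ := hu
    have he := self_mem_chart_preimage (n := n) hx
    set e := extChartAt (𝓡 (2 * n + 1)) x x with he_def
    have hxe : chartInv n x e = x := extChartAt_to_inv x
    have h1 : tangentDeriv (transition h α C') (chartInv n x e)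
        (contactField α (h' l) (chartInv n x e)) =
        fderiv ℝ (transition h α C' ∘ chartInv n x) e (chartField x (contactField α (h' l)) e) := by
      rw [← chartFrame_chartField he.1 (contactField α (h' l))]
      exact mfderiv_chartFrame he.1 (mdifferentiableAt_of_contMDiffOn hUU hsm he.2) _
    rw [hxe] at h1
    rw [h1]
    have hcomp : ∀ j, fderiv ℝ (transition h α C' ∘ chartInv n x) e
        (chartField x (contactField α (h' l)) e) (EuclideanSpace.single j 1) = 0 := by
      intro j
      have h2 := ((ContDiffOn.hasFDerivAt_of_isOpen (hm x) (hO x) he).clm_apply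
        (hasFDerivAt_const (EuclideanSpace.single j (1 : ℝ)) e)).congr_of_eventuallyEq
        (f₁ := fun e ↦ fderiv ℝ (C' ∘ chartInv n x) e
          (chartField x (contactField α (h j)) e)) (by
          filter_upwards [(hO x).mem_nhds he] with e' he'
          rw [Function.comp_apply, transition, frameMap_single, hread x e' he'])
      have h3 := congrArg (fun L ↦ L (chartField x (contactField α (h' l)) e)) h2.fderiv
      have h4 := fderiv_apply_lieBracket (hO x) (hX' x l) (hX x j) (hcd x) he
      have h5 : (fun e ↦ fderiv ℝ (C' ∘ chartInv n x) e
          (chartField x (contactField α (h' l)) e)) =ᶠ[𝓝 e]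
          fun _ ↦ EuclideanSpace.single l (1 : ℝ) := by
        filter_upwards [(hO x).mem_nhds he] with e' he'
        rw [← hread x e' he', hC'.dual _ he'.2.2]
      have h6 := lieBracket_chartField_eq_zero (x := x) hα hUU (hfi' l) (hfi j)
        (fun z hz ↦ jacobiBracket_eq_zero (F := F) hα hZ hUU
          ⟨hfi' l, fun y hy v hv ↦ (hC'.firstIntegral l).2 y hy.2 v (hpre.le_pseudoOrth hα hZ y hv)⟩
          ⟨hfi j, fun y hy ↦ (hC.firstIntegral j).2 y hy.1⟩ hz) he
      rw [h6, map_zero, h5.fderiv_eq, fderiv_const_apply, zero_apply, sub_zero, h3] at h4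
      simpa using h4.symm
    refine ContinuousLinearMap.coe_injective
      ((EuclideanSpace.basisFun (Fin k) ℝ).toBasis.ext fun j ↦ ?_)
    simpa using hcomp j

end IsAdaptedOn

theorem tangentDeriv_clm_comp {Q R : Type*} [NormedAddCommGroup Q] [NormedSpace ℝ Q]
    [NormedAddCommGroup R] [NormedSpace ℝ R] (A : Q →L[ℝ] R) {f : M → Q}
    (hf : MDifferentiableAt (𝓡 (2 * n + 1)) 𝓘(ℝ, Q) f x) :
    tangentDeriv (fun y ↦ A (f y)) x = A.comp (tangentDeriv (n := n) f x) := by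
  have h1 := mfderiv_comp x (I'' := 𝓘(ℝ, R)) (A.differentiableAt (x := f x)).mdifferentiableAt hf
  rw [mfderiv_eq_fderiv, A.fderiv] at h1
  exact h1

/-- Forgetting the first coordinate. -/
def tailMap (k : ℕ) : EuclideanSpace ℝ (Fin (k + 1)) →L[ℝ] EuclideanSpace ℝ (Fin k) :=
  frameMap (Fin.cons 0 fun i ↦ EuclideanSpace.single i 1)

/-- The inclusion as the last coordinates. -/
def inclMap (k : ℕ) : EuclideanSpace ℝ (Fin k) →L[ℝ] EuclideanSpace ℝ (Fin (k + 1)) :=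
  frameMap fun i ↦ EuclideanSpace.single i.succ 1

theorem tailMap_apply (w : EuclideanSpace ℝ (Fin (k + 1))) (i : Fin k) :
    tailMap k w i = w i.succ := by
  rw [tailMap, frameMap_apply, Fin.sum_univ_succ]
  simp [Pi.single_apply]

theorem eq_single_add_inclMap (w : EuclideanSpace ℝ (Fin (k + 1))) :
    w = w 0 • EuclideanSpace.single 0 1 + inclMap k (tailMap k w) := by
  ext i
  rw [inclMap, frameMap_apply]
  refine Fin.cases ?_ (fun j ↦ ?_) i
  · simp
  · simp [Pi.single_apply, tailMap_apply]

/-- The integral manifolds of `F` have affine structures. -/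
theorem IsIntegralManifold.hasAffineStructure_of_isPreIsotropic (hpre : IsPreIsotropic α F)
    (hF : IsFoliation F p) (hα : IsContactForm α) (hZ : ∀ x, reeb α x ∈ F x)
    (hE : IsFoliation (pseudoOrth α F) r) {L : Type u} [TopologicalSpace L]
    [ChartedSpace (EuclideanSpace ℝ (Fin (r + 1))) L] [IsManifold (𝓡 (r + 1)) ∞ L] {ι : L → M}
    (hι : IsIntegralManifold F (k := r + 1) ι) : HasAffineStructure (r + 1) L := by
  refine hι.hasAffineStructure
    (J := {t : Set M × (Fin (r + 1) → M → ℝ) × (M → EuclideanSpace ℝ (Fin (r + 1))) //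
      IsAdaptedOn α F t.1 t.2.1 t.2.2}) (fun t ↦ t.1.1) (fun t ↦ t.1.2.2)
    (fun t ↦ t.2.isOpen) (fun t ↦ t.2.smooth) (fun x ↦ ?_) (fun t x hx u hu h0 ↦ ?_)
    (fun t t' ↦ ⟨_, t.2.transition_spec t'.2 hpre hα hZ⟩)
  · obtain ⟨U, h, C, hx, hC, -⟩ := exists_isAdaptedOn hpre hF hα hZ hE x
    exact ⟨⟨(U, h, C), hC⟩, hx⟩
  · rw [t.2.eq_sum hx hu, h0]
    simp

/-- The integral manifolds of the horizontal part have affine structures. -/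
theorem IsIntegralManifold.hasAffineStructure_of_horizontalPart (hpre : IsPreIsotropic α F)
    (hF : IsFoliation F p) (hα : IsContactForm α) (hZ : ∀ x, reeb α x ∈ F x)
    (hE : IsFoliation (pseudoOrth α F) r) {L : Type u} [TopologicalSpace L]
    [ChartedSpace (EuclideanSpace ℝ (Fin r)) L] [IsManifold (𝓡 r) ∞ L] {ι : L → M}
    (hι : IsIntegralManifold (horizontalPart α F) (k := r) ι) : HasAffineStructure r L := by
  have hmd : ∀ {Q : Type} [NormedAddCommGroup Q] [NormedSpace ℝ Q] {f : M → Q} {V : Set M},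
      IsOpen V → ContMDiffOn (𝓡 (2 * n + 1)) 𝓘(ℝ, Q) ∞ f V → ∀ x ∈ V,
      MDifferentiableAt (𝓡 (2 * n + 1)) 𝓘(ℝ, Q) f x := fun hV hf x hx ↦
    mdifferentiableAt_of_contMDiffOn hV hf hx
  -- The coordinate dual to the Reeb field is dropped, which is why only adapted families with `h 0
  -- = 1` are admitted.
  refine hι.hasAffineStructure
    (J := {t : Set M × (Fin (r + 1) → M → ℝ) × (M → EuclideanSpace ℝ (Fin (r + 1))) //
      IsAdaptedOn α F t.1 t.2.1 t.2.2 ∧ t.2.1 0 = fun _ ↦ 1}) (fun t ↦ t.1.1)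
    (fun t x ↦ tailMap r (t.1.2.2 x))
    (fun t ↦ t.2.1.isOpen) (fun t ↦ (tailMap r).contDiff.contMDiff.comp_contMDiffOn t.2.1.smooth)
    (fun x ↦ ?_) (fun t x hx u hu h0 ↦ ?_) (fun t t' ↦ ?_)
  · obtain ⟨U, h, C, hx, hC⟩ := exists_isAdaptedOn hpre hF hα hZ hE x
    exact ⟨⟨(U, h, C), hC⟩, hx⟩
  · rw [tangentDeriv_clm_comp _ (hmd t.2.1.isOpen t.2.1.smooth x hx)] at h0
    have h1 := t.2.1.eq_sum hx hu.1
    have h2 : ∀ i : Fin r, tangentDeriv t.1.2.2 x u i.succ = 0 := fun i ↦ by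
      rw [← tailMap_apply]
      exact congrArg (fun w : EuclideanSpace ℝ (Fin r) ↦ w i) h0
    rw [Fin.sum_univ_succ, Finset.sum_eq_zero fun i _ ↦ by rw [h2, zero_smul], add_zero,
      t.2.2, (hα.isContactAt x).contactField_one] at h1
    have h3 : α x u = 0 := hu.2
    rw [h1, map_smul, (hα.isContactAt x).apply_reeb, smul_eq_mul, mul_one] at h3
    rw [h1, h3, zero_smul]
  · obtain ⟨hsm, hsp⟩ := t.2.1.transition_spec t'.2.1 hpre hα hZ
    have hUU := t.2.1.isOpen.inter t'.2.1.isOpen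
    let A : (EuclideanSpace ℝ (Fin (r + 1)) →L[ℝ] EuclideanSpace ℝ (Fin (r + 1))) →L[ℝ]
        (EuclideanSpace ℝ (Fin r) →L[ℝ] EuclideanSpace ℝ (Fin r)) :=
      ((tailMap r).postcomp _).comp ((inclMap r).precomp _)
    have hA : ∀ B w, A B w = tailMap r (B (inclMap r w)) := fun B w ↦ rfl
    refine ⟨fun x ↦ A (IsAdaptedOn.transition t.1.2.1 α t'.1.2.2 x),
      A.contDiff.contMDiff.comp_contMDiffOn hsm, fun x hx u hu ↦ ⟨?_, ?_⟩⟩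
    · rw [tangentDeriv_clm_comp _ (hmd hUU hsm x hx), ContinuousLinearMap.comp_apply,
        (hsp x hx u hu.1).1, map_zero]
    · rw [tangentDeriv_clm_comp _ (hmd t.2.1.isOpen t.2.1.smooth x hx.1),
        tangentDeriv_clm_comp _ (hmd t'.2.1.isOpen t'.2.1.smooth x hx.2),
        ContinuousLinearMap.comp_apply, ContinuousLinearMap.comp_apply, (hsp x hx u hu.1).2, hA]
      conv_lhs => rw [eq_single_add_inclMap (tangentDeriv t.1.2.2 x u)]
      -- Both families start with the Reeb field, so the transition fixes the first basis vector and
      -- descends to the remaining coordinates.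
      have h1 : IsAdaptedOn.transition t.1.2.1 α t'.1.2.2 x (EuclideanSpace.single 0 1) =
          EuclideanSpace.single 0 1 := by
        have h2 := t'.2.1.dual x hx.2 0
        rw [t'.2.2] at h2
        rw [IsAdaptedOn.transition, frameMap_single, t.2.2, h2]
      rw [map_add, map_add, map_smul, map_smul, h1]
      have h2 : tailMap r (EuclideanSpace.single 0 1) = 0 := by
        rw [tailMap, frameMap_single, Fin.cons_zero]
      rw [h2, smul_zero, zero_add]

end AdaptedFunctions

end ContactFoliation

end

/-! ### The main theorem. -/

theorem theorem2 (n p r : ℕ) (hpr : p + r = 2 * n) {M : Type u} [TopologicalSpace M]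
    [ChartedSpace (EuclideanSpace ℝ (Fin (2 * n + 1))) M] [IsManifold (𝓡 (2 * n + 1)) ∞ M]
    [T2Space M] [SecondCountableTopology M] [ConnectedSpace M]
    (α : ContactFoliation.OneForm n M) (hα : ContactFoliation.IsContactForm α)
    (F : ContactFoliation.PlaneField n M) (hF : ContactFoliation.IsFoliation F p)
    (hZ : ∀ x, ContactFoliation.reeb α x ∈ F x)
    (G : ContactFoliation.PlaneField n M) (hG : G = ContactFoliation.horizontalPart α F)
    (E : ContactFoliation.PlaneField n M) (hE : E = ContactFoliation.pseudoOrth α F) :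
    -- (i) the flag, and its converse
    (ContactFoliation.IsPreIsotropic α F →
      ContactFoliation.SatisfiesFlag α F ∧ ContactFoliation.IsDistribution G r ∧
        ContactFoliation.IsDistribution F (r + 1) ∧ ContactFoliation.IsDistribution E (p + 1)) ∧
    (ContactFoliation.SatisfiesFlag α F → ContactFoliation.IsPreIsotropic α F) ∧
    (ContactFoliation.IsPreIsotropic α F →
      -- `G` is a foliation, too
      ContactFoliation.IsFoliation G (p + 1) ∧
      -- (ii) completeness and integrability
      (ContactFoliation.IsAlphaComplete α F ↔ ContactFoliation.IsCompletelyIntegrable E) ∧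
      (ContactFoliation.IsAlphaComplete α G ↔ ContactFoliation.IsCompletelyIntegrable E) ∧
      (ContactFoliation.IsCompletelyIntegrable E →
        ∀ U : Set M, IsOpen U → ∀ (f : Fin p → M → ℝ) (y : Fin r → M → ℝ),
          (∀ i, ContactFoliation.IsFirstIntegralOn F U (f i)) →
          (∀ j, ContactFoliation.IsFirstIntegralOn E U (y j)) →
          ∀ x ∈ U,
            (∀ i j, ContactFoliation.jacobiBracket α (f i) (y j) x = 0) ∧
            (∀ j k, ContactFoliation.jacobiBracket α (y j) (y k) x = 0) ∧
            (∀ i, ContactFoliation.jacobiBracket α (f i) (fun _ ↦ 1) x = 0) ∧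
            (∀ j, ContactFoliation.jacobiBracket α (y j) (fun _ ↦ 1) x = 0)) ∧
      -- (iii) affine structures on the leaves
      (ContactFoliation.IsAlphaComplete α F →
        (∀ (L : Type u) [TopologicalSpace L] [ChartedSpace (EuclideanSpace ℝ (Fin (r + 1))) L]
          [IsManifold (𝓡 (r + 1)) ∞ L] (ι : L → M),
          ContactFoliation.IsLeaf F (k := r + 1) ι → ContactFoliation.HasAffineStructure (r + 1) L) ∧
        (∀ (L : Type u) [TopologicalSpace L] [ChartedSpace (EuclideanSpace ℝ (Fin r)) L]
          [IsManifold (𝓡 r) ∞ L] (ι : L → M),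
          ContactFoliation.IsLeaf G (k := r) ι → ContactFoliation.HasAffineStructure r L))) := by
  subst hG hE
  have hcontact := hα.isContactAt
  refine ⟨fun hpre ↦ ⟨hpre.satisfiesFlag hcontact hZ,
    hF.isDistribution_horizontalPart hα hZ hpr, hF.isDistribution (by omega),
    hF.isDistribution_pseudoOrth hα hZ⟩, fun h ↦ h.isPreIsotropic hcontact hZ, fun hpre ↦ ?_⟩
  -- The cycle: E integrable ⇒ G complete ⇒ F complete ⇒ E integrable yields both equivalences.
  have hEG : ContactFoliation.IsCompletelyIntegrable (ContactFoliation.pseudoOrth α F) →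
      ContactFoliation.IsAlphaComplete α (ContactFoliation.horizontalPart α F) :=
    fun ⟨_, h⟩ ↦ h.isAlphaComplete_horizontalPart hα hZ
  have hGF : ContactFoliation.IsAlphaComplete α (ContactFoliation.horizontalPart α F) →
      ContactFoliation.IsAlphaComplete α F := fun h ↦ h.of_horizontalPart hα hZ
  have hFE : ContactFoliation.IsAlphaComplete α F →
      ContactFoliation.IsFoliation (ContactFoliation.pseudoOrth α F) r :=
    fun h ↦ h.isFoliation_pseudoOrth hF hα hZ hpr
  refine ⟨hpre.isFoliation_horizontalPart hF hα hZ,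
    ⟨fun h ↦ ⟨r, hFE h⟩, fun h ↦ hGF (hEG h)⟩, ⟨fun h ↦ ⟨r, hFE (hGF h)⟩, hEG⟩,
    fun _ U hU f y hf hy x hx ↦ ?_, fun hc ↦ ⟨fun L _ _ _ ι hι ↦ ?_, fun L _ _ _ ι hι ↦ ?_⟩⟩
  · have hyF := fun j ↦ (hy j).anti (hpre.le_pseudoOrth hα hZ)
    exact ⟨fun i j ↦ ContactFoliation.jacobiBracket_eq_zero hα hZ hU (hf i) (hy j) hx,
      fun j k ↦ ContactFoliation.jacobiBracket_eq_zero hα hZ hU (hyF j) (hy k) hx,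
      fun i ↦ ContactFoliation.jacobiBracket_one_eq_zero hα hZ hU (hf i) hx,
      fun j ↦ ContactFoliation.jacobiBracket_one_eq_zero hα hZ hU (hyF j) hx⟩
  · exact hι.toIsIntegralManifold.hasAffineStructure_of_isPreIsotropic hpre hF hα hZ (hFE hc)
  · exact hι.toIsIntegralManifold.hasAffineStructure_of_horizontalPart hpre hF hα hZ (hFE hc)
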